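/- Fix $d\ge 1$ and a finite $T\ge 0$. Let $\mathcal M_{+,1}(\mathbb R^{2d})$ be the space of subprobability measures on $\mathbb R^{2d}$ with the weak topology, and let $\mathcal D_T=\mathcal D([0,T];\mathcal M_{+,1}(\mathbb R^{2d}))$ be the space of càdlàg paths with the Skorokhod ($J_1$) topology. Let $f_0$ be a probability density on $\mathbb R^{2d}$ with $\|f_0\|_{L^\infty}\le\Gamma<\infty$ and supported in a Euclidean ball of finite radius $R$ centred at $0$. Let $\theta\in C^\infty(\mathbb R^d)$ be nonnegative and even, with $\int\theta\,dx=1$, $\theta(0)=0$ and support in the closed unit ball, and put $\theta^\varepsilon(x)=\varepsilon^{-d}\theta(\varepsilon^{-1}x)$. Let $\varepsilon=\varepsilon(N)\in(0,1]$ satisfy $\varepsilon(N)\to0$ and $\limsup_{N\to\infty}\varepsilon(N)^{-d}/N\le1$. Let $(x_i(0),v_i(0))_{i\ge1}$ be i.i.d. with density $f_0$, let $(B_i)_{i\ge1}$ be independent standard Brownian motions in $\mathbb R^d$, independent of the initial data, and let $$X_i(t)=\Big(x_i(0)+v_i(0)t+\int_0^tB_i(s)\,ds,\ v_i(0)+B_i(t)\Big)$$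 be the free particles. In the $N$-particle system ($N\ge1$) all particles $i=1,\dots,N$ are active at time $0$; an active particle $i$ has position and velocity $(x_i^N(t),v_i^N(t))=X_i(t)$; and each ordered pair $(i,j)$, $i\ne j$, of active particles rings at infinitesimal rate $\frac1N\theta^{\varepsilon}(x_i^N-x_j^N)$, whereupon both particles are removed. Precisely, the ordered pairs carry i.i.d. exponential clocks of rate $1$, independent of everything else; the pair $(i,j)$ rings at the first time at which $\int_0^t\frac1N\theta^\varepsilon(x_i(s)-x_j(s))\,ds$, computed along the free trajectories, reaches its clock; and a ring removes $i$ and $j$ if both are still active. This realizes the jointly Markov system whose generator has jump part $\sum_{i}\sum_{j\ne i}\frac1N\theta^\varepsilon(x_i-x_j)[F(\zeta^{-ij})-F(\zeta)]$ (sums over active particles; $\zeta^{-ij}$ is the configuration $\zeta$ with $i$ and $j$ removed). With $\mathcal N(t)$ the set of active particles, let $$\mu_t^N=\frac1N\sum_{i\in\mathcal N(t)}\delta_{(x_i^N(t),v_i^N(t))},\qquad t\in[0,T].$$ Then, for every $t\ge 0$, the law of $X_1(t)$ has a density $\mathsf p(t,x,v)$ with respect to Lebesgue measure; almost surely $\mu^N$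 is a càdlàg path, and it defines a $\mathcal D_T$-valued random variable. The sequence of laws of $(\mu^N)_{N\ge1}$ is weakly relatively compact, i.e. it has compact closure in the space of Borel probability measures on $\mathcal D_T$ with the weak topology. If $Q$ is the weak limit of these laws along any subsequence, then for $Q$-almost every path $(\mu_t)_{t\in[0,T]}$ and for every $t\in[0,T]$, the measure $\mu_t$ is absolutely continuous with respect to Lebesgue measure, with a nonnegative density $f(t,\cdot)$ satisfying $f(t,x,v)\le\mathsf p(t,x,v)$ for almost every $(x,v)\in\mathbb R^{2d}$. -/

import Mathlib

open MeasureTheory ProbabilityTheory Filter Topology Set Metric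
open scoped ENNReal NNReal BoundedContinuousFunction

namespace AnnihilatingParticles

section LevyProkhorovTopology

variable {X : Type*} [MeasurableSpace X] [PseudoMetricSpace X] [OpensMeasurableSpace X]

lemma tendsto_integral_thickening (f : X →ᵇ ℝ) (μ : FiniteMeasure X) :
    Tendsto (fun ε ↦ ∫ t in Ioc 0 ‖f‖, (μ : Measure X).real (thickening ε {a | t ≤ f a}))
      (𝓝[>] (0 : ℝ)) (𝓝 (∫ t in Ioc 0 ‖f‖, (μ : Measure X).real {a | t ≤ f a})) := by
  apply tendsto_integral_filter_of_dominated_convergence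
    (fun _ ↦ (μ : Measure X).real univ)
  · refine Eventually.of_forall fun n ↦ Measurable.aestronglyMeasurable ?_
    refine Antitone.measurable fun s t hst ↦ ?_
    exact measureReal_mono (thickening_subset_of_subset _ fun ω h ↦ hst.trans h)
  · refine Eventually.of_forall fun i ↦ Eventually.of_forall fun t ↦ ?_
    rw [Real.norm_eq_abs, abs_of_nonneg measureReal_nonneg]
    exact measureReal_mono (subset_univ _)
  · exact integrable_const _
  · refine Eventually.of_forall fun t ↦ ?_
    refine (ENNReal.tendsto_toReal (measure_ne_top _ _)).comp ?_
    exact tendsto_measure_thickening_of_isClosed ⟨1, Real.zero_lt_one, measure_ne_top _ _⟩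
      (isClosed_le continuous_const f.continuous)

lemma eventually_integral_le (μ : LevyProkhorov (FiniteMeasure X)) (f : X →ᵇ ℝ) (hf : 0 ≤ f)
    {δ : ℝ} (hδ : 0 < δ) :
    ∀ᶠ ν in 𝓝 μ,
      ∫ x, f x ∂(ν.toMeasure : Measure X) < ∫ x, f x ∂(μ.toMeasure : Measure X) + δ := by
  have h1 := tendsto_integral_thickening f μ.toMeasure
  rw [← BoundedContinuousFunction.integral_eq_integral_meas_le f _
    (Eventually.of_forall hf)] at h1
  have h2 : Tendsto (fun ε : ℝ ↦ ε * ‖f‖) (𝓝[>] 0) (𝓝 (0 * ‖f‖)) :=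
    (tendsto_id.mono_left nhdsWithin_le_nhds).mul_const _
  have h3 := h1.add h2
  rw [zero_mul, add_zero] at h3
  have h4 := h3.eventually (Iio_mem_nhds (lt_add_of_pos_right _ hδ))
  obtain ⟨ε, hε, hε0⟩ := (h4.and self_mem_nhdsWithin).exists
  have hε0' : (0 : ℝ) < ε := hε0
  filter_upwards [Metric.ball_mem_nhds μ hε0'] with ν hν
  refine (BoundedContinuousFunction.integral_le_of_levyProkhorovEDist_lt
    (ν.toMeasure : Measure X) (μ.toMeasure : Measure X) hε0' ?_ f
    (Eventually.of_forall hf)).trans_lt hε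
  rw [← LevyProkhorov.edist_finiteMeasure_def, edist_dist]
  exact (ENNReal.ofReal_lt_ofReal_iff hε0').2 hν

lemma tendsto_mass (μ : LevyProkhorov (FiniteMeasure X)) :
    Tendsto (fun ν : LevyProkhorov (FiniteMeasure X) ↦ (ν.toMeasure : Measure X).real univ)
      (𝓝 μ) (𝓝 ((μ.toMeasure : Measure X).real univ)) := by
  rw [Metric.tendsto_nhds]
  intro ε hε
  filter_upwards [Metric.ball_mem_nhds μ (half_pos hε)] with ν hν
  have h : levyProkhorovEDist (ν.toMeasure : Measure X) (μ.toMeasure : Measure X)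
      < ENNReal.ofReal (ε / 2) := by
    rw [← LevyProkhorov.edist_finiteMeasure_def, edist_dist]
    exact (ENNReal.ofReal_lt_ofReal_iff (half_pos hε)).2 hν
  have aux : ∀ (a b : FiniteMeasure X) (s : Set X),
      (a : Measure X) univ ≤ (b : Measure X) s + ENNReal.ofReal (ε / 2) →
      (a : Measure X).real univ ≤ (b : Measure X).real univ + ε / 2 := by
    intro a b s h
    have h' : (a : Measure X) univ ≤ (b : Measure X) univ + ENNReal.ofReal (ε / 2) :=
      h.trans (by gcongr; exact subset_univ _)
    have := ENNReal.toReal_mono (by finiteness) h'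
    rwa [ENNReal.toReal_add (by finiteness) (by finiteness),
      ENNReal.toReal_ofReal (half_pos hε).le] at this
  have h1 := aux _ _ _ (left_measure_le_of_levyProkhorovEDist_lt h MeasurableSet.univ)
  have h2 := aux _ _ _ (right_measure_le_of_levyProkhorovEDist_lt h MeasurableSet.univ)
  rw [Real.dist_eq, abs_lt]
  constructor <;> linarith

lemma continuous_toMeasure :
    Continuous (LevyProkhorov.toMeasure : LevyProkhorov (FiniteMeasure X) → FiniteMeasure X) := by
  rw [continuous_iff_continuousAt]
  intro μ
  rw [ContinuousAt, FiniteMeasure.tendsto_iff_forall_integral_tendsto]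
  intro f
  have hi : ∀ (ν : FiniteMeasure X) (c : ℝ), ∫ x, (BoundedContinuousFunction.const X c + f) x
      ∂(ν : Measure X) = (ν : Measure X).real univ * c + ∫ x, f x ∂(ν : Measure X) := by
    intro ν c
    simp only [BoundedContinuousFunction.coe_add, Pi.add_apply,
      BoundedContinuousFunction.const_apply]
    rw [integral_add (integrable_const _) (f.integrable _), integral_const, smul_eq_mul]
  have hi' : ∀ (ν : FiniteMeasure X) (c : ℝ), ∫ x, (BoundedContinuousFunction.const X c - f) x
      ∂(ν : Measure X) = (ν : Measure X).real univ * c - ∫ x, f x ∂(ν : Measure X) := by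
    intro ν c
    simp only [BoundedContinuousFunction.coe_sub, Pi.sub_apply,
      BoundedContinuousFunction.const_apply]
    rw [integral_sub (integrable_const _) (f.integrable _), integral_const, smul_eq_mul]
  have hm := (tendsto_mass μ).mul_const ‖f‖
  rw [Metric.tendsto_nhds] at hm ⊢
  intro ε hε
  filter_upwards [hm (ε / 2) (half_pos hε),
    eventually_integral_le μ (BoundedContinuousFunction.const X ‖f‖ + f)
      (fun x ↦ by
        have := (abs_le.1 (f.norm_coe_le_norm x)).1
        change (0 : ℝ) ≤ ‖f‖ + f x
        linarith) (half_pos hε),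
    eventually_integral_le μ (BoundedContinuousFunction.const X ‖f‖ - f)
      (fun x ↦ by
        have := (abs_le.1 (f.norm_coe_le_norm x)).2
        change (0 : ℝ) ≤ ‖f‖ - f x
        linarith) (half_pos hε)] with ν h1 h2 h3
  rw [hi, hi] at h2
  rw [hi', hi'] at h3
  rw [Real.dist_eq, abs_lt] at h1 ⊢
  constructor <;> linarith [h1.1, h1.2]

lemma eventually_measure_open_lt (μ : FiniteMeasure X) {G : Set X} (hG : IsOpen G) {δ : ℝ}
    (hδ : 0 < δ) :
    ∀ᶠ ν : FiniteMeasure X in 𝓝 μ, (μ : Measure X).real G < (ν : Measure X).real G + δ := by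
  have h1 : ∀ᶠ ν : FiniteMeasure X in 𝓝 μ,
      (ν : Measure X) Gᶜ < (μ : Measure X) Gᶜ + ENNReal.ofReal (δ / 2) := by
    have h := FiniteMeasure.limsup_measure_closed_le_of_tendsto (tendsto_id (x := 𝓝 μ))
      hG.isClosed_compl
    exact Filter.eventually_lt_of_limsup_lt (h.trans_lt
      (ENNReal.lt_add_right (by finiteness) (by simpa using hδ)))
  have h2 : Tendsto (fun ν : FiniteMeasure X ↦ ((ν.mass : ℝ≥0) : ℝ)) (𝓝 μ) (𝓝 μ.mass) :=
    (NNReal.continuous_coe.comp FiniteMeasure.continuous_mass).tendsto μ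
  filter_upwards [h1, h2.eventually (Ioi_mem_nhds (sub_lt_self _ (half_pos hδ)))] with ν h3 h4
  have e : ∀ ν : FiniteMeasure X,
      (ν.mass : ℝ) = (ν : Measure X).real G + (ν : Measure X).real Gᶜ := fun ν ↦
    (measureReal_add_measureReal_compl hG.measurableSet).symm
  have h5 := ENNReal.toReal_strict_mono (by finiteness) h3
  rw [ENNReal.toReal_add (by finiteness) (by finiteness),
    ENNReal.toReal_ofReal (half_pos hδ).le] at h5
  change (ν : Measure X).real Gᶜ < (μ : Measure X).real Gᶜ + δ / 2 at h5
  have h6 : (μ.mass : ℝ) - δ / 2 < ν.mass := h4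
  rw [e, e] at h6
  linarith

lemma continuous_ofMeasure [TopologicalSpace.SeparableSpace X] :
    Continuous (LevyProkhorov.ofMeasure : FiniteMeasure X → LevyProkhorov (FiniteMeasure X)) := by
  rw [continuous_iff_continuousAt]
  intro μ
  rw [ContinuousAt, Metric.tendsto_nhds]
  intro ε hε
  set η := ε / 5 with hη
  have hη0 : 0 < η := by positivity
  obtain ⟨A, hAm, hAb, hAd, hAc, hAdisj⟩ :=
    SeparableSpace.exists_measurable_partition_diam_le X hη0
  obtain ⟨N, hN⟩ : ∃ N, (μ : Measure X).real (⋃ i, ⋃ (_ : N ≤ i), A i) < η := by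
    have h := tendsto_measure_biUnion_Ici_zero_of_pairwise_disjoint (μ := (μ : Measure X))
      (fun n ↦ (hAm n).nullMeasurableSet) hAdisj
    have h' := (ENNReal.tendsto_toReal ENNReal.zero_ne_top).comp h
    exact (h'.eventually (Iio_mem_nhds hη0)).exists
  have hG : ∀ᶠ ν : FiniteMeasure X in 𝓝 μ, ∀ J ∈ (Finset.range N).powerset,
      (μ : Measure X).real (thickening η (⋃ j ∈ J, A j))
        < (ν : Measure X).real (thickening η (⋃ j ∈ J, A j)) + η := by
    rw [Filter.eventually_all_finset]
    exact fun J _ ↦ eventually_measure_open_lt μ isOpen_thickening hη0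
  have hM : Tendsto (fun ν : FiniteMeasure X ↦ ((ν.mass : ℝ≥0) : ℝ)) (𝓝 μ) (𝓝 μ.mass) :=
    (NNReal.continuous_coe.comp FiniteMeasure.continuous_mass).tendsto μ
  filter_upwards [hG, hM.eventually (Iio_mem_nhds (lt_add_of_pos_right _ hη0))] with ν hν hνm
  have hνm' : (ν : Measure X).real univ < (μ : Measure X).real univ + η := hνm
  have key : ∀ r, 2 * η < r → ∀ B : Set X,
      (μ : Measure X).real B ≤ (ν : Measure X).real (thickening r B) + 2 * η := by
    intro r hr B
    classical
    set J := (Finset.range N).filter fun j ↦ (B ∩ A j).Nonempty with hJ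
    have h1 : B ⊆ thickening η (⋃ j ∈ J, A j) ∪ ⋃ i, ⋃ (_ : N ≤ i), A i := by
      intro x hx
      obtain ⟨i, hi⟩ := mem_iUnion.1 (hAc.symm ▸ mem_univ x : x ∈ ⋃ n, A n)
      by_cases hiN : N ≤ i
      · exact Or.inr (mem_iUnion₂.2 ⟨i, hiN, hi⟩)
      · refine Or.inl (self_subset_thickening hη0 _ (mem_iUnion₂.2 ⟨i, ?_, hi⟩))
        simp only [hJ, Finset.mem_filter, Finset.mem_range]
        exact ⟨by omega, x, hx, hi⟩
    have h2 : thickening η (⋃ j ∈ J, A j) ⊆ thickening r B := by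
      intro x hx
      obtain ⟨w, hw, hxw⟩ := mem_thickening_iff.1 hx
      obtain ⟨j, hj, hwj⟩ := mem_iUnion₂.1 hw
      obtain ⟨z, hzB, hzj⟩ := (Finset.mem_filter.1 hj).2
      refine mem_thickening_iff.2 ⟨z, hzB, ?_⟩
      have h3 := (dist_le_diam_of_mem (hAb j) hwj hzj).trans (hAd j)
      linarith [dist_triangle x w z]
    have h3 := hν J (Finset.mem_powerset.2 (Finset.filter_subset _ _))
    have h4 := (measureReal_mono h1 (by finiteness)).trans
      (measureReal_union_le (μ := (μ : Measure X)) _ _)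
    have h5 : (ν : Measure X).real _ ≤ (ν : Measure X).real _ :=
      measureReal_mono h2 (by finiteness)
    linarith
  have conv : ∀ (a b : FiniteMeasure X) (s t : Set X) (r : ℝ≥0∞), r ≠ ∞ →
      (a : Measure X).real s ≤ (b : Measure X).real t + r.toReal →
      (a : Measure X) s ≤ (b : Measure X) t + r := by
    intro a b s t r hr h
    rw [measureReal_def, measureReal_def, ← ENNReal.toReal_add (by finiteness) hr] at h
    exact (ENNReal.toReal_le_toReal (by finiteness) (by finiteness)).1 h
  have hle : levyProkhorovEDist (μ : Measure X) (ν : Measure X) ≤ ENNReal.ofReal (4 * η) := by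
    refine levyProkhorovEDist_le_of_forall _ _ _ fun r B hr hr' hB ↦ ?_
    have hr4 : 4 * η < r.toReal := by
      rwa [← ENNReal.ofReal_lt_iff_lt_toReal (by positivity) hr'.ne]
    refine ⟨conv _ _ _ _ _ hr'.ne ((key _ (by linarith) B).trans (by linarith)),
      conv _ _ _ _ _ hr'.ne ?_⟩
    have h1 := key r.toReal (by linarith) (thickening r.toReal B)ᶜ
    have h2 : (ν : Measure X).real B
        ≤ (ν : Measure X).real (thickening r.toReal (thickening r.toReal B)ᶜ)ᶜ :=
      measureReal_mono (subset_compl_thickening_compl_thickening_self _ _) (by finiteness)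
    have h3 := measureReal_add_measureReal_compl (μ := (ν : Measure X))
      (isOpen_thickening (δ := r.toReal) (E := (thickening r.toReal B)ᶜ)).measurableSet
    have h4 := measureReal_add_measureReal_compl (μ := (μ : Measure X))
      (isOpen_thickening (δ := r.toReal) (E := B)).measurableSet
    linarith
  rw [dist_comm, dist_edist, LevyProkhorov.edist_finiteMeasure_def]
  refine (ENNReal.toReal_le_of_le_ofReal (by positivity) hle).trans_lt ?_
  linarith

end LevyProkhorovTopology

section SubprobabilityMeasures

/-- The space `M_{+,1}(X)` of subprobability measures on `X`. -/
def SubProb (X : Type*) [MeasurableSpace X] : Type _ :=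
  {μ : FiniteMeasure X // μ.mass ≤ 1}

variable {X : Type*} [MeasurableSpace X]

/-- The weak topology (tested against bounded continuous functions). -/
instance [TopologicalSpace X] [OpensMeasurableSpace X] : TopologicalSpace (SubProb X) :=
  inferInstanceAs (TopologicalSpace {μ : FiniteMeasure X // μ.mass ≤ 1})

/-- The underlying measure of a subprobability measure. -/
def SubProb.toMeasure (μ : SubProb X) : Measure X := (μ.1 : Measure X)

/-- A measure of total mass at most one, as a point of `SubProb X`. -/
def SubProb.mk (μ : Measure X) (h : μ univ ≤ 1) : SubProb X :=
  ⟨⟨μ, ⟨h.trans_lt ENNReal.one_lt_top⟩⟩, ENNReal.toNNReal_mono ENNReal.one_ne_top h⟩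

/-- The Lévy–Prokhorov metric on subprobability measures; its topology is, definitionally in Lean,
the weak topology. -/
noncomputable instance [PseudoMetricSpace X] [OpensMeasurableSpace X]
    [TopologicalSpace.SeparableSpace X] : PseudoMetricSpace (SubProb X) :=
  (PseudoMetricSpace.induced
    (fun μ : SubProb X ↦ LevyProkhorov.ofMeasure μ.1) inferInstance).replaceTopology <| by
      apply le_antisymm
      · exact continuous_iff_le_induced.1 (continuous_ofMeasure.comp continuous_subtype_val)
      · refine (induced_mono (g := fun μ : SubProb X ↦ LevyProkhorov.ofMeasure μ.1)
          (continuous_iff_le_induced.1 (continuous_toMeasure (X := X)))).trans ?_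
        rw [induced_compose]
        exact le_rfl

end SubprobabilityMeasures

section SkorokhodSpace

/-- Right-continuous functions on `[0,T]` with left limits. -/
def IsCadlag {T : ℝ≥0} {E : Type*} [TopologicalSpace E] (x : Icc (0 : ℝ≥0) T → E) : Prop :=
  ∀ t, ContinuousWithinAt x (Ici t) t ∧ ∃ l, Tendsto x (𝓝[<] t) (𝓝 l)

/-- The space `D([0,T]; E)` of càdlàg paths. -/
def SkorokhodSpace (T : ℝ≥0) (E : Type*) [TopologicalSpace E] : Type _ :=
  {x : Icc (0 : ℝ≥0) T → E // IsCadlag x}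

instance {T : ℝ≥0} {E : Type*} [TopologicalSpace E] :
    CoeFun (SkorokhodSpace T E) (fun _ ↦ Icc (0 : ℝ≥0) T → E) := ⟨fun x ↦ x.1⟩

/-- The Skorokhod (`J₁`) distance: the infimum over increasing bijections `σ` of `[0,T]` of
`max (sup_t |σ t - t|) (sup_t dist (x t) (y (σ t)))`. -/
noncomputable instance {T : ℝ≥0} {E : Type*} [PseudoMetricSpace E] :
    PseudoEMetricSpace (SkorokhodSpace T E) where
  edist x y := ⨅ σ : Icc (0 : ℝ≥0) T ≃o Icc (0 : ℝ≥0) T,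
    max (⨆ t, edist (σ t) t) (⨆ t, edist (x t) (y (σ t)))
  edist_self x := by
    refine le_antisymm (iInf_le_of_le (OrderIso.refl _) ?_) bot_le
    simp
  edist_comm x y := by
    have h : ∀ x y : SkorokhodSpace T E,
        (⨅ σ : Icc (0 : ℝ≥0) T ≃o Icc (0 : ℝ≥0) T,
          max (⨆ t, edist (σ t) t) (⨆ t, edist (x t) (y (σ t))))
        ≤ ⨅ σ : Icc (0 : ℝ≥0) T ≃o Icc (0 : ℝ≥0) T,
          max (⨆ t, edist (σ t) t) (⨆ t, edist (y t) (x (σ t))) := by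
      intro x y
      refine le_iInf fun σ ↦ iInf_le_of_le σ.symm (max_le_max ?_ ?_)
      · refine iSup_le fun t ↦ ?_
        have := le_iSup (fun s ↦ edist (σ s) s) (σ.symm t)
        simpa [edist_comm] using this
      · refine iSup_le fun t ↦ ?_
        have := le_iSup (fun s ↦ edist (y s) (x (σ s))) (σ.symm t)
        simpa [edist_comm] using this
    exact le_antisymm (h x y) (h y x)
  edist_triangle x y z := by
    refine ENNReal.le_iInf_add_iInf fun σ ρ ↦ iInf_le_of_le (σ.trans ρ) (max_le ?_ ?_)
    · refine iSup_le fun t ↦ ?_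
      calc edist (ρ (σ t)) t ≤ edist (σ t) t + edist (ρ (σ t)) (σ t) := by
            rw [add_comm]; exact edist_triangle _ _ _
        _ ≤ _ := add_le_add
            ((le_iSup (fun s ↦ edist (σ s) s) t).trans (le_max_left _ _))
            ((le_iSup (fun s ↦ edist (ρ s) s) (σ t)).trans (le_max_left _ _))
    · refine iSup_le fun t ↦ ?_
      calc edist (x t) (z (ρ (σ t))) ≤ edist (x t) (y (σ t)) + edist (y (σ t)) (z (ρ (σ t))) :=
            edist_triangle _ _ _
        _ ≤ _ := add_le_add
            ((le_iSup (fun s ↦ edist (x s) (y (σ s))) t).trans (le_max_right _ _))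
            ((le_iSup (fun s ↦ edist (y s) (z (ρ s))) (σ t)).trans (le_max_right _ _))

noncomputable instance {T : ℝ≥0} {E : Type*} [PseudoMetricSpace E] : MeasurableSpace (SkorokhodSpace T E) :=
  borel _

instance {T : ℝ≥0} {E : Type*} [PseudoMetricSpace E] : BorelSpace (SkorokhodSpace T E) := ⟨rfl⟩

open Classical in
/-- The path `x` as a point of `D([0,T]; E)`; paths that are not càdlàg are replaced by the
constant path `e`. -/
noncomputable def toSkorokhod {T : ℝ≥0} {E : Type*} [TopologicalSpace E] (e : E)
    (x : Icc (0 : ℝ≥0) T → E) : SkorokhodSpace T E :=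
  if h : IsCadlag x then ⟨x, h⟩
  else ⟨fun _ ↦ e, fun _ ↦ ⟨continuousWithinAt_const, e, tendsto_const_nhds⟩⟩

end SkorokhodSpace

section Annihilation

variable {ι : Type*} [Fintype ι]

/-- Given ring times `τ i j` of ordered pairs, the time of the first ring of a pair in `A`. -/
noncomputable def firstRing (τ : ι → ι → ℝ≥0∞) (A : Finset ι) : ℝ≥0∞ :=
  ⨅ i ∈ A, ⨅ j ∈ A, ⨅ (_ : i ≠ j), τ i j

open Classical in
/-- The set of particles that are active after `k` annihilation events: at each event, which
happens at the first ring of a pair of active particles, that pair is removed (as are any pairs that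
ring at exactly the same time, which has probability zero). -/
noncomputable def survivors (τ : ι → ι → ℝ≥0∞) : ℕ → Finset ι
  | 0 => Finset.univ
  | k + 1 => {i ∈ survivors τ k | ∀ j ∈ survivors τ k, j ≠ i →
      τ i j ≠ firstRing τ (survivors τ k) ∧ τ j i ≠ firstRing τ (survivors τ k)}

/-- The time at which particle `i` is removed (`∞` if it never is). -/
noncomputable def lifetime (τ : ι → ι → ℝ≥0∞) (i : ι) : ℝ≥0∞ :=
  ⨅ (k : ℕ) (_ : i ∉ survivors τ (k + 1)), firstRing τ (survivors τ k)

end Annihilation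

section ParticleSystem

/-- Positions and velocities `(x, v) ∈ ℝ^d × ℝ^d`. -/
abbrev Phase (d : ℕ) : Type := EuclideanSpace ℝ (Fin d) × EuclideanSpace ℝ (Fin d)

variable {d : ℕ} {Ω : Type*}

/-- `f₀` is a probability density on `ℝ^{2d}`, bounded by `Γ` and vanishing outside the Euclidean
ball of radius `R` (almost everywhere). -/
structure IsInitialDensity (f₀ : Phase d → ℝ) (Γ R : ℝ) : Prop where
  measurable : Measurable f₀
  nonneg : ∀ z, 0 ≤ f₀ z
  lintegral_eq_one : ∫⁻ z, ENNReal.ofReal (f₀ z) = 1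
  bounded : ∀ᵐ z, f₀ z ≤ Γ
  support : ∀ᵐ z : Phase d, f₀ z ≠ 0 → ‖z.1‖ ^ 2 + ‖z.2‖ ^ 2 ≤ R ^ 2

/-- The assumptions on the interaction potential `θ`. -/
structure IsInteractionKernel (θ : EuclideanSpace ℝ (Fin d) → ℝ) : Prop where
  smooth : ContDiff ℝ (⊤ : ℕ∞) θ
  nonneg : ∀ x, 0 ≤ θ x
  integral_eq_one : ∫ x, θ x = 1
  zero : θ 0 = 0
  even : ∀ x, θ (-x) = θ x
  support : tsupport θ ⊆ Metric.closedBall 0 1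

/-- `ε(N) ∈ (0,1]`, `ε(N) → 0` and `limsup ε(N)^{-d} / N ≤ 1`. -/
structure IsLocalScale (d : ℕ) (ε : ℕ → ℝ) : Prop where
  pos : ∀ N, 1 ≤ N → 0 < ε N
  le_one : ∀ N, 1 ≤ N → ε N ≤ 1
  tendsto_zero : Tendsto ε atTop (𝓝 0)
  limsup_le : limsup (fun N : ℕ ↦ ENNReal.ofReal ((ε N ^ d)⁻¹ / N)) atTop ≤ 1

/-- The randomness of the systems: i.i.d. initial data `Z i = (x_i(0), v_i(0))` with density `f₀`,
independent standard `d`-dimensional Brownian motions `B i`, and, for each `N`, i.i.d. exponential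
clocks `e N i j` of rate one attached to the ordered pairs `(i, j)`; these three families are
independent. -/
structure IsDrivingNoise [MeasurableSpace Ω] (P : Measure Ω) (f₀ : Phase d → ℝ)
    (Z : ℕ → Ω → Phase d) (B : ℕ → ℝ≥0 → Ω → EuclideanSpace ℝ (Fin d))
    (e : ℕ → ℕ → ℕ → Ω → ℝ) : Prop where
  measurable_init : ∀ i, Measurable (Z i)
  measurable_brownian : ∀ i t, Measurable (B i t)
  measurable_clock : ∀ N i j, Measurable (e N i j)
  law_init : ∀ i, HasLaw (Z i) (volume.withDensity fun z ↦ ENNReal.ofReal (f₀ z)) P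
  brownian : ∀ i k, IsBrownianReal (fun t ω ↦ B i t ω k) P
  law_clock : ∀ N i j, HasLaw (e N i j) (expMeasure 1) P
  indep_init : iIndepFun Z P
  indep_brownian : iIndepFun (fun (p : ℕ × Fin d) ω (t : ℝ≥0) ↦ B p.1 t ω p.2) P
  indep_clock : ∀ N, iIndepFun (fun (p : ℕ × ℕ) ω ↦ e N p.1 p.2 ω) P
  indep_init_brownian : IndepFun (fun ω i ↦ Z i ω) (fun ω (i : ℕ) (t : ℝ≥0) ↦ B i t ω) P
  indep_clock_rest : ∀ N, IndepFun (fun ω (i j : ℕ) ↦ e N i j ω)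
    (fun ω ↦ (fun i ↦ Z i ω, fun (i : ℕ) (t : ℝ≥0) ↦ B i t ω)) P

/-- The free particle `X_i(t) = (x_i(0) + v_i(0) t + ∫₀ᵗ B_i(s) ds, v_i(0) + B_i(t))`. -/
noncomputable def freeParticle (Z : ℕ → Ω → Phase d)
    (B : ℕ → ℝ≥0 → Ω → EuclideanSpace ℝ (Fin d)) (i : ℕ) (t : ℝ≥0) (ω : Ω) : Phase d :=
  ((Z i ω).1 + (t : ℝ) • (Z i ω).2 + ∫ s in (0 : ℝ)..t, B i s.toNNReal ω,
    (Z i ω).2 + B i t ω)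

/-- The rescaled potential `θ^ε(x) = ε^{-d} θ(ε^{-1} x)`. -/
noncomputable def rescale (θ : EuclideanSpace ℝ (Fin d) → ℝ) (ε : ℝ)
    (x : EuclideanSpace ℝ (Fin d)) : ℝ :=
  (ε ^ d)⁻¹ * θ (ε⁻¹ • x)

/-- The cumulative annihilation rate `∫₀ᵗ N⁻¹ θ^ε(x_i(s) - x_j(s)) ds` of the ordered pair
`(i, j)`. -/
noncomputable def cumulativeRate (θ : EuclideanSpace ℝ (Fin d) → ℝ) (ε : ℝ)
    (Z : ℕ → Ω → Phase d) (B : ℕ → ℝ≥0 → Ω → EuclideanSpace ℝ (Fin d)) (N i j : ℕ) (t : ℝ≥0)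
    (ω : Ω) : ℝ :=
  ∫ s in (0 : ℝ)..t, (N : ℝ)⁻¹ *
    rescale θ ε ((freeParticle Z B i s.toNNReal ω).1 - (freeParticle Z B j s.toNNReal ω).1)

/-- The ring time of the ordered pair `(i, j)`: the first time at which its cumulative rate reaches
its exponential clock. Thus, as long as both particles are active, the pair rings with
infinitesimal rate `N⁻¹ θ^ε(x_i - x_j)`. -/
noncomputable def ringTime (θ : EuclideanSpace ℝ (Fin d) → ℝ) (ε : ℝ)
    (Z : ℕ → Ω → Phase d) (B : ℕ → ℝ≥0 → Ω → EuclideanSpace ℝ (Fin d))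
    (e : ℕ → ℕ → ℕ → Ω → ℝ) (N i j : ℕ) (ω : Ω) : ℝ≥0∞ :=
  ⨅ (t : ℝ≥0) (_ : e N i j ω ≤ cumulativeRate θ ε Z B N i j t ω), (t : ℝ≥0∞)

open Classical in
/-- The set `𝒩(t)` of active particles of the `N`-particle system. An active particle `i` is at
`freeParticle Z B i t`. -/
noncomputable def active (θ : EuclideanSpace ℝ (Fin d) → ℝ) (ε : ℝ)
    (Z : ℕ → Ω → Phase d) (B : ℕ → ℝ≥0 → Ω → EuclideanSpace ℝ (Fin d))
    (e : ℕ → ℕ → ℕ → Ω → ℝ) (N : ℕ) (t : ℝ≥0) (ω : Ω) : Finset (Fin N) :=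
  {i | (t : ℝ≥0∞) < lifetime (fun i j : Fin N ↦ ringTime θ ε Z B e N i j ω) i}

/-- The empirical measure `μ_t^N = N⁻¹ ∑_{i ∈ 𝒩(t)} δ_{(x_i(t), v_i(t))}` of active particles. -/
noncomputable def empiricalMeasure (θ : EuclideanSpace ℝ (Fin d) → ℝ) (ε : ℝ)
    (Z : ℕ → Ω → Phase d) (B : ℕ → ℝ≥0 → Ω → EuclideanSpace ℝ (Fin d))
    (e : ℕ → ℕ → ℕ → Ω → ℝ) (N : ℕ) (ω : Ω) (t : ℝ≥0) : SubProb (Phase d) :=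
  SubProb.mk ((N : ℝ≥0∞)⁻¹ • ∑ i ∈ active θ ε Z B e N t ω,
      Measure.dirac (freeParticle Z B i t ω)) <| by
    simp only [Measure.smul_apply, Measure.finsetSum_apply, measure_univ, Finset.sum_const,
      nsmul_eq_mul, mul_one, smul_eq_mul]
    calc (N : ℝ≥0∞)⁻¹ * ((active θ ε Z B e N t ω).card : ℝ≥0∞)
        ≤ (N : ℝ≥0∞)⁻¹ * N := by
          gcongr
          simpa using Finset.card_le_univ (active θ ε Z B e N t ω)
      _ ≤ 1 := ENNReal.inv_mul_le_one _

/-- The empirical measure process as a `D([0,T]; M_{+,1}(ℝ^{2d}))`-valued map (set to the zero path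
where the trajectory is not càdlàg). -/
noncomputable def empiricalProcess (T : ℝ≥0) (θ : EuclideanSpace ℝ (Fin d) → ℝ) (ε : ℕ → ℝ)
    (Z : ℕ → Ω → Phase d) (B : ℕ → ℝ≥0 → Ω → EuclideanSpace ℝ (Fin d))
    (e : ℕ → ℕ → ℕ → Ω → ℝ) (N : ℕ) (ω : Ω) : SkorokhodSpace T (SubProb (Phase d)) :=
  toSkorokhod (SubProb.mk 0 (by simp)) fun t ↦ empiricalMeasure θ (ε N) Z B e N ω t

/-- The density `p(t, x, v)` of one free particle at time `t`, i.e. the Radon–Nikodym derivative of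
its law with respect to Lebesgue measure. -/
noncomputable def freeDensity [MeasurableSpace Ω] (P : Measure Ω) (Z : ℕ → Ω → Phase d)
    (B : ℕ → ℝ≥0 → Ω → EuclideanSpace ℝ (Fin d)) (t : ℝ≥0) : Phase d → ℝ≥0∞ :=
  (P.map (freeParticle Z B 0 t)).rnDeriv volume

end ParticleSystem

end AnnihilatingParticles

open AnnihilatingParticles

/-!
Why the limits are dominated by the law of a free particle: removing particles only decreases the
empirical measure, and by the law of large numbers the empirical measure of *all* free particles at a
fixed time converges to that law. Everything else is about passing from fixed times to all times and
about compactness.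

*Compactness.* The marks of the particles (initial datum and Brownian path) are i.i.d., and the
position of a free particle has a density that is bounded uniformly in time, because the initial
velocities are bounded and `f₀` is bounded (`IsDrivingNoise.map_position_le`). As `∫ θ^ε = 1`, the
expected cumulative rate of a pair over a time interval of length `h` is thus at most `K h / N`,
however one of the two particles moves. The clocks being independent of the marks, a second moment
computation (`measure_card_ringEvent_le`) shows that at most `c N` pairs ring in a given interval of
length `h`, up to a probability of order `(h² + h / N) / c²`. Summing over a grid of mesh `h`, no
interval of length `h` sees the removal of a positive proportion of the particles
(`IsDrivingNoise.exists_measure_removals_le`). Together with Markov's inequality for the number of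
particles that are far away or move fast this controls the modulus of continuity of the empirical
measures in the Lévy–Prokhorov metric.

The empirical process has jumps of size `1 / N`. Instead of a compactness criterion for càdlàg
paths, the proof compares it with a process with continuous paths, in which the weight of a particle
fades linearly during the time `1 / N` before its removal. The fading processes are tight, since
continuous paths with a common modulus of continuity and values in a compact set form a compact subset
of the Skorokhod space (`SkorokhodSpace.isCompact_of_modulus`), and Prokhorov's theorem applies. The
empirical processes are uniformly close to them in probability, hence have relatively compact laws
too (`isCompact_closure_laws_of_tight`).

*Measurability.* The trajectories and the rates are measurable functions of the marks once the
Brownian paths are replaced by continuous versions (`regularize`). A càdlàg path is the limit in the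
Skorokhod topology of the step paths obtained by sampling it on finer and finer grids
(`tendsto_stepPath`), so a process is measurable as a random element of the Skorokhod space
(`measurable_skorokhod`).

*Identification.* If a càdlàg path charges an open set with more than `c` at time `t < T`, then so do
all paths in a neighbourhood at slightly later times (`SkorokhodSpace.exists_mem_interior`); at time
`T` the evaluation is continuous. By the portmanteau theorem such open sets of paths are null sets for
a limit law when `c` exceeds the mass given by the law of a free particle, and countably many times
and open sets suffice (`IsDrivingNoise.ae_le_freeLaw`). The law of a free particle is absolutely
continuous, because given the Brownian path it is the image of `f₀` under a shear and a translation,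
and so are the measures that it dominates.
-/

namespace AnnihilatingParticles

/-! ### The Skorokhod topology -/

section Skorokhod

variable {T : ℝ≥0} {E : Type*} [PseudoMetricSpace E]

/-- The right end point of `[0,T]`. -/
def endTime (T : ℝ≥0) : Icc (0 : ℝ≥0) T := ⟨T, zero_le, le_rfl⟩

lemma le_endTime (t : Icc (0 : ℝ≥0) T) : t ≤ endTime T := t.2.2

lemma orderIso_endTime (σ : Icc (0 : ℝ≥0) T ≃o Icc (0 : ℝ≥0) T) :
    σ (endTime T) = endTime T := by
  apply le_antisymm (le_endTime _)
  have := σ.monotone (le_endTime (σ.symm (endTime T)))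
  simpa using this

lemma SkorokhodSpace.exists_orderIso_of_edist_lt {x y : SkorokhodSpace T E} {c : ℝ≥0∞}
    (h : edist x y < c) :
    ∃ σ : Icc (0 : ℝ≥0) T ≃o Icc (0 : ℝ≥0) T,
      (∀ t, edist (σ t) t < c) ∧ ∀ t, edist (x t) (y (σ t)) < c := by
  obtain ⟨σ, hσ⟩ := iInf_lt_iff.1 h
  refine ⟨σ, fun t ↦ ?_, fun t ↦ ?_⟩
  · exact (le_iSup (fun t ↦ edist (σ t) t) t).trans_lt ((le_max_left _ _).trans_lt hσ)
  · exact (le_iSup (fun t ↦ edist (x t) (y (σ t))) t).trans_lt ((le_max_right _ _).trans_lt hσ)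

lemma SkorokhodSpace.edist_le_of_orderIso {x y : SkorokhodSpace T E} {c : ℝ≥0∞}
    (σ : Icc (0 : ℝ≥0) T ≃o Icc (0 : ℝ≥0) T) (h₁ : ∀ t, edist (σ t) t ≤ c)
    (h₂ : ∀ t, edist (x t) (y (σ t)) ≤ c) : edist x y ≤ c :=
  iInf_le_of_le σ (max_le (iSup_le h₁) (iSup_le h₂))

lemma SkorokhodSpace.edist_le_of_forall {x y : SkorokhodSpace T E} {c : ℝ≥0∞}
    (h : ∀ t, edist (x t) (y t) ≤ c) : edist x y ≤ c :=
  edist_le_of_orderIso (OrderIso.refl _) (by simp) h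

/-- At the end point the Skorokhod distance controls the distance of the values, because a time
change fixes the end point. -/
lemma SkorokhodSpace.edist_endTime_le (x y : SkorokhodSpace T E) :
    edist (x (endTime T)) (y (endTime T)) ≤ edist x y := by
  refine le_of_forall_gt fun c hc ↦ ?_
  obtain ⟨σ, -, hσ⟩ := exists_orderIso_of_edist_lt hc
  simpa [orderIso_endTime] using hσ (endTime T)

/-- If a path takes a value in an open set at time `t < T`, then at all slightly later times it lies
in the interior of the set of paths with a value in that open set. -/
lemma SkorokhodSpace.exists_mem_interior {x : SkorokhodSpace T E} {O : Set E} (hO : IsOpen O)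
    {t : Icc (0 : ℝ≥0) T} (hx : x t ∈ O) (ht : t < endTime T) :
    ∃ b > t, ∀ a ∈ Ioo t b, x ∈ interior {y : SkorokhodSpace T E | y a ∈ O} := by
  obtain ⟨ρ, hρ, hball⟩ := Metric.isOpen_iff.1 hO _ hx
  have h := (x.2 t).1 (Metric.ball_mem_nhds _ (half_pos hρ))
  rw [mem_map, mem_nhdsGE_iff_exists_Ico_subset' ht] at h
  obtain ⟨b, hb, hsub⟩ := h
  refine ⟨b, hb, fun a ha ↦ ?_⟩
  rw [mem_interior_iff_mem_nhds]
  -- small time changes keep `a` inside `(t, b)`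
  obtain ⟨c, hc, hcsub⟩ := EMetric.mem_nhds_iff.1 (Ioo_mem_nhds ha.1 ha.2)
  have hc' : 0 < min c (ENNReal.ofReal (ρ / 2)) := lt_min hc (by simpa using hρ)
  filter_upwards [Metric.eball_mem_nhds x hc'] with y hy
  obtain ⟨σ, hσ₁, hσ₂⟩ := exists_orderIso_of_edist_lt (Metric.mem_eball.1 hy)
  have h1 : σ a ∈ Ioo t b := hcsub ((hσ₁ a).trans_le (min_le_left _ _))
  have h2 : dist (x (σ a)) (x t) < ρ / 2 := hsub ⟨h1.1.le, h1.2⟩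
  have h3 := (hσ₂ a).trans_le (min_le_right _ _)
  rw [edist_dist, ENNReal.ofReal_lt_ofReal_iff (half_pos hρ)] at h3
  refine hball ?_
  rw [Metric.mem_ball]
  linarith [dist_triangle (y a) (x (σ a)) (x t)]

lemma SkorokhodSpace.isOpen_endTime_mem {O : Set E} (hO : IsOpen O) :
    IsOpen {y : SkorokhodSpace T E | y (endTime T) ∈ O} := by
  have : LipschitzWith 1 (fun y : SkorokhodSpace T E ↦ y (endTime T)) :=
    fun x y ↦ by simpa using edist_endTime_le x y
  exact hO.preimage this.continuous

instance [T2Space E] : T2Space (SkorokhodSpace T E) := by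
  have : T0Space (SkorokhodSpace T E) := by
    refine ⟨fun x y hxy ↦ ?_⟩
    by_contra hne
    obtain ⟨t, ht⟩ : ∃ t, x t ≠ y t := by
      by_contra! h
      exact hne (Subtype.ext (funext h))
    obtain ⟨U, V, hU, hV, hxU, hyV, hUV⟩ := t2_separation ht
    rcases (le_endTime t).lt_or_eq with hlt | rfl
    · obtain ⟨b, hb, hb'⟩ := SkorokhodSpace.exists_mem_interior hU hxU hlt
      obtain ⟨c, hc, hc'⟩ := SkorokhodSpace.exists_mem_interior hV hyV hlt
      obtain ⟨a, ha⟩ : ∃ a, a ∈ Ioo t (min b c) := by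
        obtain ⟨a, h1, h2⟩ := exists_between (show t.1 < (min b c).1 from lt_min hb hc)
        exact ⟨⟨a, zero_le, h2.le.trans (min b c).2.2⟩, h1, h2⟩
      have h1 := hb' a ⟨ha.1, ha.2.trans_le (min_le_left _ _)⟩
      have h2 := hc' a ⟨ha.1, ha.2.trans_le (min_le_right _ _)⟩
      have h3 := (hxy.mem_open_iff isOpen_interior).1 h1
      have h4 : y ∈ {y : SkorokhodSpace T E | y a ∈ U} := interior_subset h3
      have h5 : y ∈ {y : SkorokhodSpace T E | y a ∈ V} := interior_subset h2
      exact disjoint_left.1 hUV h4 h5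
    · have h3 := (hxy.mem_open_iff (SkorokhodSpace.isOpen_endTime_mem hU)).1 hxU
      exact disjoint_left.1 hUV h3 hyV
  infer_instance

/-- Continuous paths, as points of the Skorokhod space. -/
def SkorokhodSpace.ofContinuous (f : C(Icc (0 : ℝ≥0) T, E)) : SkorokhodSpace T E :=
  ⟨f, fun t ↦ ⟨f.continuous.continuousWithinAt, f t,
    f.continuous.continuousAt.tendsto.mono_left nhdsWithin_le_nhds⟩⟩

lemma SkorokhodSpace.continuous_ofContinuous :
    Continuous (ofContinuous : C(Icc (0 : ℝ≥0) T, E) → SkorokhodSpace T E) := by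
  have : LipschitzWith 1 (ofContinuous : C(Icc (0 : ℝ≥0) T, E) → SkorokhodSpace T E) := by
    intro f g
    rw [ENNReal.coe_one, one_mul]
    refine edist_le_of_forall fun t ↦ ?_
    rw [edist_dist, edist_dist]
    exact ENNReal.ofReal_le_ofReal (ContinuousMap.dist_apply_le_dist t)
  exact this.continuous

/-- Paths with values in a fixed compact set and with fixed moduli of continuity form a compact
subset of the Skorokhod space (Arzelà–Ascoli). -/
lemma SkorokhodSpace.isCompact_of_modulus [T2Space E] {K : Set E} (hK : IsCompact K) {η : ℕ → ℝ}
    (hη : Tendsto η atTop (𝓝 0)) {δ : ℕ → ℝ} (hδ : ∀ m, 0 < δ m) :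
    IsCompact {x : SkorokhodSpace T E | (∀ t, x t ∈ K) ∧
      ∀ m s t, dist s t < δ m → dist (x s) (x t) ≤ η m} := by
  set A : Set (Icc (0 : ℝ≥0) T → E) := {f | (∀ t, f t ∈ K) ∧
      ∀ m s t, dist s t < δ m → dist (f s) (f t) ≤ η m} with hA
  have hequi : UniformEquicontinuous (fun f : A ↦ (f : Icc (0 : ℝ≥0) T → E)) := by
    rw [Metric.uniformEquicontinuous_iff]
    intro c hc
    obtain ⟨m, hm⟩ := (hη.eventually (Iio_mem_nhds hc)).exists
    exact ⟨δ m, hδ m, fun s t hst f ↦ (f.2.2 m s t hst).trans_lt hm⟩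
  have hcont : ∀ f ∈ A, Continuous f := fun f hf ↦ (hequi.uniformContinuous ⟨f, hf⟩).continuous
  have hAc : IsCompact A := by
    have : A = (univ.pi fun _ ↦ K) ∩
        ⋂ (m) (s) (t) (_ : dist s t < δ m), {f | dist (f s) (f t) ≤ η m} := by
      ext f; simp [hA, Set.mem_pi]
    rw [this]
    refine (isCompact_univ_pi fun _ ↦ hK).inter_right ?_
    refine isClosed_iInter fun m ↦ isClosed_iInter fun s ↦ isClosed_iInter fun t ↦
      isClosed_iInter fun _ ↦ ?_
    exact isClosed_le ((continuous_apply s).dist (continuous_apply t)) continuous_const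
  set S : Set C(Icc (0 : ℝ≥0) T, E) := {f | ⇑f ∈ A} with hS
  have hSc : IsCompact S := by
    apply ArzelaAscoli.isCompact_of_equicontinuous
    · convert hAc
      ext f
      constructor
      · rintro ⟨g, hg, rfl⟩
        exact hg
      · intro hf
        exact ⟨⟨f, hcont f hf⟩, hf, rfl⟩
    · exact (hequi.comp (fun f : S ↦ ⟨f.1, f.2⟩)).equicontinuous
  convert hSc.image continuous_ofContinuous
  ext x
  constructor
  · intro hx
    exact ⟨⟨x, hcont _ hx⟩, hx, rfl⟩
  · rintro ⟨f, hf, rfl⟩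
    exact hf

end Skorokhod

/-! ### Sampling càdlàg paths on grids -/

section Sampling

variable {T : ℝ≥0} {E : Type*} [PseudoMetricSpace E]

lemma exists_cell {m : ℕ} {s : ℕ → ℝ} {a : ℝ} (h0 : s 0 ≤ a) (hm : a < s m) :
    ∃ i < m, s i ≤ a ∧ a < s (i + 1) := by
  classical
  have hex : ∃ j, a < s j := ⟨m, hm⟩
  have h1 := Nat.find_spec hex
  have h2 : Nat.find hex ≠ 0 := by
    intro h
    rw [h] at h1
    linarith
  obtain ⟨k, hk⟩ := Nat.exists_eq_succ_of_ne_zero h2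
  have h3 : Nat.find hex ≤ m := Nat.find_min' hex hm
  exact ⟨k, by omega, not_lt.1 (Nat.find_min hex (by omega)), by rw [hk] at h1; exact h1⟩

/-- Two subdivisions of `[0,T]` with the same number of points are exchanged by an increasing
bijection, the piecewise linear one. -/
lemma exists_orderIso_of_subdivision {m : ℕ} {s g : ℕ → ℝ}
    (hs : ∀ i < m, s i < s (i + 1)) (hg : ∀ i < m, g i < g (i + 1))
    (hs0 : s 0 = 0) (hg0 : g 0 = 0) (hsm : s m = T) (hgm : g m = T) :
    ∃ σ : Icc (0 : ℝ≥0) T ≃o Icc (0 : ℝ≥0) T,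
      ∀ t : Icc (0 : ℝ≥0) T, ∀ j ≤ m, ((t : ℝ≥0) : ℝ) = s j → ((σ t : ℝ≥0) : ℝ) = g j := by
  have hsmono : ∀ i j, i ≤ j → j ≤ m → s i ≤ s j := by
    intro i j hij
    induction j, hij using Nat.le_induction with
    | base => intro _; exact le_rfl
    | succ j hj ih => intro h; exact (ih (by omega)).trans (hs j (by omega)).le
  -- the piecewise linear function with value `g i` at `s i`, as a sum over the cells
  set f : ℝ → ℝ := fun t ↦ ∑ i ∈ Finset.range m,
    (g (i + 1) - g i) * max 0 (min 1 ((t - s i) / (s (i + 1) - s i))) with hf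
  have hpos : ∀ i < m, 0 < s (i + 1) - s i := fun i hi ↦ sub_pos.2 (hs i hi)
  have hgpos : ∀ i < m, 0 < g (i + 1) - g i := fun i hi ↦ sub_pos.2 (hg i hi)
  have hfs : ∀ j ≤ m, f (s j) = g j := by
    intro j hj
    have h1 : ∀ i ∈ Finset.range m,
        (g (i + 1) - g i) * max 0 (min 1 ((s j - s i) / (s (i + 1) - s i)))
          = if i < j then g (i + 1) - g i else 0 := by
      intro i hi
      have hi' := Finset.mem_range.1 hi
      split_ifs with hij
      · have : 1 ≤ (s j - s i) / (s (i + 1) - s i) := by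
          rw [le_div_iff₀ (hpos i hi')]
          linarith [hsmono (i + 1) j hij hj]
        rw [min_eq_left this]; simp
      · have : (s j - s i) / (s (i + 1) - s i) ≤ 0 :=
          div_nonpos_of_nonpos_of_nonneg
            (by linarith [hsmono j i (by omega) hi'.le]) (hpos i hi').le
        rw [max_eq_left ((min_le_right _ _).trans this)]; simp
    rw [hf]
    simp only
    rw [Finset.sum_congr rfl h1, ← Finset.sum_filter]
    have : Finset.filter (fun i ↦ i < j) (Finset.range m) = Finset.range j := by
      ext i; simp; omega
    rw [this, Finset.sum_range_sub, hg0, sub_zero]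
  have hfmono : Monotone f := by
    intro a b hab
    refine Finset.sum_le_sum fun i hi ↦ ?_
    have hi' := Finset.mem_range.1 hi
    have := (hgpos i hi').le
    have := (hpos i hi').le
    gcongr
  have hfcont : Continuous f := by
    refine continuous_finsetSum _ fun i hi ↦ ?_
    fun_prop
  have hfstrict : ∀ a b, 0 ≤ a → a < b → b ≤ T → f a < f b := by
    intro a b ha hab hb
    obtain ⟨i, hi, hia, hai⟩ := exists_cell (s := s) (by rw [hs0]; exact ha)
      (by rw [hsm]; linarith : a < s m)
    refine Finset.sum_lt_sum (fun k hk ↦ ?_) ⟨i, Finset.mem_range.2 hi, ?_⟩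
    · have hk' := Finset.mem_range.1 hk
      have := (hgpos k hk').le
      have := (hpos k hk').le
      gcongr
    · refine mul_lt_mul_of_pos_left ?_ (hgpos i hi)
      have h0 : 0 ≤ (a - s i) / (s (i + 1) - s i) :=
        div_nonneg (by linarith) (hpos i hi).le
      have h1 : (a - s i) / (s (i + 1) - s i) < 1 := by
        rw [div_lt_one (hpos i hi)]; linarith
      have h2 : (a - s i) / (s (i + 1) - s i) < (b - s i) / (s (i + 1) - s i) := by
        have := hpos i hi
        gcongr
      rw [min_eq_right h1.le, max_eq_right h0]
      exact lt_max_of_lt_right (lt_min h1 h2)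
  have hf0 : f 0 = 0 := by rw [← hs0, hfs 0 (Nat.zero_le _), hg0, hs0]
  have hfT : f T = T := by rw [← hsm, hfs m le_rfl, hgm, hsm]
  have hmem : ∀ t : Icc (0 : ℝ≥0) T, 0 ≤ f t ∧ f t ≤ T := fun t ↦
    ⟨hf0 ▸ hfmono t.1.2, hfT ▸ hfmono (NNReal.coe_le_coe.2 t.2.2)⟩
  set φ : Icc (0 : ℝ≥0) T → Icc (0 : ℝ≥0) T := fun t ↦
    ⟨⟨f t, (hmem t).1⟩, zero_le, NNReal.coe_le_coe.1 (hmem t).2⟩ with hφ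
  have hφmono : StrictMono φ := by
    intro a b hab
    have := hfstrict a b a.1.2 (NNReal.coe_lt_coe.2 hab) (NNReal.coe_le_coe.2 b.2.2)
    exact this
  have hφsurj : Function.Surjective φ := by
    intro u
    obtain ⟨t, ht, htu⟩ := intermediate_value_Icc (T.2 : (0 : ℝ) ≤ T) hfcont.continuousOn
      (show ((u : ℝ≥0) : ℝ) ∈ Icc (f 0) (f T) by
        rw [hf0, hfT]; exact ⟨u.1.2, NNReal.coe_le_coe.2 u.2.2⟩)
    refine ⟨⟨⟨t, ht.1⟩, zero_le, NNReal.coe_le_coe.1 ht.2⟩, ?_⟩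
    ext
    exact htu
  refine ⟨hφmono.orderIsoOfSurjective φ hφsurj, fun t j hj ht ↦ ?_⟩
  have : ((φ t : ℝ≥0) : ℝ) = f t := rfl
  simp only [StrictMono.coe_orderIsoOfSurjective]
  rw [this, ht, hfs j hj]

/-- A càdlàg path has a fine finite subdivision such that the path oscillates little on each cell,
the right end point of the cell being excluded. -/
lemma IsCadlag.exists_subdivision {x : Icc (0 : ℝ≥0) T → E} (hx : IsCadlag x) {η : ℝ}
    (hη : 0 < η) :
    ∃ (m : ℕ) (s : ℕ → ℝ), (∀ i < m, s i < s (i + 1)) ∧ s 0 = 0 ∧ s m = T ∧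
      (∀ i < m, s (i + 1) - s i < η) ∧
      ∀ i < m, ∀ t t' : Icc (0 : ℝ≥0) T, ((t : ℝ≥0) : ℝ) ∈ Ico (s i) (s (i + 1)) →
        ((t' : ℝ≥0) : ℝ) ∈ Ico (s i) (s (i + 1)) → dist (x t) (x t') < η := by
  -- the points of `[0,T]` that are reached by such a subdivision
  set S : Set ℝ := {u | 0 ≤ u ∧ u ≤ T ∧ ∃ (m : ℕ) (s : ℕ → ℝ),
      (∀ i < m, s i < s (i + 1)) ∧ s 0 = 0 ∧ s m = u ∧
      (∀ i < m, s (i + 1) - s i < η) ∧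
      ∀ i < m, ∀ t t' : Icc (0 : ℝ≥0) T, ((t : ℝ≥0) : ℝ) ∈ Ico (s i) (s (i + 1)) →
        ((t' : ℝ≥0) : ℝ) ∈ Ico (s i) (s (i + 1)) → dist (x t) (x t') < η} with hS
  -- a subdivision can be extended by one cell of small length and small oscillation
  have hext : ∀ a ∈ S, ∀ b, a < b → b ≤ T → b - a < η →
      (∀ t t' : Icc (0 : ℝ≥0) T, ((t : ℝ≥0) : ℝ) ∈ Ico a b → ((t' : ℝ≥0) : ℝ) ∈ Ico a b →
        dist (x t) (x t') < η) → b ∈ S := by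
    rintro a ⟨ha0, -, m, s, h1, h2, h3, h4, h5⟩ b hab hbT hη' hosc
    refine ⟨by linarith, hbT, m + 1, fun i ↦ if i ≤ m then s i else b, ?_, ?_, ?_, ?_, ?_⟩
    · intro i hi
      rcases Nat.lt_succ_iff_lt_or_eq.1 hi with hi | rfl
      · simpa [hi.le, Nat.succ_le_of_lt hi] using h1 i hi
      · simpa [h3] using hab
    · simpa using h2
    · simp
    · intro i hi
      rcases Nat.lt_succ_iff_lt_or_eq.1 hi with hi | rfl
      · simpa [hi.le, Nat.succ_le_of_lt hi] using h4 i hi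
      · simpa [h3] using hη'
    · intro i hi
      rcases Nat.lt_succ_iff_lt_or_eq.1 hi with hi | rfl
      · simpa [hi.le, Nat.succ_le_of_lt hi] using h5 i hi
      · simpa [h3] using hosc
  have h0 : (0 : ℝ) ∈ S := ⟨le_rfl, T.2, 0, fun _ ↦ 0, by simp⟩
  have hbdd : BddAbove S := ⟨T, fun u hu ↦ hu.2.1⟩
  set c := sSup S with hc
  have hc0 : 0 ≤ c := le_csSup hbdd h0
  have hcT : c ≤ T := csSup_le ⟨0, h0⟩ fun u hu ↦ hu.2.1
  set c' : Icc (0 : ℝ≥0) T := ⟨⟨c, hc0⟩, zero_le, hcT⟩ with hc'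
  -- the left limit at `c` makes the oscillation small on a cell that ends at `c`
  have hcS : c ∈ S := by
    by_contra hcn
    have hcpos : 0 < c := lt_of_le_of_ne hc0 fun h ↦ hcn (h ▸ h0)
    obtain ⟨l, hl⟩ := (hx c').2
    have h1 := hl (Metric.ball_mem_nhds l (half_pos hη))
    have hlt : (⟨0, zero_le, zero_le⟩ : Icc (0 : ℝ≥0) T) < c' := hcpos
    rw [mem_map, mem_nhdsLT_iff_exists_Ioo_subset' hlt] at h1
    obtain ⟨a, ha, hsub⟩ := h1
    have ha' : ((a : ℝ≥0) : ℝ) < c := ha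
    obtain ⟨b, hbS, hb⟩ := exists_lt_of_lt_csSup ⟨0, h0⟩ (max_lt ha' (sub_lt_self c hη))
    have hbc : b < c := lt_of_le_of_ne (le_csSup hbdd hbS) fun h ↦ hcn (h ▸ hbS)
    have hab := (le_max_left _ _).trans_lt hb
    have hηb := (le_max_right _ _).trans_lt hb
    refine hcn (hext b hbS c hbc hcT (by linarith) fun t t' ht ht' ↦ ?_)
    have h2 : dist (x t) l < η / 2 := hsub ⟨hab.trans_le ht.1, ht.2⟩
    have h3 : dist (x t') l < η / 2 := hsub ⟨hab.trans_le ht'.1, ht'.2⟩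
    rw [dist_comm] at h3
    linarith [dist_triangle (x t) l (x t')]
  -- right continuity at `c < T` would give a further cell
  have hceq : c = T := by
    by_contra hne
    have hlt : c < T := lt_of_le_of_ne hcT hne
    have h1 := (hx c').1 (Metric.ball_mem_nhds _ (half_pos hη))
    have hlt' : c' < endTime T := hlt
    rw [mem_map, mem_nhdsGE_iff_exists_Ico_subset' hlt'] at h1
    obtain ⟨b, hb, hsub⟩ := h1
    have hb' : c < ((b : ℝ≥0) : ℝ) := hb
    have hbT : ((b : ℝ≥0) : ℝ) ≤ T := b.2.2
    set d := min ((b : ℝ≥0) : ℝ) (c + η / 2) with hd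
    have hcd : c < d := lt_min hb' (by linarith)
    have hdS : d ∈ S := by
      refine hext c hcS d hcd ((min_le_left _ _).trans hbT) ?_ fun t t' ht ht' ↦ ?_
      · have := min_le_right ((b : ℝ≥0) : ℝ) (c + η / 2)
        linarith
      · have h2 : dist (x t) (x c') < η / 2 := hsub ⟨ht.1, ht.2.trans_le (min_le_left _ _)⟩
        have h3 : dist (x t') (x c') < η / 2 := hsub ⟨ht'.1, ht'.2.trans_le (min_le_left _ _)⟩
        rw [dist_comm] at h3
        linarith [dist_triangle (x t) (x c') (x t')]
    exact absurd (le_csSup hbdd hdS) (not_le.2 hcd)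
  obtain ⟨-, -, h⟩ := hceq ▸ hcS
  exact h

end Sampling

section Measurability

variable {T : ℝ≥0} {E : Type*} [PseudoMetricSpace E]

/-- The index of the cell of the grid of mesh `1 / n` that contains `t`; the index `0` is reserved
for the right end point of `[0,T]`. -/
noncomputable def gridIndex (T : ℝ≥0) (n : ℕ) (t : Icc (0 : ℝ≥0) T) : ℕ :=
  open Classical in if t = endTime T then 0 else ⌊(n : ℝ) * ((t : ℝ≥0) : ℝ)⌋₊ + 1

/-- The grid point at which a path is sampled on the cell of index `k`. -/
noncomputable def gridPoint (T : ℝ≥0) (n : ℕ) : ℕ → Icc (0 : ℝ≥0) T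
  | 0 => endTime T
  | k + 1 => ⟨min (k / n) T, zero_le, min_le_right _ _⟩

lemma gridIndex_le (T : ℝ≥0) (n : ℕ) (t : Icc (0 : ℝ≥0) T) :
    gridIndex T n t ≤ ⌊(n : ℝ) * T⌋₊ + 1 := by
  have : ((t : ℝ≥0) : ℝ) ≤ T := t.2.2
  unfold gridIndex
  split_ifs
  · omega
  · gcongr

lemma isCadlag_comp_gridIndex (n : ℕ) (a : ℕ → E) :
    IsCadlag fun t ↦ a (gridIndex T n t) := by
  have hcont : Continuous fun u : Icc (0 : ℝ≥0) T ↦ (n : ℝ) * ((u : ℝ≥0) : ℝ) := by fun_prop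
  intro t
  constructor
  · suffices h : ∀ᶠ u in 𝓝[≥] t, gridIndex T n u = gridIndex T n t from
      tendsto_const_nhds.congr' (h.mono fun u hu ↦ by simp only [hu])
    rcases (le_endTime t).lt_or_eq with ht | rfl
    · have h1 : ∀ᶠ u : Icc (0 : ℝ≥0) T in 𝓝[≥] t,
          (n : ℝ) * ((u : ℝ≥0) : ℝ) < ⌊(n : ℝ) * ((t : ℝ≥0) : ℝ)⌋₊ + 1 :=
        mem_nhdsWithin_of_mem_nhds ((hcont.continuousAt (x := t)).eventually
          (Iio_mem_nhds (Nat.lt_floor_add_one _)))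
      filter_upwards [mem_nhdsWithin_of_mem_nhds (Iio_mem_nhds ht), self_mem_nhdsWithin, h1]
        with u hu hut h
      rw [gridIndex, gridIndex, if_neg (ne_of_lt hu), if_neg (ne_of_lt ht)]
      congr 1
      rw [Nat.floor_eq_iff (by positivity)]
      refine ⟨(Nat.floor_le (by positivity)).trans ?_, h⟩
      have : ((t : ℝ≥0) : ℝ) ≤ ((u : ℝ≥0) : ℝ) := hut
      gcongr
    · filter_upwards [self_mem_nhdsWithin] with u hu
      rw [le_antisymm (le_endTime u) hu]
  · suffices h : ∃ m, ∀ᶠ u in 𝓝[<] t, gridIndex T n u = m by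
      obtain ⟨m, hm⟩ := h
      exact ⟨a m, tendsto_const_nhds.congr' (hm.mono fun u hu ↦ by simp only [hu])⟩
    rcases Nat.eq_zero_or_pos n with rfl | hn
    · refine ⟨1, ?_⟩
      filter_upwards [self_mem_nhdsWithin] with u hu
      rw [gridIndex, if_neg (ne_of_lt (lt_of_lt_of_le hu (le_endTime t)))]
      simp
    have hn' : (0 : ℝ) < n := Nat.cast_pos.2 hn
    refine ⟨⌈(n : ℝ) * ((t : ℝ≥0) : ℝ)⌉₊, ?_⟩
    have h1 : ∀ᶠ u : Icc (0 : ℝ≥0) T in 𝓝[<] t,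
        (⌈(n : ℝ) * ((t : ℝ≥0) : ℝ)⌉₊ : ℝ) < (n : ℝ) * ((u : ℝ≥0) : ℝ) + 1 :=
      mem_nhdsWithin_of_mem_nhds (((hcont.add continuous_const).continuousAt (x := t)).eventually
        (Ioi_mem_nhds (Nat.ceil_lt_add_one (by positivity))))
    filter_upwards [self_mem_nhdsWithin, h1] with u hu h
    rw [gridIndex, if_neg (ne_of_lt (lt_of_lt_of_le hu (le_endTime t)))]
    have hut : (n : ℝ) * ((u : ℝ≥0) : ℝ) < (n : ℝ) * ((t : ℝ≥0) : ℝ) := by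
      have : ((u : ℝ≥0) : ℝ) < ((t : ℝ≥0) : ℝ) := hu
      gcongr
    have h3 : ⌊(n : ℝ) * ((u : ℝ≥0) : ℝ)⌋₊ < ⌈(n : ℝ) * ((t : ℝ≥0) : ℝ)⌉₊ := by
      rw [Nat.floor_lt (by positivity)]
      exact hut.trans_le (Nat.le_ceil _)
    have h4 : ⌈(n : ℝ) * ((t : ℝ≥0) : ℝ)⌉₊ < ⌊(n : ℝ) * ((u : ℝ≥0) : ℝ)⌋₊ + 2 := by
      have := Nat.lt_floor_add_one ((n : ℝ) * ((u : ℝ≥0) : ℝ))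
      have h5 : (⌈(n : ℝ) * ((t : ℝ≥0) : ℝ)⌉₊ : ℝ)
          < (⌊(n : ℝ) * ((u : ℝ≥0) : ℝ)⌋₊ + 2 : ℕ) := by
        push_cast; linarith
      exact_mod_cast h5
    omega

/-- The path that takes the value `a k` on the cell of index `k` of the grid of mesh `1 / n`. -/
noncomputable def stepPath (n : ℕ) (a : ℕ → E) : SkorokhodSpace T E :=
  ⟨fun t ↦ a (gridIndex T n t), isCadlag_comp_gridIndex n a⟩

lemma continuous_stepPath (n : ℕ) : Continuous (stepPath n : (ℕ → E) → SkorokhodSpace T E) := by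
  rw [continuous_iff_continuousAt]
  intro a
  rw [ContinuousAt, EMetric.tendsto_nhds]
  intro c hc
  obtain ⟨c', hc', hcc'⟩ := exists_between hc
  have h : ∀ᶠ b in 𝓝 a, ∀ k ∈ Finset.range (⌊(n : ℝ) * T⌋₊ + 2), edist (b k) (a k) < c' := by
    rw [Filter.eventually_all_finset]
    exact fun k _ ↦ (continuous_apply k).continuousAt (Metric.eball_mem_nhds (a k) hc')
  filter_upwards [h] with b hb
  refine (SkorokhodSpace.edist_le_of_forall fun t ↦ (hb _ ?_).le).trans_lt hcc'
  have := gridIndex_le T n t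
  rw [Finset.mem_range]; omega

/-- Sampling a càdlàg path on finer and finer grids approximates it in the Skorokhod topology. The
time change moves the points of a subdivision adapted to the path to the next grid points. -/
lemma tendsto_stepPath (x : SkorokhodSpace T E) :
    Tendsto (fun n ↦ stepPath n fun k ↦ x (gridPoint T n k)) atTop (𝓝 x) := by
  rw [EMetric.tendsto_nhds]
  intro c hc
  obtain ⟨η, hη, hηc⟩ : ∃ η : ℝ, 0 < η ∧ ENNReal.ofReal (2 * η) < c := by
    obtain ⟨c', hc', hcc'⟩ := ENNReal.lt_iff_exists_nnreal_btwn.1 hc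
    refine ⟨c' / 2, half_pos (by simpa using hc'), ?_⟩
    rwa [mul_div_cancel₀ _ two_ne_zero, ENNReal.ofReal_coe_nnreal]
  obtain ⟨m, s, hs, hs0, hsm, hmesh, hosc⟩ := x.2.exists_subdivision hη
  have hev : ∀ᶠ n : ℕ in atTop, (∀ i ∈ Finset.range m, 1 / (n : ℝ) < s (i + 1) - s i) ∧
      1 / (n : ℝ) < η ∧ 0 < n := by
    refine (Filter.eventually_all_finset _).2 (fun i hi ↦ ?_) |>.and (Eventually.and ?_ ?_)
    · exact tendsto_one_div_atTop_nhds_zero_nat.eventually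
        (Iio_mem_nhds (sub_pos.2 (hs i (Finset.mem_range.1 hi))))
    · exact tendsto_one_div_atTop_nhds_zero_nat.eventually (Iio_mem_nhds hη)
    · exact eventually_gt_atTop 0
  filter_upwards [hev] with n ⟨hgap, hnη, hn⟩
  have hn' : (0 : ℝ) < n := Nat.cast_pos.2 hn
  have hsmono : ∀ i j, i ≤ j → j ≤ m → s i ≤ s j := by
    intro i j hij
    induction j, hij using Nat.le_induction with
    | base => intro _; exact le_rfl
    | succ j hj ih => intro h; exact (ih (by omega)).trans (hs j (by omega)).le
  have hs_nonneg : ∀ i ≤ m, 0 ≤ s i := fun i hi ↦ hs0 ▸ hsmono 0 i (Nat.zero_le _) hi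
  -- `g j` is the next grid point after `s j`, except that the end point `T` stays fixed
  set g : ℕ → ℝ := fun j ↦ if j = m then T else (⌈(n : ℝ) * s j⌉₊ : ℝ) / n with hg
  have hgs : ∀ j ≤ m, s j ≤ g j := by
    intro j hj
    simp only [hg]
    split_ifs with h
    · rw [h, hsm]
    · rw [le_div_iff₀ hn', mul_comm]; exact Nat.le_ceil _
  have hgs' : ∀ j ≤ m, g j < s j + 1 / n := by
    intro j hj
    simp only [hg]
    split_ifs with h
    · rw [h, hsm]; linarith [one_div_pos.2 hn']
    · have := Nat.ceil_lt_add_one (mul_nonneg hn'.le (hs_nonneg j hj))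
      rw [div_lt_iff₀ hn', add_mul, div_mul_cancel₀ _ hn'.ne', mul_comm (s j)]
      exact this
  obtain ⟨σ, hσ⟩ := exists_orderIso_of_subdivision (g := g) (T := T) hs (fun i hi ↦ by
      linarith [hgs' i hi.le, hgs (i + 1) hi, hgap i (Finset.mem_range.2 hi)]) hs0 (by
      simp only [hg]
      split_ifs with h
      · rw [← hsm, ← h, hs0]
      · rw [hs0]; simp) hsm (by simp [hg])
  refine (edist_comm _ _).trans_lt ((SkorokhodSpace.edist_le_of_orderIso σ
    (c := ENNReal.ofReal (2 * η)) ?_ ?_).trans_lt hηc)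
  all_goals
    intro t
    rcases (le_endTime t).eq_or_lt with rfl | ht
    on_goal 2 =>
      have htT : ((t : ℝ≥0) : ℝ) < T := ht
      obtain ⟨i, hi, hit, hti⟩ := exists_cell (m := m) (s := s) (a := ((t : ℝ≥0) : ℝ))
        (by rw [hs0]; exact t.1.2) (by rw [hsm]; exact htT)
      have hpt : ∀ j ≤ m, ∃ u : Icc (0 : ℝ≥0) T, ((u : ℝ≥0) : ℝ) = s j := fun j hj ↦
        ⟨⟨⟨s j, hs_nonneg j hj⟩, zero_le, NNReal.coe_le_coe.1
          (show s j ≤ T from hsm ▸ hsmono j m hj le_rfl)⟩, rfl⟩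
      have hlow : g i ≤ ((σ t : ℝ≥0) : ℝ) := by
        obtain ⟨u, hu⟩ := hpt i hi.le
        rw [← hσ u i hi.le hu]
        exact σ.monotone (show ((u : ℝ≥0) : ℝ) ≤ ((t : ℝ≥0) : ℝ) by rw [hu]; exact hit)
      have hupp : ((σ t : ℝ≥0) : ℝ) < g (i + 1) := by
        obtain ⟨u, hu⟩ := hpt (i + 1) hi
        rw [← hσ u (i + 1) hi hu]
        exact σ.strictMono (show ((t : ℝ≥0) : ℝ) < ((u : ℝ≥0) : ℝ) by rw [hu]; exact hti)
  · simp [orderIso_endTime]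
  · rw [edist_dist]
    apply ENNReal.ofReal_le_ofReal
    change |((σ t : ℝ≥0) : ℝ) - ((t : ℝ≥0) : ℝ)| ≤ 2 * η
    rw [abs_le]
    constructor
    · linarith [hgs i hi.le, hmesh i hi]
    · linarith [hgs' (i + 1) hi, hmesh i hi]
  · rw [orderIso_endTime]
    simp [stepPath, gridIndex, gridPoint]
  · have hσt : σ t ≠ endTime T := by
      intro h
      rw [← orderIso_endTime σ] at h
      exact ht.ne (σ.injective h)
    rw [edist_dist]
    apply ENNReal.ofReal_le_ofReal
    set k := ⌊(n : ℝ) * ((σ t : ℝ≥0) : ℝ)⌋₊ with hk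
    have hval : (stepPath n (fun k ↦ x (gridPoint T n k)) : SkorokhodSpace T E) (σ t)
        = x (gridPoint T n (k + 1)) := by
      simp [stepPath, gridIndex, hσt, hk]
    have hkle : (k : ℝ) / n ≤ ((σ t : ℝ≥0) : ℝ) := by
      rw [div_le_iff₀ hn', mul_comm]; exact Nat.floor_le (by positivity)
    have hσT : ((σ t : ℝ≥0) : ℝ) ≤ T := (σ t).2.2
    have hpoint : ((gridPoint T n (k + 1) : ℝ≥0) : ℝ) = k / n := by
      simp only [gridPoint]
      push_cast
      exact min_eq_left (hkle.trans hσT)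
    rw [hval]
    have hi' : g i = (⌈(n : ℝ) * s i⌉₊ : ℝ) / n := by simp [hg, hi.ne]
    -- the sampling point `k / n` of the cell of `σ t` lies in the same cell of `s` as `t`
    refine (hosc i hi _ _ ⟨hit, hti⟩ ⟨?_, ?_⟩).le.trans (by linarith)
    · rw [hpoint, le_div_iff₀ hn', mul_comm]
      refine (Nat.le_ceil _).trans ?_
      rw [hi', div_le_iff₀ hn', mul_comm ((σ t : ℝ≥0) : ℝ)] at hlow
      have h1 : ⌈(n : ℝ) * s i⌉₊ ≤ k := Nat.le_floor hlow
      exact_mod_cast h1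
    · rw [hpoint]
      by_cases him : i + 1 = m
      · rw [him, hsm]
        have : ((σ t : ℝ≥0) : ℝ) < T :=
          lt_of_le_of_ne hσT fun h ↦ hσt (Subtype.ext (NNReal.coe_injective h))
        linarith
      · have h1 : g (i + 1) = (⌈(n : ℝ) * s (i + 1)⌉₊ : ℝ) / n := by simp [hg, him]
        rw [h1, lt_div_iff₀ hn', mul_comm] at hupp
        have h2 : k < ⌈(n : ℝ) * s (i + 1)⌉₊ := by
          rw [hk, Nat.floor_lt (by positivity)]; exact hupp
        rw [div_lt_iff₀ hn', mul_comm]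
        exact Nat.lt_ceil.1 h2

/-- A process whose values are continuous functions of random elements of a second countable space
is measurable as a random element of the Skorokhod space. -/
lemma measurable_skorokhod {Ω Y : Type*} [MeasurableSpace Ω] [TopologicalSpace Y]
    [SecondCountableTopology Y] [MeasurableSpace Y] [BorelSpace Y] {g : Y → E} (hg : Continuous g)
    {y : Icc (0 : ℝ≥0) T → Ω → Y} (hy : ∀ t, Measurable (y t)) {F : Ω → SkorokhodSpace T E}
    (hF : ∀ ω t, F ω t = g (y t ω)) : Measurable F := by
  have h : ∀ n, Measurable fun ω ↦ (stepPath n fun k ↦ F ω (gridPoint T n k) : SkorokhodSpace T E) := by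
    intro n
    have h1 : Continuous fun v : ℕ → Y ↦ (stepPath n fun k ↦ g (v k) : SkorokhodSpace T E) :=
      (continuous_stepPath n).comp (continuous_pi fun k ↦ hg.comp (continuous_apply k))
    have h2 : Measurable fun ω ↦ fun k ↦ y (gridPoint T n k) ω := measurable_pi_lambda _ fun k ↦ hy _
    simp_rw [hF]
    exact h1.measurable.comp h2
  refine measurable_of_tendsto_metrizable h ?_
  rw [tendsto_pi_nhds]
  exact fun ω ↦ tendsto_stepPath (F ω)

end Measurability

/-! ### Subprobability measures and weighted empirical measures -/

section SubProbability

variable {X : Type*} [MeasurableSpace X] [PseudoMetricSpace X]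

lemma SubProb.ext_measure {X : Type*} [MeasurableSpace X] {μ ν : SubProb X}
    (h : μ.toMeasure = ν.toMeasure) : μ = ν :=
  Subtype.ext (Subtype.ext h)

@[simp] lemma SubProb.toMeasure_mk {X : Type*} [MeasurableSpace X] (μ : Measure X)
    (h : μ univ ≤ 1) : (SubProb.mk μ h).toMeasure = μ := rfl

instance {X : Type*} [MeasurableSpace X] (μ : SubProb X) : IsFiniteMeasure μ.toMeasure := μ.1.2

instance [BorelSpace X] : T2Space (SubProb X) :=
  inferInstanceAs (T2Space {μ : FiniteMeasure X // μ.mass ≤ 1})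

lemma SubProb.dist_le_of_forall [OpensMeasurableSpace X] [TopologicalSpace.SeparableSpace X]
    {μ ν : SubProb X} {r : ℝ} (hr : 0 ≤ r)
    (h₁ : ∀ r' > r, ∀ A : Set X,
      μ.toMeasure A ≤ ν.toMeasure (thickening r' A) + ENNReal.ofReal r')
    (h₂ : ∀ r' > r, ∀ A : Set X,
      ν.toMeasure A ≤ μ.toMeasure (thickening r' A) + ENNReal.ofReal r') : dist μ ν ≤ r := by
  have hle : levyProkhorovEDist μ.toMeasure ν.toMeasure ≤ ENNReal.ofReal r := by
    refine levyProkhorovEDist_le_of_forall _ _ _ fun c A hc hc' _ ↦ ?_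
    have h : r < c.toReal := by rwa [← ENNReal.ofReal_lt_iff_lt_toReal hr hc'.ne]
    have e : ENNReal.ofReal c.toReal = c := ENNReal.ofReal_toReal hc'.ne
    exact ⟨by simpa only [e] using h₁ _ h A, by simpa only [e] using h₂ _ h A⟩
  change dist (LevyProkhorov.ofMeasure μ.1) (LevyProkhorov.ofMeasure ν.1) ≤ r
  rw [dist_edist, LevyProkhorov.edist_finiteMeasure_def]
  exact ENNReal.toReal_le_of_le_ofReal hr hle

/-- Prokhorov's criterion for subprobability measures. -/
lemma SubProb.isCompact_of_compl_le [T2Space X] [BorelSpace X] {K : ℕ → Set X}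
    (hK : ∀ n, IsCompact (K n)) {u : ℕ → ℝ≥0} (hu : Tendsto u atTop (𝓝 0)) :
    IsCompact {μ : SubProb X | ∀ n, μ.toMeasure (K n)ᶜ ≤ u n} := by
  have h := isCompact_setOfPred_finiteMeasure_mass_le_compl_isCompact_le (E := X) 1 hu hK
    (Or.inl inferInstance)
  have hind : IsInducing (Subtype.val : {μ : FiniteMeasure X // μ.mass ≤ 1} → FiniteMeasure X) :=
    IsInducing.subtypeVal
  refine hind.isCompact_iff.2 ?_
  convert h
  ext μ
  constructor
  · rintro ⟨ν, hν, rfl⟩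
    refine ⟨ν.2, fun n ↦ ?_⟩
    rw [← ENNReal.coe_le_coe, FiniteMeasure.ennreal_coeFn_eq_coeFn_toMeasure]
    exact hν n
  · rintro ⟨h1, h2⟩
    refine ⟨⟨μ, h1⟩, fun n ↦ ?_, rfl⟩
    have := ENNReal.coe_le_coe.2 (h2 n)
    rwa [FiniteMeasure.ennreal_coeFn_eq_coeFn_toMeasure] at this

lemma SubProb.isOpen_lt_measure [OpensMeasurableSpace X] {G : Set X} (hG : IsOpen G) (c : ℝ) :
    IsOpen {μ : SubProb X | c < μ.toMeasure.real G} := by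
  rw [isOpen_iff_mem_nhds]
  intro μ hμ
  have hμ' : c < μ.toMeasure.real G := hμ
  have h := eventually_measure_open_lt μ.1 hG (sub_pos.2 hμ')
  have hc : ContinuousAt (Subtype.val : {μ : FiniteMeasure X // μ.mass ≤ 1} → FiniteMeasure X) μ :=
    continuous_subtype_val.continuousAt
  filter_upwards [hc.eventually h] with ν hν
  have hν' : μ.toMeasure.real G < ν.toMeasure.real G + (μ.toMeasure.real G - c) := hν
  change c < ν.toMeasure.real G
  linarith

/-- The measure `N⁻¹ ∑ᵢ wᵢ δ_{xᵢ}`; weights are truncated to `[0,1]`. -/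
noncomputable def weightedEmpirical {N : ℕ} (w : Fin N → ℝ) (x : Fin N → X) : SubProb X :=
  SubProb.mk ((N : ℝ≥0∞)⁻¹ • ∑ i, ENNReal.ofReal (min (w i) 1) • Measure.dirac (x i)) <| by
    simp only [Measure.smul_apply, Measure.finsetSum_apply, measure_univ, smul_eq_mul, mul_one]
    calc (N : ℝ≥0∞)⁻¹ * ∑ i, ENNReal.ofReal (min (w i) 1)
        ≤ (N : ℝ≥0∞)⁻¹ * ∑ i : Fin N, 1 := by
          gcongr with i
          exact ENNReal.ofReal_le_one.2 (min_le_right _ _)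
      _ ≤ 1 := by simp [ENNReal.inv_mul_le_one]

lemma continuous_weightedEmpirical [OpensMeasurableSpace X] {N : ℕ} :
    Continuous fun p : (Fin N → ℝ) × (Fin N → X) ↦ weightedEmpirical p.1 p.2 := by
  rw [continuous_iff_continuousAt]
  intro p
  have hind : IsInducing (Subtype.val : {μ : FiniteMeasure X // μ.mass ≤ 1} → FiniteMeasure X) :=
    IsInducing.subtypeVal
  refine hind.continuousAt_iff.2 ?_
  rw [ContinuousAt, FiniteMeasure.tendsto_iff_forall_integral_tendsto]
  intro f
  have hval : ∀ q : (Fin N → ℝ) × (Fin N → X),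
      ∫ z, f z ∂((N : ℝ≥0∞)⁻¹ • ∑ i, ENNReal.ofReal (min (q.1 i) 1) • Measure.dirac (q.2 i))
        = (N : ℝ)⁻¹ * ∑ i, max (min (q.1 i) 1) 0 * f (q.2 i) := by
    intro q
    rw [integral_smul_measure, integral_finsetSum_measure]
    · simp [integral_smul_measure, integral_dirac' _ _ f.continuous.stronglyMeasurable,
        ENNReal.toReal_ofReal', -ENNReal.ofReal_min]
    · intro i _
      exact (f.integrable (Measure.dirac (q.2 i))).smul_measure ENNReal.ofReal_ne_top
  have hc : Continuous fun q : (Fin N → ℝ) × (Fin N → X) ↦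
      (N : ℝ)⁻¹ * ∑ i, max (min (q.1 i) 1) 0 * f (q.2 i) := by
    fun_prop
  refine (hc.tendsto p).congr' ?_ |>.trans_eq ?_
  · exact Eventually.of_forall fun q ↦ (hval q).symm
  · exact congrArg 𝓝 (hval p).symm

open Classical in
/-- Moving few atoms far, and the other atoms by less than `r`, moves an empirical measure by at
most `r` in the Lévy–Prokhorov distance. -/
lemma dist_weightedEmpirical_le [OpensMeasurableSpace X] [TopologicalSpace.SeparableSpace X]
    {N : ℕ} {w w' : Fin N → ℝ} {x x' : Fin N → X} {r : ℝ} (hr : 0 ≤ r)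
    (h : ((Finset.univ.filter fun i ↦ ¬ (w i = w' i ∧ dist (x i) (x' i) ≤ r)).card : ℝ) ≤ r * N) :
    dist (weightedEmpirical w x) (weightedEmpirical w' x') ≤ r := by
  have key : ∀ (w w' : Fin N → ℝ) (x x' : Fin N → X),
      ((Finset.univ.filter fun i ↦ ¬ (w i = w' i ∧ dist (x i) (x' i) ≤ r)).card : ℝ) ≤ r * N →
      ∀ r' > r, ∀ A : Set X, (weightedEmpirical w x).toMeasure A
        ≤ (weightedEmpirical w' x').toMeasure (thickening r' A) + ENNReal.ofReal r' := by
    intro w w' x x' h r' hr' A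
    rcases Nat.eq_zero_or_pos N with rfl | hN
    · simp [weightedEmpirical]
    -- it suffices to treat measurable sets, the right hand side depends on the closure only
    suffices hcl : ∀ A : Set X, MeasurableSet A → (weightedEmpirical w x).toMeasure A
        ≤ (weightedEmpirical w' x').toMeasure (thickening r' A) + ENNReal.ofReal r' by
      refine (measure_mono subset_closure).trans ((hcl _ isClosed_closure.measurableSet).trans ?_)
      rw [thickening_closure]
    clear A
    intro A hA
    set bad := Finset.univ.filter fun i ↦ ¬ (w i = w' i ∧ dist (x i) (x' i) ≤ r) with hbad
    have hterm : ∀ i, ENNReal.ofReal (min (w i) 1) * A.indicator 1 (x i)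
        ≤ ENNReal.ofReal (min (w' i) 1) * (thickening r' A).indicator 1 (x' i)
          + if i ∈ bad then 1 else 0 := by
      intro i
      by_cases hi : i ∈ bad
      · rw [if_pos hi]
        refine le_add_left ?_
        calc ENNReal.ofReal (min (w i) 1) * A.indicator 1 (x i) ≤ 1 * 1 := by
              gcongr
              · exact ENNReal.ofReal_le_one.2 (min_le_right _ _)
              · exact indicator_le_self' (by simp) _
          _ = 1 := one_mul 1
      · rw [if_neg hi, add_zero]
        simp only [hbad, Finset.mem_filter, Finset.mem_univ, true_and, not_not] at hi
        rw [hi.1]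
        gcongr
        by_cases hxA : x i ∈ A
        · have : x' i ∈ thickening r' A :=
            mem_thickening_iff.2 ⟨x i, hxA, by rw [dist_comm]; exact hi.2.trans_lt hr'⟩
          simp [hxA, this]
        · simp [hxA]
    have hN0 : (N : ℝ≥0∞) ≠ 0 := by exact_mod_cast hN.ne'
    have hcard : (N : ℝ≥0∞)⁻¹ * (bad.card : ℝ≥0∞) ≤ ENNReal.ofReal r' := by
      rw [ENNReal.inv_mul_le_iff hN0 (ENNReal.natCast_ne_top N)]
      have h1 : (bad.card : ℝ) ≤ N * r' := by
        refine h.trans ?_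
        rw [mul_comm]
        gcongr
      calc (bad.card : ℝ≥0∞) = ENNReal.ofReal (bad.card : ℝ) := by simp
        _ ≤ ENNReal.ofReal (N * r') := ENNReal.ofReal_le_ofReal h1
        _ = N * ENNReal.ofReal r' := by rw [ENNReal.ofReal_mul (by positivity)]; simp
    simp only [weightedEmpirical, SubProb.toMeasure_mk, Measure.smul_apply,
      Measure.finsetSum_apply, smul_eq_mul, Measure.dirac_apply' _ hA,
      Measure.dirac_apply' _ (isOpen_thickening (δ := r') (E := A)).measurableSet]
    calc (N : ℝ≥0∞)⁻¹ * ∑ i, ENNReal.ofReal (min (w i) 1) * A.indicator 1 (x i)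
        ≤ (N : ℝ≥0∞)⁻¹ * ∑ i, (ENNReal.ofReal (min (w' i) 1) * (thickening r' A).indicator 1 (x' i)
          + if i ∈ bad then 1 else 0) := by gcongr with i; exact hterm i
      _ = (N : ℝ≥0∞)⁻¹ * ∑ i, ENNReal.ofReal (min (w' i) 1) * (thickening r' A).indicator 1 (x' i)
          + (N : ℝ≥0∞)⁻¹ * (bad.card : ℝ≥0∞) := by
          rw [Finset.sum_add_distrib, mul_add]
          congr 2
          rw [Finset.sum_ite_mem, Finset.univ_inter]
          simp
      _ ≤ _ := by gcongr
  refine SubProb.dist_le_of_forall hr (key _ _ _ _ h) (key _ _ _ _ ?_)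
  convert h using 6 with i
  · exact eq_comm
  · rw [dist_comm]

end SubProbability

/-! ### Continuous modification as a measurable map of the path -/

section ContinuousPath

variable {E : Type*} [NormedAddCommGroup E]

/-- The last multiple of `1 / (n + 1)` that is not after `t`. -/
noncomputable def gridFloor (n : ℕ) (t : ℝ≥0) : ℝ≥0 := (⌊((n : ℝ≥0) + 1) * t⌋₊ : ℝ≥0) / (n + 1)

lemma gridFloor_le (n : ℕ) (t : ℝ≥0) : gridFloor n t ≤ t := by
  rw [gridFloor, div_le_iff₀ (by positivity), mul_comm]
  exact Nat.floor_le zero_le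

lemma tendsto_gridFloor (t : ℝ≥0) : Tendsto (fun n ↦ gridFloor n t) atTop (𝓝 t) := by
  rw [← NNReal.tendsto_coe]
  have h0 : Tendsto (fun n : ℕ ↦ (t : ℝ) - 1 / ((n : ℝ) + 1)) atTop (𝓝 t) := by
    simpa using tendsto_const_nhds.sub (tendsto_one_div_add_atTop_nhds_zero_nat (𝕜 := ℝ))
  refine tendsto_of_tendsto_of_tendsto_of_le_of_le h0 tendsto_const_nhds (fun n ↦ ?_)
    fun n ↦ NNReal.coe_le_coe.2 (gridFloor_le n t)
  have hn : (0 : ℝ) < (n : ℝ) + 1 := by positivity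
  have h1 : ((n : ℝ) + 1) * t < ⌊((n : ℝ≥0) + 1) * t⌋₊ + 1 := by
    have := Nat.lt_floor_add_one (((n : ℝ≥0) + 1) * t)
    exact_mod_cast this
  simp only [gridFloor]
  push_cast
  rw [le_div_iff₀ hn, sub_mul, div_mul_cancel₀ _ hn.ne']
  linarith

/-- The paths that are locally uniformly continuous on the nonnegative rational numbers. -/
def goodPaths (E : Type*) [NormedAddCommGroup E] : Set (ℝ≥0 → E) :=
  {b | ∀ M k : ℕ, ∃ j : ℕ, ∀ p q : ℕ × ℕ,
    (p.1 : ℝ≥0) / (p.2 + 1) ≤ M → (q.1 : ℝ≥0) / (q.2 + 1) ≤ M →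
    dist ((p.1 : ℝ≥0) / (p.2 + 1)) ((q.1 : ℝ≥0) / (q.2 + 1)) < 1 / ((j : ℝ) + 1) →
    dist (b ((p.1 : ℝ≥0) / (p.2 + 1))) (b ((q.1 : ℝ≥0) / (q.2 + 1))) ≤ 1 / ((k : ℝ) + 1)}

lemma measurableSet_goodPaths [MeasurableSpace E] [BorelSpace E] [SecondCountableTopology E] :
    MeasurableSet (goodPaths E) := by
  simp only [goodPaths, ofPred_forall, ofPred_exists]
  refine MeasurableSet.iInter fun M ↦ MeasurableSet.iInter fun k ↦ MeasurableSet.iUnion fun j ↦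
    MeasurableSet.iInter fun p ↦ MeasurableSet.iInter fun q ↦ MeasurableSet.iInter fun _ ↦
    MeasurableSet.iInter fun _ ↦ MeasurableSet.iInter fun _ ↦ ?_
  exact measurableSet_le ((measurable_pi_apply _).dist (measurable_pi_apply _)) measurable_const

open Classical in
/-- The continuous function that agrees with the path `b` on the nonnegative rational numbers, if
there is one, and the zero path otherwise. -/
noncomputable def regularize (b : ℝ≥0 → E) (t : ℝ≥0) : E :=
  if b ∈ goodPaths E then limUnder atTop fun n ↦ b (gridFloor n t) else 0

lemma exists_forall_dist_gridFloor_le {b : ℝ≥0 → E} (hb : b ∈ goodPaths E) (t : ℝ≥0) {η : ℝ}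
    (hη : 0 < η) : ∃ δ > 0, ∀ s, dist s t < δ → ∃ n₀, ∀ n ≥ n₀, ∀ m ≥ n₀,
      dist (b (gridFloor n s)) (b (gridFloor m t)) ≤ η := by
  obtain ⟨M, hM⟩ := exists_nat_gt (t + 1)
  obtain ⟨k, hk⟩ := exists_nat_one_div_lt hη
  obtain ⟨j, hj⟩ := hb M k
  have hjpos : (0 : ℝ) < 1 / ((j : ℝ) + 1) := by positivity
  refine ⟨min 1 (1 / ((j : ℝ) + 1) / 2), by positivity, fun s hs ↦ ?_⟩
  have hs1 := hs.trans_le (min_le_left _ _)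
  have hs2 := hs.trans_le (min_le_right _ _)
  have hsM : s ≤ M := by
    rw [NNReal.dist_eq, abs_lt] at hs1
    have : (s : ℝ) ≤ t + 1 := by linarith [hs1.2]
    have h2 : s ≤ t + 1 := by exact_mod_cast this
    exact h2.trans hM.le
  obtain ⟨n₁, hn₁⟩ := eventually_atTop.1 ((tendsto_gridFloor s).eventually
    (Metric.ball_mem_nhds s (by positivity : 0 < 1 / ((j : ℝ) + 1) / 4)))
  obtain ⟨n₂, hn₂⟩ := eventually_atTop.1 ((tendsto_gridFloor t).eventually
    (Metric.ball_mem_nhds t (by positivity : 0 < 1 / ((j : ℝ) + 1) / 4)))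
  refine ⟨max n₁ n₂, fun n hn m hm ↦ ?_⟩
  replace hn := hn₁ n ((le_max_left _ _).trans hn)
  replace hm := hn₂ m ((le_max_right _ _).trans hm)
  refine (hj (⌊((n : ℝ≥0) + 1) * s⌋₊, n) (⌊((m : ℝ≥0) + 1) * t⌋₊, m) ?_ ?_ ?_).trans hk.le
  · exact (gridFloor_le n s).trans hsM
  · exact (gridFloor_le m t).trans (le_self_add.trans hM.le)
  · change dist (gridFloor n s) (gridFloor m t) < _
    have hn' : dist (gridFloor n s) s < 1 / ((j : ℝ) + 1) / 4 := hn
    have hm' : dist t (gridFloor m t) < 1 / ((j : ℝ) + 1) / 4 := by rw [dist_comm]; exact hm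
    linarith [dist_triangle4 (gridFloor n s) s t (gridFloor m t)]

lemma tendsto_regularize [CompleteSpace E] {b : ℝ≥0 → E} (hb : b ∈ goodPaths E) (t : ℝ≥0) :
    Tendsto (fun n ↦ b (gridFloor n t)) atTop (𝓝 (regularize b t)) := by
  rw [regularize, if_pos hb]
  apply CauchySeq.tendsto_limUnder
  rw [Metric.cauchySeq_iff']
  intro η hη
  obtain ⟨δ, hδ, h⟩ := exists_forall_dist_gridFloor_le hb t (half_pos hη)
  obtain ⟨n₀, hn₀⟩ := h t (by simpa using hδ)
  exact ⟨n₀, fun n hn ↦ (hn₀ n hn n₀ le_rfl).trans_lt (half_lt_self hη)⟩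

lemma continuous_regularize [CompleteSpace E] (b : ℝ≥0 → E) : Continuous (regularize b) := by
  by_cases hb : b ∈ goodPaths E
  · rw [Metric.continuous_iff]
    intro t η hη
    obtain ⟨δ, hδ, h⟩ := exists_forall_dist_gridFloor_le hb t (half_pos hη)
    refine ⟨δ, hδ, fun s hs ↦ ?_⟩
    obtain ⟨n₀, hn₀⟩ := h s hs
    refine (le_of_tendsto ((tendsto_regularize hb s).dist (tendsto_regularize hb t)) ?_).trans_lt
      (half_lt_self hη)
    filter_upwards [eventually_ge_atTop n₀] with n hn using hn₀ n hn n hn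
  · have : regularize b = fun _ ↦ 0 := by ext t; simp [regularize, hb]
    rw [this]
    exact continuous_const

lemma regularize_eq_self [CompleteSpace E] {b : ℝ≥0 → E} (hb : Continuous b) :
    regularize b = b := by
  have hgood : b ∈ goodPaths E := by
    intro M k
    have h := (isCompact_Icc (a := (0 : ℝ≥0)) (b := M)).uniformContinuousOn_of_continuous
      hb.continuousOn
    rw [Metric.uniformContinuousOn_iff] at h
    obtain ⟨δ, hδ, h⟩ := h (1 / ((k : ℝ) + 1)) (by positivity)
    obtain ⟨j, hj⟩ := exists_nat_one_div_lt hδ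
    exact ⟨j, fun p q hp hq hpq ↦ (h _ ⟨zero_le, hp⟩ _ ⟨zero_le, hq⟩ (hpq.trans hj)).le⟩
  ext1 t
  exact tendsto_nhds_unique (tendsto_regularize hgood t)
    ((hb.tendsto t).comp (tendsto_gridFloor t))

lemma measurable_regularize_apply [CompleteSpace E] [MeasurableSpace E] [BorelSpace E]
    [SecondCountableTopology E] (t : ℝ≥0) : Measurable fun b : ℝ≥0 → E ↦ regularize b t := by
  have h : ∀ n, Measurable ((goodPaths E).indicator fun b ↦ b (gridFloor n t)) := fun n ↦
    (measurable_pi_apply _).indicator measurableSet_goodPaths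
  refine measurable_of_tendsto_metrizable h ?_
  rw [tendsto_pi_nhds]
  intro b
  by_cases hb : b ∈ goodPaths E
  · simpa [hb] using tendsto_regularize hb t
  · simp [hb, regularize]

lemma measurable_regularize [CompleteSpace E] [MeasurableSpace E] [BorelSpace E]
    [SecondCountableTopology E] :
    Measurable fun p : ℝ≥0 × (ℝ≥0 → E) ↦ regularize p.2 p.1 :=
  measurable_uncurry_of_continuous_of_measurable (u := fun t b ↦ regularize b t)
    continuous_regularize measurable_regularize_apply

end ContinuousPath

/-! ### Free trajectories as functions of i.i.d. marks -/

section Marks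

/-- The mark of a particle: its initial position and velocity, and its Brownian path. -/
abbrev Mark (d : ℕ) : Type := Phase d × (ℝ≥0 → EuclideanSpace ℝ (Fin d))

variable {d : ℕ}

/-- The free trajectory that is driven by a mark; the Brownian path is replaced by its continuous
version, so that the trajectory is a continuous and measurable function for every mark. -/
noncomputable def markTrajectory (t : ℝ≥0) (m : Mark d) : Phase d :=
  (m.1.1 + (t : ℝ) • m.1.2 + ∫ s in (0 : ℝ)..t, regularize m.2 s.toNNReal,
    m.1.2 + regularize m.2 t)

lemma continuous_markTrajectory (m : Mark d) : Continuous fun t ↦ markTrajectory t m := by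
  have h : Continuous fun s : ℝ ↦ regularize m.2 s.toNNReal :=
    (continuous_regularize m.2).comp continuous_real_toNNReal
  have h2 : Continuous fun t : ℝ≥0 ↦ ∫ s in (0 : ℝ)..t, regularize m.2 s.toNNReal :=
    (intervalIntegral.continuous_primitive (fun a b ↦ h.intervalIntegrable a b) 0).comp
      NNReal.continuous_coe
  have h3 := continuous_regularize m.2
  unfold markTrajectory
  fun_prop

lemma measurable_integral_regularize (t : ℝ≥0) :
    Measurable fun b : ℝ≥0 → EuclideanSpace ℝ (Fin d) ↦
      ∫ s in (0 : ℝ)..t, regularize b s.toNNReal := by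
  simp only [intervalIntegral.integral_of_le (NNReal.coe_nonneg t)]
  apply StronglyMeasurable.measurable
  apply StronglyMeasurable.integral_prod_right
  apply Measurable.stronglyMeasurable
  exact Measurable.comp (g := fun p : ℝ≥0 × (ℝ≥0 → EuclideanSpace ℝ (Fin d)) ↦ regularize p.2 p.1)
    (f := fun p : (ℝ≥0 → EuclideanSpace ℝ (Fin d)) × ℝ ↦ (p.2.toNNReal, p.1))
    measurable_regularize
    ((measurable_real_toNNReal.comp measurable_snd).prodMk measurable_fst)

lemma measurable_markTrajectory :
    Measurable fun p : ℝ≥0 × Mark d ↦ markTrajectory p.1 p.2 := by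
  refine measurable_uncurry_of_continuous_of_measurable (u := fun t m ↦ markTrajectory t m)
    continuous_markTrajectory fun t ↦ ?_
  have h1 : Measurable fun m : Mark d ↦ ∫ s in (0 : ℝ)..t, regularize m.2 s.toNNReal :=
    (measurable_integral_regularize (d := d) t).comp measurable_snd
  have h2 : Measurable fun m : Mark d ↦ regularize m.2 t :=
    (measurable_regularize_apply t).comp measurable_snd
  unfold markTrajectory
  refine Measurable.prodMk ?_ ?_
  · exact (by fun_prop : Measurable fun m : Mark d ↦ m.1.1 + (t : ℝ) • m.1.2).add h1
  · exact (by fun_prop : Measurable fun m : Mark d ↦ m.1.2).add h2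

lemma measurable_markTrajectory_apply (t : ℝ≥0) : Measurable (markTrajectory t : Mark d → Phase d) :=
  Measurable.comp (g := fun p : ℝ≥0 × Mark d ↦ markTrajectory p.1 p.2) (f := fun m ↦ (t, m))
    measurable_markTrajectory (measurable_const.prodMk measurable_id)

end Marks

/-! ### Joining and regrouping independent families -/

section Independence

variable {Ω : Type*} [MeasurableSpace Ω] {P : Measure Ω}

lemma iIndepFun_prodMk {ι : Type*} {α β : ι → Type*} [∀ i, MeasurableSpace (α i)]
    [∀ i, MeasurableSpace (β i)] {U : ∀ i, Ω → α i} {V : ∀ i, Ω → β i} (hU : iIndepFun U P)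
    (hV : iIndepFun V P) (hUV : IndepFun (fun ω i ↦ U i ω) (fun ω i ↦ V i ω) P)
    (hUm : ∀ i, Measurable (U i)) (hVm : ∀ i, Measurable (V i)) :
    iIndepFun (fun i ω ↦ (U i ω, V i ω)) P := by
  classical
  refine iIndepSets.iIndep (fun i ↦ ((hUm i).prodMk (hVm i)).comap_le)
    (fun i ↦ {s | ∃ A C, MeasurableSet A ∧ MeasurableSet C ∧ s = U i ⁻¹' A ∩ V i ⁻¹' C}) ?_ ?_ ?_
  · rintro i _ ⟨A, C, hA, hC, rfl⟩ _ ⟨A', C', hA', hC', rfl⟩ -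
    exact ⟨A ∩ A', C ∩ C', hA.inter hA', hC.inter hC', by ext; simp; tauto⟩
  · intro i
    change MeasurableSpace.comap (fun ω ↦ (U i ω, V i ω)) Prod.instMeasurableSpace = _
    rw [← generateFrom_prod, MeasurableSpace.comap_generateFrom]
    congr 1
    ext s
    constructor
    · rintro ⟨_, ⟨A, hA, C, hC, rfl⟩, rfl⟩
      exact ⟨A, C, hA, hC, rfl⟩
    · rintro ⟨A, C, hA, hC, rfl⟩
      exact ⟨_, ⟨A, hA, C, hC, rfl⟩, rfl⟩
  · rw [iIndepSets_iff]
    intro S f hf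
    choose! A C hA hC hAC using hf
    have h1 : ⋂ i ∈ S, f i = (⋂ i ∈ S, U i ⁻¹' A i) ∩ ⋂ i ∈ S, V i ⁻¹' C i := by
      ext ω
      simp only [mem_iInter, mem_inter_iff]
      constructor
      · intro h
        exact ⟨fun i hi ↦ (hAC i hi ▸ h i hi).1, fun i hi ↦ (hAC i hi ▸ h i hi).2⟩
      · rintro ⟨h, h'⟩ i hi
        rw [hAC i hi]
        exact ⟨h i hi, h' i hi⟩
    have h2 := hUV.measure_inter_preimage_eq_mul
      {u | ∀ i ∈ S, u i ∈ A i} {v | ∀ i ∈ S, v i ∈ C i}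
      (by
        have : {u : ∀ i, α i | ∀ i ∈ S, u i ∈ A i} = ⋂ i ∈ S, (fun u ↦ u i) ⁻¹' A i := by
          ext; simp
        rw [this]
        exact Finset.measurableSet_biInter S fun i hi ↦ measurable_pi_apply i (hA i hi))
      (by
        have : {u : ∀ i, β i | ∀ i ∈ S, u i ∈ C i} = ⋂ i ∈ S, (fun u ↦ u i) ⁻¹' C i := by
          ext; simp
        rw [this]
        exact Finset.measurableSet_biInter S fun i hi ↦ measurable_pi_apply i (hC i hi))
    have h3 : (fun ω i ↦ U i ω) ⁻¹' {u | ∀ i ∈ S, u i ∈ A i} = ⋂ i ∈ S, U i ⁻¹' A i := by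
      ext; simp
    have h4 : (fun ω i ↦ V i ω) ⁻¹' {u | ∀ i ∈ S, u i ∈ C i} = ⋂ i ∈ S, V i ⁻¹' C i := by
      ext; simp
    rw [h3, h4] at h2
    rw [h1, h2, hU.measure_inter_preimage_eq_mul S hA, hV.measure_inter_preimage_eq_mul S hC,
      ← Finset.prod_mul_distrib]
    refine Finset.prod_congr rfl fun i hi ↦ ?_
    rw [hAC i hi]
    exact ((hUV.comp (measurable_pi_apply i) (measurable_pi_apply i)).measure_inter_preimage_eq_mul
      _ _ (hA i hi) (hC i hi)).symm

lemma iIndepFun_curry [IsProbabilityMeasure P] {ι κ α : Type*} [MeasurableSpace α]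
    {V : ι × κ → Ω → α}
    (hV : iIndepFun V P) (hVm : ∀ p, Measurable (V p)) :
    iIndepFun (fun i ω (k : κ) ↦ V (i, k) ω) P := by
  have hpr : ∀ p, IsProbabilityMeasure (P.map (V p)) := fun p ↦
    Measure.isProbabilityMeasure_map (hVm p).aemeasurable
  have hm : ∀ i, Measurable fun ω (k : κ) ↦ V (i, k) ω := fun i ↦
    measurable_pi_lambda _ fun k ↦ hVm _
  rw [iIndepFun_iff_map_fun_eq_infinitePi_map hm]
  have h1 := (iIndepFun_iff_map_fun_eq_infinitePi_map hVm).1 hV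
  have h2 : ∀ i, P.map (fun ω (k : κ) ↦ V (i, k) ω) = Measure.infinitePi fun k ↦ P.map (V (i, k)) :=
    fun i ↦ (iIndepFun_iff_map_fun_eq_infinitePi_map fun k ↦ hVm (i, k)).1
      (hV.precomp (g := fun k ↦ (i, k)) fun k l h ↦ (Prod.mk.inj h).2)
  simp_rw [h2]
  rw [← Measure.infinitePi_map_curry (fun i k ↦ P.map (V (i, k)))]
  have h3 : (fun p : ι × κ ↦ P.map (V (p.1, p.2))) = fun p ↦ P.map (V p) := rfl
  rw [h3, ← h1, Measure.map_map (MeasurableEquiv.measurable _) (measurable_pi_lambda _ hVm)]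
  rfl

end Independence

/-! ### The law of a free particle -/

section DrivingNoise

variable {d : ℕ} {Ω : Type*} {f₀ : Phase d → ℝ} {Γ R : ℝ}
  {Z : ℕ → Ω → Phase d} {B : ℕ → ℝ≥0 → Ω → EuclideanSpace ℝ (Fin d)} {e : ℕ → ℕ → ℕ → Ω → ℝ}

/-- The mark of particle `i`. -/
def mark (Z : ℕ → Ω → Phase d) (B : ℕ → ℝ≥0 → Ω → EuclideanSpace ℝ (Fin d)) (i : ℕ) (ω : Ω) :
    Mark d :=
  (Z i ω, fun t ↦ B i t ω)

/-- The continuous versions of the Brownian paths. -/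
noncomputable def regularNoise (B : ℕ → ℝ≥0 → Ω → EuclideanSpace ℝ (Fin d)) (i : ℕ) (t : ℝ≥0)
    (ω : Ω) : EuclideanSpace ℝ (Fin d) :=
  regularize (fun s ↦ B i s ω) t

lemma freeParticle_regularNoise (i : ℕ) (t : ℝ≥0) (ω : Ω) :
    freeParticle Z (regularNoise B) i t ω = markTrajectory t (mark Z B i ω) := rfl

variable [MeasurableSpace Ω] {P : Measure Ω}

namespace IsDrivingNoise

variable (hP : IsDrivingNoise P f₀ Z B e)
include hP

lemma ae_regularNoise_eq : ∀ᵐ ω ∂P, ∀ i t, regularNoise B i t ω = B i t ω := by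
  have h : ∀ᵐ ω ∂P, ∀ i k, Continuous fun t ↦ B i t ω k := by
    simp_rw [ae_all_iff]
    exact fun i k ↦ (hP.brownian i k).cont
  filter_upwards [h] with ω hω i t
  have hc : Continuous fun t ↦ B i t ω := by
    have h1 : Continuous fun t ↦ (WithLp.ofLp (B i t ω)) := continuous_pi fun k ↦ hω i k
    exact (PiLp.continuous_toLp 2 _).comp h1
  exact congrFun (regularize_eq_self hc) t

lemma measurable_path (i : ℕ) : Measurable fun ω t ↦ B i t ω :=
  measurable_pi_lambda _ fun t ↦ hP.measurable_brownian i t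

lemma measurable_mark (i : ℕ) : Measurable (mark Z B i) :=
  (hP.measurable_init i).prodMk (hP.measurable_path i)

omit hP in
lemma measurable_assemble : Measurable fun (u : Fin d → ℝ≥0 → ℝ) (t : ℝ≥0) ↦
    (WithLp.toLp 2 fun k ↦ u k t : EuclideanSpace ℝ (Fin d)) := by
  refine measurable_pi_lambda _ fun t ↦ ?_
  refine (PiLp.continuous_toLp 2 _).measurable.comp (measurable_pi_lambda _ fun k ↦ ?_)
  exact (measurable_pi_apply t).comp (measurable_pi_apply k)

lemma measurable_coordinate (p : ℕ × Fin d) : Measurable fun ω (t : ℝ≥0) ↦ B p.1 t ω p.2 := by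
  refine measurable_pi_lambda _ fun t ↦ ?_
  have h := hP.measurable_brownian p.1 t
  fun_prop

lemma iIndepFun_path [IsProbabilityMeasure P] : iIndepFun (fun i ω t ↦ B i t ω) P :=
  (iIndepFun_curry hP.indep_brownian hP.measurable_coordinate).comp _ fun _ ↦ measurable_assemble

lemma iIndepFun_mark [IsProbabilityMeasure P] : iIndepFun (mark Z B) P :=
  iIndepFun_prodMk hP.indep_init hP.iIndepFun_path hP.indep_init_brownian hP.measurable_init
    hP.measurable_path

lemma identDistrib_path [IsProbabilityMeasure P] (i : ℕ) :
    IdentDistrib (fun ω t ↦ B i t ω) (fun ω t ↦ B 0 t ω) P P := by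
  have h : ∀ k : Fin d, IdentDistrib (fun ω (t : ℝ≥0) ↦ B i t ω k) (fun ω (t : ℝ≥0) ↦ B 0 t ω k) P P := by
    intro k
    have h1 := fun j ↦ (hP.measurable_coordinate (j, k)).aemeasurable (μ := P)
    rw [identDistrib_iff_forall_finset_identDistrib (h1 i) (h1 0)]
    intro I
    have hi := (hP.brownian i k).hasLaw I
    have h0 := (hP.brownian 0 k).hasLaw I
    exact ⟨hi.aemeasurable, h0.aemeasurable, hi.map_eq.trans h0.map_eq.symm⟩
  have hpi := IdentDistrib.pi h
    (hP.indep_brownian.precomp (g := fun k ↦ (i, k)) fun k l h ↦ (Prod.mk.inj h).2)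
    (hP.indep_brownian.precomp (g := fun k ↦ (0, k)) fun k l h ↦ (Prod.mk.inj h).2)
  exact hpi.comp measurable_assemble

lemma indepFun_init_path (i : ℕ) : IndepFun (Z i) (fun ω t ↦ B i t ω) P :=
  hP.indep_init_brownian.comp (measurable_pi_apply i) (measurable_pi_apply i)

lemma map_mark [IsProbabilityMeasure P] (i : ℕ) :
    P.map (mark Z B i) = P.map (mark Z B 0) := by
  refine (IdentDistrib.prodMk ⟨?_, ?_, ?_⟩ (hP.identDistrib_path i) (hP.indepFun_init_path i)
    (hP.indepFun_init_path 0)).map_eq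
  · exact (hP.measurable_init i).aemeasurable
  · exact (hP.measurable_init 0).aemeasurable
  · rw [(hP.law_init i).map_eq, (hP.law_init 0).map_eq]

lemma map_mark_eq_prod [IsProbabilityMeasure P] (i : ℕ) :
    P.map (mark Z B i) = (volume.withDensity fun z ↦ ENNReal.ofReal (f₀ z)).prod
      (P.map fun ω t ↦ B i t ω) := by
  rw [← (hP.law_init i).map_eq]
  exact (indepFun_iff_map_prod_eq_prod_map_map (hP.measurable_init i).aemeasurable
    (hP.measurable_path i).aemeasurable).1 (hP.indepFun_init_path i)

lemma indepFun_clock_mark (N : ℕ) :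
    IndepFun (fun ω (i j : ℕ) ↦ e N i j ω) (fun ω i ↦ mark Z B i ω) P := by
  refine (hP.indep_clock_rest N).comp measurable_id
    (ψ := fun p : (ℕ → Phase d) × (ℕ → ℝ≥0 → EuclideanSpace ℝ (Fin d)) ↦ fun i ↦ (p.1 i, p.2 i)) ?_
  refine measurable_pi_lambda _ fun i ↦ ?_
  exact ((measurable_pi_apply i).comp measurable_fst).prodMk
    ((measurable_pi_apply i).comp measurable_snd)

end IsDrivingNoise

/-- The velocity of a particle is bounded initially, so transport along the initial velocity keeps
the spatial density of a particle below `Γ` times the volume of a ball of radius `R`. Adding an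
independent displacement cannot increase the bound. -/
lemma IsInitialDensity.measure_transport_le (hf₀ : IsInitialDensity f₀ Γ R) (t : ℝ)
    (c : EuclideanSpace ℝ (Fin d)) {A : Set (EuclideanSpace ℝ (Fin d))} (hA : MeasurableSet A) :
    (volume.withDensity fun z ↦ ENNReal.ofReal (f₀ z)) {z : Phase d | z.1 + t • z.2 + c ∈ A}
      ≤ ENNReal.ofReal Γ * volume (closedBall (0 : EuclideanSpace ℝ (Fin d)) |R|) * volume A := by
  have hmeas : MeasurableSet {z : Phase d | z.1 + t • z.2 + c ∈ A} := by
    have : Measurable fun z : Phase d ↦ z.1 + t • z.2 + c := by fun_prop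
    exact this hA
  rw [withDensity_apply _ hmeas, ← lintegral_indicator hmeas]
  have hball : MeasurableSet (closedBall (0 : EuclideanSpace ℝ (Fin d)) |R|) :=
    isClosed_closedBall.measurableSet
  calc ∫⁻ z, {z : Phase d | z.1 + t • z.2 + c ∈ A}.indicator (fun z ↦ ENNReal.ofReal (f₀ z)) z
      ≤ ∫⁻ z : Phase d, ENNReal.ofReal Γ * ((closedBall 0 |R|).indicator 1 z.2 *
          A.indicator 1 (z.1 + (t • z.2 + c))) := by
        refine lintegral_mono_ae ?_
        filter_upwards [hf₀.bounded, hf₀.support] with z h1 h2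
        by_cases hz : z.1 + t • z.2 + c ∈ A
        · have hz' : z.1 + (t • z.2 + c) ∈ A := by rwa [← add_assoc]
          rw [indicator_of_mem (show z ∈ {z : Phase d | z.1 + t • z.2 + c ∈ A} from hz),
            indicator_of_mem hz']
          by_cases h0 : f₀ z = 0
          · simp [h0]
          · have h3 := h2 h0
            have h4 : z.2 ∈ closedBall (0 : EuclideanSpace ℝ (Fin d)) |R| := by
              rw [mem_closedBall_zero_iff]
              refine abs_le_of_sq_le_sq' ?_ (abs_nonneg _) |>.2
              rw [sq_abs]
              nlinarith [sq_nonneg ‖z.1‖]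
            rw [indicator_of_mem h4]
            simpa using ENNReal.ofReal_le_ofReal h1
        · rw [indicator_of_notMem (show z ∉ {z : Phase d | z.1 + t • z.2 + c ∈ A} from hz)]
          exact zero_le
    _ = ENNReal.ofReal Γ * ∫⁻ v : EuclideanSpace ℝ (Fin d),
          ∫⁻ x : EuclideanSpace ℝ (Fin d), (closedBall 0 |R|).indicator 1 v *
          A.indicator 1 (x + (t • v + c)) := by
        rw [lintegral_const_mul' _ _ ENNReal.ofReal_ne_top, Measure.volume_eq_prod,
          lintegral_prod_symm']
        refine (Measurable.mul ?_ ?_)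
        · exact (measurable_one.indicator hball).comp measurable_snd
        · exact (measurable_one.indicator hA).comp (by fun_prop)
    _ = ENNReal.ofReal Γ * ∫⁻ v : EuclideanSpace ℝ (Fin d),
          (closedBall 0 |R|).indicator 1 v * volume A := by
        congr 1
        refine lintegral_congr fun v ↦ ?_
        have hmx : Measurable fun x : EuclideanSpace ℝ (Fin d) ↦
            A.indicator (1 : EuclideanSpace ℝ (Fin d) → ℝ≥0∞) (x + (t • v + c)) :=
          (measurable_one.indicator hA).comp (measurable_id.add_const _)
        rw [lintegral_const_mul _ hmx,
          lintegral_add_right_eq_self (A.indicator (1 : EuclideanSpace ℝ (Fin d) → ℝ≥0∞)) (t • v + c),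
          lintegral_indicator_one hA]
    _ = _ := by
        rw [lintegral_mul_const _ (measurable_one.indicator hball), lintegral_indicator_one hball,
          mul_assoc]

namespace IsDrivingNoise

variable (hP : IsDrivingNoise P f₀ Z B e)
include hP

/-- The spatial density of a free particle is bounded uniformly in time. -/
lemma map_position_le [IsProbabilityMeasure P] (hf₀ : IsInitialDensity f₀ Γ R) (t : ℝ≥0) :
    (P.map (mark Z B 0)).map (fun m ↦ (markTrajectory t m).1)
      ≤ (ENNReal.ofReal Γ * volume (closedBall (0 : EuclideanSpace ℝ (Fin d)) |R|)) • volume := by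
  have hm : Measurable fun m : Mark d ↦ (markTrajectory t m).1 :=
    (measurable_markTrajectory_apply t).fst
  have hpr : IsProbabilityMeasure (P.map fun ω t ↦ B 0 t ω) :=
    Measure.isProbabilityMeasure_map (hP.measurable_path 0).aemeasurable
  have hsf : SFinite (volume.withDensity fun z : Phase d ↦ ENNReal.ofReal (f₀ z)) := by
    rw [← (hP.law_init 0).map_eq]; infer_instance
  refine Measure.le_iff.2 fun A hA ↦ ?_
  rw [Measure.map_apply hm hA, hP.map_mark_eq_prod, Measure.prod_apply_symm (hm hA),
    Measure.smul_apply, smul_eq_mul]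
  calc ∫⁻ b, (volume.withDensity fun z ↦ ENNReal.ofReal (f₀ z))
        ((fun z ↦ (z, b)) ⁻¹' ((fun m : Mark d ↦ (markTrajectory t m).1) ⁻¹' A))
          ∂(P.map fun ω t ↦ B 0 t ω)
      ≤ ∫⁻ _, ENNReal.ofReal Γ * volume (closedBall (0 : EuclideanSpace ℝ (Fin d)) |R|) * volume A
          ∂(P.map fun ω t ↦ B 0 t ω) :=
        lintegral_mono fun b ↦ by
          have h := hf₀.measure_transport_le t (∫ s in (0 : ℝ)..t, regularize b s.toNNReal) hA
          exact h
    _ = _ := by simp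

/-- The law of a free particle is absolutely continuous: for a given Brownian path, the particle is
at the image of the initial datum under a volume preserving map (a shear and a translation). -/
lemma map_trajectory_absolutelyContinuous [IsProbabilityMeasure P] (t : ℝ≥0) :
    (P.map (mark Z B 0)).map (markTrajectory t) ≪ volume := by
  have hpr : IsProbabilityMeasure (P.map fun ω t ↦ B 0 t ω) :=
    Measure.isProbabilityMeasure_map (hP.measurable_path 0).aemeasurable
  have hsf : SFinite (volume.withDensity fun z : Phase d ↦ ENNReal.ofReal (f₀ z)) := by
    rw [← (hP.law_init 0).map_eq]; infer_instance
  have hm := measurable_markTrajectory_apply (d := d) t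
  refine Measure.AbsolutelyContinuous.mk fun A hA hA0 ↦ ?_
  rw [Measure.map_apply hm hA, hP.map_mark_eq_prod, Measure.prod_apply_symm (hm hA)]
  refine (lintegral_congr fun b ↦ ?_).trans lintegral_zero
  refine withDensity_absolutelyContinuous _ _ ?_
  -- the shear followed by the translation, one velocity at a time
  set c : EuclideanSpace ℝ (Fin d) := ∫ s in (0 : ℝ)..t, regularize b s.toNNReal with hc
  have hset : MeasurableSet ((fun z : Phase d ↦ (z, b)) ⁻¹' (markTrajectory t ⁻¹' A)) :=
    measurable_prodMk_right (hm hA)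
  rw [Measure.volume_eq_prod] at hA0 ⊢
  rw [Measure.prod_apply_symm hset]
  rw [Measure.prod_apply_symm hA] at hA0
  have h1 : ∀ v : EuclideanSpace ℝ (Fin d),
      volume ((fun x ↦ (x, v)) ⁻¹' ((fun z : Phase d ↦ (z, b)) ⁻¹' (markTrajectory t ⁻¹' A)))
        = volume ((fun x ↦ (x, v + regularize b t)) ⁻¹' A) := by
    intro v
    have : (fun x ↦ (x, v)) ⁻¹' ((fun z : Phase d ↦ (z, b)) ⁻¹' (markTrajectory t ⁻¹' A))
        = (fun x ↦ x + ((t : ℝ) • v + c)) ⁻¹' ((fun x ↦ (x, v + regularize b t)) ⁻¹' A) := by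
      ext x
      simp only [mem_preimage, markTrajectory, hc, add_assoc]
    rw [this, measure_preimage_add_right]
  simp_rw [h1]
  rw [lintegral_add_right_eq_self (fun v ↦ volume ((fun x ↦ (x, v)) ⁻¹' A)) (regularize b t)]
  exact hA0

end IsDrivingNoise

end DrivingNoise

/-! ### Annihilation times -/

section Lifetime

variable {ι : Type*} {τ : ι → ι → ℝ≥0∞}

lemma firstRing_antitone (τ : ι → ι → ℝ≥0∞) : Antitone (firstRing τ) := fun _ _ h ↦
  biInf_mono h |>.trans' <| iInf₂_mono fun _ _ ↦ biInf_mono h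

lemma measurable_firstRing [Countable ι] (A : Finset ι) :
    Measurable fun τ : ι → ι → ℝ≥0∞ ↦ firstRing τ A := by
  unfold firstRing
  refine Measurable.iInf fun j ↦ Measurable.iInf fun _ ↦ Measurable.iInf fun k ↦
    Measurable.iInf fun _ ↦ Measurable.iInf fun _ ↦ ?_
  exact (measurable_pi_apply k).comp (measurable_pi_apply j)

variable [Fintype ι]

lemma survivors_succ_subset (τ : ι → ι → ℝ≥0∞) (k : ℕ) : survivors τ (k + 1) ⊆ survivors τ k := by
  classical
  exact Finset.filter_subset _ _

lemma survivors_antitone (τ : ι → ι → ℝ≥0∞) : Antitone (survivors τ) :=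
  antitone_nat_of_succ_le (survivors_succ_subset τ)

/-- A particle that is removed at a finite time is removed by the ring of a pair it belongs to. -/
lemma exists_ring_eq_lifetime {i : ι} (hi : lifetime τ i ≠ ∞) :
    ∃ j, j ≠ i ∧ (τ i j = lifetime τ i ∨ τ j i = lifetime τ i) := by
  classical
  have hex : ∃ k, i ∉ survivors τ (k + 1) := by
    by_contra! h
    apply hi
    simp [lifetime, h]
  set k := Nat.find hex with hk
  have hk1 : i ∉ survivors τ (k + 1) := Nat.find_spec hex
  have hk2 : i ∈ survivors τ k := by
    rcases Nat.eq_zero_or_pos k with h0 | h0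
    · rw [h0]; exact Finset.mem_univ i
    · have := Nat.find_min hex (m := k - 1) (by omega)
      rwa [not_not, Nat.sub_add_cancel h0] at this
  have hlife : lifetime τ i = firstRing τ (survivors τ k) := by
    apply le_antisymm
    · exact iInf₂_le k hk1
    · refine le_iInf₂ fun k' hk' ↦ firstRing_antitone τ (survivors_antitone τ ?_)
      exact Nat.find_min' hex hk'
  rw [hlife]
  simp only [survivors, Finset.mem_filter, not_and, not_forall] at hk1
  obtain ⟨j, -, hji, h⟩ := hk1 hk2
  exact ⟨j, hji, by tauto⟩

open Classical in
lemma card_lifetime_mem_le {s t : ℝ≥0∞} :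
    (Finset.univ.filter fun i ↦ s < lifetime τ i ∧ lifetime τ i < t).card
      ≤ 2 * ((Finset.univ : Finset ι).offDiag.filter fun p ↦
          s < τ p.1 p.2 ∧ τ p.1 p.2 < t).card := by
  set F := (Finset.univ : Finset ι).offDiag.filter fun p ↦ s < τ p.1 p.2 ∧ τ p.1 p.2 < t with hF
  have hsub : (Finset.univ.filter fun i ↦ s < lifetime τ i ∧ lifetime τ i < t)
      ⊆ F.image Prod.fst ∪ F.image Prod.snd := by
    intro i hi
    simp only [Finset.mem_filter, Finset.mem_univ, true_and] at hi
    obtain ⟨j, hji, h | h⟩ := exists_ring_eq_lifetime hi.2.ne_top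
    · refine Finset.mem_union_left _ (Finset.mem_image.2 ⟨(i, j), ?_, rfl⟩)
      simp [hF, h, hi, hji.symm]
    · refine Finset.mem_union_right _ (Finset.mem_image.2 ⟨(j, i), ?_, rfl⟩)
      simp [hF, h, hi, hji]
  calc _ ≤ (F.image Prod.fst ∪ F.image Prod.snd).card := Finset.card_le_card hsub
    _ ≤ (F.image Prod.fst).card + (F.image Prod.snd).card := Finset.card_union_le _ _
    _ ≤ F.card + F.card := add_le_add Finset.card_image_le Finset.card_image_le
    _ = 2 * F.card := (two_mul _).symm

lemma measurableSet_survivors_eq (k : ℕ) (A : Finset ι) :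
    MeasurableSet {τ : ι → ι → ℝ≥0∞ | survivors τ k = A} := by
  induction k generalizing A with
  | zero => exact MeasurableSet.const (Finset.univ = A)
  | succ k ih =>
    have : {τ : ι → ι → ℝ≥0∞ | survivors τ (k + 1) = A}
        = ⋃ A' : Finset ι, {τ | survivors τ k = A'} ∩ {τ | ∀ i, (i ∈ A' ∧ ∀ j ∈ A', j ≠ i →
              τ i j ≠ firstRing τ A' ∧ τ j i ≠ firstRing τ A') ↔ i ∈ A} := by
      ext τ
      simp only [mem_iUnion, mem_inter_iff, mem_ofPred_eq, exists_eq_left']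
      simp [survivors, Finset.ext_iff]
    rw [this]
    refine MeasurableSet.iUnion fun A' ↦ (ih A').inter (measurableSet_setOfPred.2 ?_)
    refine Measurable.forall fun i ↦ Measurable.iff (measurable_const.and ?_) measurable_const
    refine Measurable.forall fun j ↦ measurable_const.imp (measurable_const.imp ?_)
    have h1 : ∀ a b, Measurable fun τ : ι → ι → ℝ≥0∞ ↦ τ a b ≠ firstRing τ A' := fun a b ↦
      measurableSet_setOfPred.1 (measurableSet_eq_fun
        ((measurable_pi_apply b).comp (measurable_pi_apply a)) (measurable_firstRing A')).compl
    exact (h1 i j).and (h1 j i)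

lemma measurable_lifetime (i : ι) : Measurable fun τ : ι → ι → ℝ≥0∞ ↦ lifetime τ i := by
  unfold lifetime
  refine Measurable.iInf fun k ↦ ?_
  -- the removal times take countably many forms, one for each value of the sets of survivors
  have : (fun τ : ι → ι → ℝ≥0∞ ↦ ⨅ (_ : i ∉ survivors τ (k + 1)), firstRing τ (survivors τ k))
      = fun τ ↦ ⨅ (A : Finset ι) (A' : Finset ι),
        ({τ | survivors τ k = A} ∩ {τ | survivors τ (k + 1) = A'})ᶜ.indicator (fun _ ↦ ∞) τ
          + ⨅ (_ : i ∉ A'), firstRing τ A := by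
    ext τ
    apply le_antisymm
    · refine le_iInf₂ fun A A' ↦ ?_
      by_cases h : survivors τ k = A ∧ survivors τ (k + 1) = A'
      · obtain ⟨rfl, rfl⟩ := h
        exact le_add_self
      · rw [indicator_of_mem (by simpa using h)]
        simp
    · refine (iInf₂_le (survivors τ k) (survivors τ (k + 1))).trans ?_
      simp
  rw [this]
  refine Measurable.iInf fun A ↦ Measurable.iInf fun A' ↦ Measurable.add ?_ ?_
  · exact measurable_const.indicator
      ((measurableSet_survivors_eq k A).inter (measurableSet_survivors_eq (k + 1) A')).compl
  · exact Measurable.iInf fun _ ↦ measurable_firstRing A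

end Lifetime

/-! ### Cumulative rates along the free trajectories -/

section Rate

variable {d : ℕ} {θ : EuclideanSpace ℝ (Fin d) → ℝ} {a : ℝ} {N : ℕ}

/-- The cumulative annihilation rate of a pair as a function of the marks of the particles. -/
noncomputable def markRate (θ : EuclideanSpace ℝ (Fin d) → ℝ) (a : ℝ) (N : ℕ) (t : ℝ≥0)
    (m m' : Mark d) : ℝ :=
  ∫ s in (0 : ℝ)..t, (N : ℝ)⁻¹ *
    rescale θ a ((markTrajectory s.toNNReal m).1 - (markTrajectory s.toNNReal m').1)

namespace IsInteractionKernel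

variable (hθ : IsInteractionKernel θ)
include hθ

lemma continuous_rescale (a : ℝ) : Continuous (rescale θ a) := by
  have := hθ.smooth.continuous
  unfold rescale
  fun_prop

lemma rescale_nonneg (ha : 0 ≤ a) (x : EuclideanSpace ℝ (Fin d)) : 0 ≤ rescale θ a x :=
  mul_nonneg (by positivity) (hθ.nonneg _)

lemma rescale_neg (a : ℝ) (x : EuclideanSpace ℝ (Fin d)) : rescale θ a (-x) = rescale θ a x := by
  simp [rescale, hθ.even]

lemma lintegral_rescale (ha : 0 < a) : ∫⁻ x, ENNReal.ofReal (rescale θ a x) = 1 := by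
  have hint : Integrable θ := by
    by_contra h
    have := hθ.integral_eq_one
    rw [integral_undef h] at this
    exact zero_ne_one this
  have hint' : Integrable (rescale θ a) := by
    have := (hint.comp_smul (inv_ne_zero ha.ne')).const_mul (a ^ d)⁻¹
    exact this
  rw [← ofReal_integral_eq_lintegral_ofReal hint'
    (Eventually.of_forall (hθ.rescale_nonneg ha.le))]
  unfold rescale
  rw [integral_const_mul, Measure.integral_comp_inv_smul, finrank_euclideanSpace_fin,
    hθ.integral_eq_one, abs_of_pos (pow_pos ha d), smul_eq_mul, mul_one,
    inv_mul_cancel₀ (pow_pos ha d).ne', ENNReal.ofReal_one]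

lemma continuous_rate_integrand (N : ℕ) (m m' : Mark d) : Continuous fun s : ℝ ↦ (N : ℝ)⁻¹ *
    rescale θ a ((markTrajectory s.toNNReal m).1 - (markTrajectory s.toNNReal m').1) := by
  have h := hθ.continuous_rescale a
  have h1 := (continuous_markTrajectory m).comp continuous_real_toNNReal
  have h2 := (continuous_markTrajectory m').comp continuous_real_toNNReal
  exact continuous_const.mul (h.comp (h1.fst.sub h2.fst))

lemma markRate_comm (t : ℝ≥0) (m m' : Mark d) :
    markRate θ a N t m m' = markRate θ a N t m' m := by
  unfold markRate
  congr 1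
  ext s
  rw [← hθ.rescale_neg, neg_sub]

lemma ofReal_markRate_sub (ha : 0 ≤ a) {s t : ℝ≥0} (hst : s ≤ t) (m m' : Mark d) :
    ENNReal.ofReal (markRate θ a N t m m' - markRate θ a N s m m')
      = ∫⁻ u in Ioc (s : ℝ) t, ENNReal.ofReal ((N : ℝ)⁻¹ *
        rescale θ a ((markTrajectory u.toNNReal m).1 - (markTrajectory u.toNNReal m').1)) := by
  have hc := hθ.continuous_rate_integrand (a := a) N m m'
  unfold markRate
  rw [intervalIntegral.integral_interval_sub_left (hc.intervalIntegrable _ _)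
    (hc.intervalIntegrable _ _), intervalIntegral.integral_of_le (NNReal.coe_le_coe.2 hst),
    ofReal_integral_eq_lintegral_ofReal]
  · exact (hc.intervalIntegrable _ _).1
  · exact Eventually.of_forall fun u ↦ mul_nonneg (by positivity) (hθ.rescale_nonneg ha _)

lemma markRate_mono (ha : 0 ≤ a) (m m' : Mark d) : Monotone fun t ↦ markRate θ a N t m m' := by
  intro s t hst
  have hc := hθ.continuous_rate_integrand (a := a) N m m'
  refine intervalIntegral.integral_mono_interval le_rfl s.2 (NNReal.coe_le_coe.2 hst)
    (Eventually.of_forall fun u ↦ mul_nonneg (by positivity) (hθ.rescale_nonneg ha _))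
    (hc.intervalIntegrable _ _)

lemma measurable_rate_integrand (a : ℝ) (N : ℕ) : Measurable fun p : (Mark d × Mark d) × ℝ ↦
    (N : ℝ)⁻¹ * rescale θ a ((markTrajectory p.2.toNNReal p.1.1).1
      - (markTrajectory p.2.toNNReal p.1.2).1) := by
  have h1 : Measurable fun p : (Mark d × Mark d) × ℝ ↦ markTrajectory p.2.toNNReal p.1.1 :=
    Measurable.comp (g := fun p : ℝ≥0 × Mark d ↦ markTrajectory p.1 p.2)
      (f := fun p : (Mark d × Mark d) × ℝ ↦ (p.2.toNNReal, p.1.1)) measurable_markTrajectory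
      ((measurable_real_toNNReal.comp measurable_snd).prodMk measurable_fst.fst)
  have h2 : Measurable fun p : (Mark d × Mark d) × ℝ ↦ markTrajectory p.2.toNNReal p.1.2 :=
    Measurable.comp (g := fun p : ℝ≥0 × Mark d ↦ markTrajectory p.1 p.2)
      (f := fun p : (Mark d × Mark d) × ℝ ↦ (p.2.toNNReal, p.1.2)) measurable_markTrajectory
      ((measurable_real_toNNReal.comp measurable_snd).prodMk measurable_fst.snd)
  exact measurable_const.mul ((hθ.continuous_rescale a).measurable.comp (h1.fst.sub h2.fst))

lemma measurable_markRate (a : ℝ) (N : ℕ) (t : ℝ≥0) :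
    Measurable fun p : Mark d × Mark d ↦ markRate θ a N t p.1 p.2 := by
  unfold markRate
  simp only [intervalIntegral.integral_of_le (NNReal.coe_nonneg t)]
  apply StronglyMeasurable.measurable
  apply StronglyMeasurable.integral_prod_right
  exact (hθ.measurable_rate_integrand a N).stronglyMeasurable

/-- However one particle moves, the expected cumulative rate at which it meets an independent
particle is controlled by the bound `K` on the spatial density of the latter. -/
lemma lintegral_markRate_le (ha : 0 < a) {ν : Measure (Mark d)} [SFinite ν] {K : ℝ≥0∞}
    (hν : ∀ t, ν.map (fun m ↦ (markTrajectory t m).1) ≤ K • volume) {s t : ℝ≥0} (hst : s ≤ t)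
    (m : Mark d) :
    ∫⁻ m', ENNReal.ofReal (markRate θ a N t m m' - markRate θ a N s m m') ∂ν
      ≤ ENNReal.ofReal ((N : ℝ)⁻¹) * K * ENNReal.ofReal (t - s) := by
  simp_rw [hθ.ofReal_markRate_sub ha.le hst]
  have hmeas := (hθ.measurable_rate_integrand a N).ennreal_ofReal
  rw [lintegral_lintegral_swap]
  swap
  · exact (hmeas.comp ((measurable_const.prodMk measurable_fst).prodMk measurable_snd)).aemeasurable
  calc ∫⁻ u in Ioc (s : ℝ) t, ∫⁻ m', ENNReal.ofReal ((N : ℝ)⁻¹ *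
        rescale θ a ((markTrajectory u.toNNReal m).1 - (markTrajectory u.toNNReal m').1)) ∂ν
      ≤ ∫⁻ u in Ioc (s : ℝ) t, ENNReal.ofReal ((N : ℝ)⁻¹) * K := by
        refine lintegral_mono fun u ↦ ?_
        set x := (markTrajectory u.toNNReal m).1 with hx
        have hg : Measurable fun y ↦ ENNReal.ofReal ((N : ℝ)⁻¹ * rescale θ a (x - y)) := by
          have := (hθ.continuous_rescale a).measurable
          fun_prop
        have hpos : Measurable fun m : Mark d ↦ (markTrajectory u.toNNReal m).1 :=
          (measurable_markTrajectory_apply u.toNNReal).fst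
        change ∫⁻ m', (fun y ↦ ENNReal.ofReal ((N : ℝ)⁻¹ * rescale θ a (x - y)))
          ((markTrajectory u.toNNReal m').1) ∂ν ≤ _
        rw [← lintegral_map hg hpos]
        refine (lintegral_mono' (hν _) le_rfl).trans ?_
        rw [lintegral_smul_measure]
        simp_rw [ENNReal.ofReal_mul (show (0 : ℝ) ≤ (N : ℝ)⁻¹ by positivity)]
        rw [lintegral_const_mul' _ _ ENNReal.ofReal_ne_top,
          lintegral_sub_left_eq_self (fun y ↦ ENNReal.ofReal (rescale θ a y)) x,
          hθ.lintegral_rescale ha, mul_one, smul_eq_mul, mul_comm]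
    _ = _ := by simp

end IsInteractionKernel

end Rate

/-! ### Second moment of the number of rings in a time interval -/

section ExponentialClock

lemma expMeasure_Ioc_le (x y : ℝ) : expMeasure 1 (Ioc x y) ≤ ENNReal.ofReal (y - x) := by
  have h : ∀ z, gammaPDF 1 1 z ≤ 1 := by
    intro z
    rw [gammaPDF, ENNReal.ofReal_le_one, gammaPDFReal]
    split_ifs with hz
    · simp [hz]
    · exact zero_le_one
  rw [expMeasure, gammaMeasure, withDensity_apply _ measurableSet_Ioc]
  calc ∫⁻ z in Ioc x y, gammaPDF 1 1 z ≤ ∫⁻ _ in Ioc x y, 1 := lintegral_mono fun z ↦ h z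
    _ = _ := by simp

variable {Ω Y : Type*} [MeasurableSpace Ω] [MeasurableSpace Y] {P : Measure Ω}
  [IsProbabilityMeasure P] {H : Ω → Y} {lo hi lo' hi' : Y → ℝ} {C C' : Ω → ℝ}

instance : IsProbabilityMeasure (expMeasure 1) := isProbabilityMeasure_expMeasure one_pos

/-- The probability that an exponential clock of rate one rings in an independent random interval is
at most the expected length of the interval. -/
lemma measure_clock_le (hC : HasLaw C (expMeasure 1) P) (hCm : Measurable C) (hH : Measurable H)
    (hCH : IndepFun C H P) (hlo : Measurable lo) (hhi : Measurable hi) :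
    P {ω | lo (H ω) < C ω ∧ C ω ≤ hi (H ω)} ≤ ∫⁻ ω, ENNReal.ofReal (hi (H ω) - lo (H ω)) ∂P := by
  have hS : MeasurableSet {p : ℝ × Y | lo p.2 < p.1 ∧ p.1 ≤ hi p.2} :=
    (measurableSet_lt (hlo.comp measurable_snd) measurable_fst).inter
      (measurableSet_le measurable_fst (hhi.comp measurable_snd))
  have hlaw := (indepFun_iff_map_prod_eq_prod_map_map hCm.aemeasurable hH.aemeasurable).1 hCH
  rw [hC.map_eq] at hlaw
  have hpr := Measure.isProbabilityMeasure_map (μ := P) hH.aemeasurable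
  calc P {ω | lo (H ω) < C ω ∧ C ω ≤ hi (H ω)}
      = P.map (fun ω ↦ (C ω, H ω)) {p : ℝ × Y | lo p.2 < p.1 ∧ p.1 ≤ hi p.2} := by
        rw [Measure.map_apply (hCm.prodMk hH) hS]; rfl
    _ = ∫⁻ y, expMeasure 1 (Ioc (lo y) (hi y)) ∂(P.map H) := by
        rw [hlaw, Measure.prod_apply_symm hS]; rfl
    _ ≤ ∫⁻ y, ENNReal.ofReal (hi y - lo y) ∂(P.map H) :=
        lintegral_mono fun y ↦ expMeasure_Ioc_le _ _
    _ = _ := lintegral_map (hhi.sub hlo).ennreal_ofReal hH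

/-- The version of `measure_clock_le` for two independent clocks: given the random intervals, the clocks
ring independently. -/
lemma measure_two_clocks_le (hC : HasLaw C (expMeasure 1) P) (hCm : Measurable C)
    (hC' : HasLaw C' (expMeasure 1) P) (hCm' : Measurable C') (hCC' : IndepFun C C' P)
    (hH : Measurable H) (hCH : IndepFun (fun ω ↦ (C ω, C' ω)) H P) (hlo : Measurable lo)
    (hhi : Measurable hi) (hlo' : Measurable lo') (hhi' : Measurable hi') :
    P {ω | (lo (H ω) < C ω ∧ C ω ≤ hi (H ω)) ∧ lo' (H ω) < C' ω ∧ C' ω ≤ hi' (H ω)}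
      ≤ ∫⁻ ω, ENNReal.ofReal (hi (H ω) - lo (H ω)) * ENNReal.ofReal (hi' (H ω) - lo' (H ω)) ∂P := by
  have hS : MeasurableSet {p : (ℝ × ℝ) × Y | (lo p.2 < p.1.1 ∧ p.1.1 ≤ hi p.2) ∧
      lo' p.2 < p.1.2 ∧ p.1.2 ≤ hi' p.2} :=
    ((measurableSet_lt (hlo.comp measurable_snd) measurable_fst.fst).inter
      (measurableSet_le measurable_fst.fst (hhi.comp measurable_snd))).inter
      ((measurableSet_lt (hlo'.comp measurable_snd) measurable_fst.snd).inter
      (measurableSet_le measurable_fst.snd (hhi'.comp measurable_snd)))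
  have hlaw := (indepFun_iff_map_prod_eq_prod_map_map (hCm.prodMk hCm').aemeasurable
    hH.aemeasurable).1 hCH
  rw [(indepFun_iff_map_prod_eq_prod_map_map hCm.aemeasurable hCm'.aemeasurable).1 hCC',
    hC.map_eq, hC'.map_eq] at hlaw
  have hpr := Measure.isProbabilityMeasure_map (μ := P) hH.aemeasurable
  calc P {ω | (lo (H ω) < C ω ∧ C ω ≤ hi (H ω)) ∧ lo' (H ω) < C' ω ∧ C' ω ≤ hi' (H ω)}
      = P.map (fun ω ↦ ((C ω, C' ω), H ω)) {p : (ℝ × ℝ) × Y | (lo p.2 < p.1.1 ∧ p.1.1 ≤ hi p.2) ∧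
          lo' p.2 < p.1.2 ∧ p.1.2 ≤ hi' p.2} := by
        rw [Measure.map_apply ((hCm.prodMk hCm').prodMk hH) hS]; rfl
    _ = ∫⁻ y, ((expMeasure 1).prod (expMeasure 1)) (Ioc (lo y) (hi y) ×ˢ Ioc (lo' y) (hi' y))
          ∂(P.map H) := by
        rw [hlaw, Measure.prod_apply_symm hS]; rfl
    _ ≤ ∫⁻ y, ENNReal.ofReal (hi y - lo y) * ENNReal.ofReal (hi' y - lo' y) ∂(P.map H) := by
        refine lintegral_mono fun y ↦ ?_
        rw [Measure.prod_prod]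
        exact mul_le_mul' (expMeasure_Ioc_le _ _) (expMeasure_Ioc_le _ _)
    _ = _ := lintegral_map ((hhi.sub hlo).ennreal_ofReal.mul (hhi'.sub hlo').ennreal_ofReal) hH

end ExponentialClock

/-- For independent `U` and `V`, a bound on the expectation over `V` that is uniform in the value of
`U` can be used first. -/
lemma lintegral_mul_comp_le_of_indepFun {Ω Y Y' : Type*} [MeasurableSpace Ω] [MeasurableSpace Y]
    [MeasurableSpace Y'] {P : Measure Ω} [IsProbabilityMeasure P] {U : Ω → Y} {V : Ω → Y'}
    (h : IndepFun U V P) (hU : Measurable U) (hV : Measurable V) {F : Y → ℝ≥0∞} (hF : Measurable F)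
    {k : Y → Y' → ℝ≥0∞} (hk : Measurable fun p : Y × Y' ↦ k p.1 p.2) {b : ℝ≥0∞}
    (hb : ∀ u, ∫⁻ v, k u v ∂(P.map V) ≤ b) :
    ∫⁻ ω, F (U ω) * k (U ω) (V ω) ∂P ≤ (∫⁻ ω, F (U ω) ∂P) * b := by
  have hlaw := (indepFun_iff_map_prod_eq_prod_map_map hU.aemeasurable hV.aemeasurable).1 h
  have hpr := Measure.isProbabilityMeasure_map (μ := P) hU.aemeasurable
  have hpr' := Measure.isProbabilityMeasure_map (μ := P) hV.aemeasurable
  have hG : Measurable fun p : Y × Y' ↦ F p.1 * k p.1 p.2 := (hF.comp measurable_fst).mul hk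
  calc ∫⁻ ω, F (U ω) * k (U ω) (V ω) ∂P
      = ∫⁻ p, F p.1 * k p.1 p.2 ∂(P.map fun ω ↦ (U ω, V ω)) := by
        rw [lintegral_map hG (hU.prodMk hV)]
    _ = ∫⁻ u, ∫⁻ v, F u * k u v ∂(P.map V) ∂(P.map U) := by
        rw [hlaw, lintegral_prod _ hG.aemeasurable]
    _ ≤ ∫⁻ u, F u * b ∂(P.map U) := by
        refine lintegral_mono fun u ↦ ?_
        have hku : Measurable (k u) := hk.comp measurable_prodMk_left
        simp only
        rw [lintegral_const_mul _ hku]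
        gcongr
        exact hb u
    _ = _ := by rw [lintegral_mul_const _ hF, lintegral_map hF hU]

section PairEvents

variable {d : ℕ} {Ω : Type*} [MeasurableSpace Ω] {P : Measure Ω} [IsProbabilityMeasure P]
  {f₀ : Phase d → ℝ} {θ : EuclideanSpace ℝ (Fin d) → ℝ} {a : ℝ} {N : ℕ}
  {Z : ℕ → Ω → Phase d} {B : ℕ → ℝ≥0 → Ω → EuclideanSpace ℝ (Fin d)} {e : ℕ → ℕ → ℕ → Ω → ℝ}

/-- The increment over `(s,t]` of the cumulative rate of a pair of marks. -/
noncomputable def rateIncrement (θ : EuclideanSpace ℝ (Fin d) → ℝ) (a : ℝ) (N : ℕ) (s t : ℝ≥0)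
    (m m' : Mark d) : ℝ≥0∞ :=
  ENNReal.ofReal (markRate θ a N t m m' - markRate θ a N s m m')

lemma IsInteractionKernel.measurable_rateIncrement (hθ : IsInteractionKernel θ) (a : ℝ) (N : ℕ)
    (s t : ℝ≥0) : Measurable fun p : Mark d × Mark d ↦ rateIncrement θ a N s t p.1 p.2 :=
  ((hθ.measurable_markRate a N t).sub (hθ.measurable_markRate a N s)).ennreal_ofReal

/-- The event that the cumulative rate of the ordered pair `p` passes its clock during `(s,t]`. -/
def ringEvent (θ : EuclideanSpace ℝ (Fin d) → ℝ) (a : ℝ) (Z : ℕ → Ω → Phase d)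
    (B : ℕ → ℝ≥0 → Ω → EuclideanSpace ℝ (Fin d)) (e : ℕ → ℕ → ℕ → Ω → ℝ) (N : ℕ) (s t : ℝ≥0)
    (p : ℕ × ℕ) : Set Ω :=
  {ω | markRate θ a N s (mark Z B p.1 ω) (mark Z B p.2 ω) < e N p.1 p.2 ω ∧
    e N p.1 p.2 ω ≤ markRate θ a N t (mark Z B p.1 ω) (mark Z B p.2 ω)}

variable (hP : IsDrivingNoise P f₀ Z B e) (hθ : IsInteractionKernel θ)
include hP hθ

omit [IsProbabilityMeasure P] in
lemma measurable_markRate_mark (t : ℝ≥0) (p : ℕ × ℕ) :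
    Measurable fun ω ↦ markRate θ a N t (mark Z B p.1 ω) (mark Z B p.2 ω) :=
  Measurable.comp (g := fun q : Mark d × Mark d ↦ markRate θ a N t q.1 q.2)
    (f := fun ω ↦ (mark Z B p.1 ω, mark Z B p.2 ω)) (hθ.measurable_markRate a N t)
    ((hP.measurable_mark _).prodMk (hP.measurable_mark _))

omit [IsProbabilityMeasure P] in
lemma measurableSet_ringEvent (s t : ℝ≥0) (p : ℕ × ℕ) :
    MeasurableSet (ringEvent θ a Z B e N s t p) :=
  (measurableSet_lt (measurable_markRate_mark hP hθ s p) (hP.measurable_clock _ _ _)).inter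
    (measurableSet_le (hP.measurable_clock _ _ _) (measurable_markRate_mark hP hθ t p))

omit hP [IsProbabilityMeasure P] in
lemma measurable_markRate_pi (t : ℝ≥0) (p : ℕ × ℕ) :
    Measurable fun w : ℕ → Mark d ↦ markRate θ a N t (w p.1) (w p.2) :=
  Measurable.comp (g := fun q : Mark d × Mark d ↦ markRate θ a N t q.1 q.2)
    (f := fun w : ℕ → Mark d ↦ (w p.1, w p.2)) (hθ.measurable_markRate a N t)
    ((measurable_pi_apply _).prodMk (measurable_pi_apply _))

lemma measure_ringEvent_le (s t : ℝ≥0) (p : ℕ × ℕ) :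
    P (ringEvent θ a Z B e N s t p)
      ≤ ∫⁻ ω, rateIncrement θ a N s t (mark Z B p.1 ω) (mark Z B p.2 ω) ∂P :=
  measure_clock_le (H := fun ω i ↦ mark Z B i ω)
    (lo := fun w ↦ markRate θ a N s (w p.1) (w p.2))
    (hi := fun w ↦ markRate θ a N t (w p.1) (w p.2)) (hP.law_clock N p.1 p.2)
    (hP.measurable_clock _ _ _)
    (measurable_pi_lambda _ hP.measurable_mark)
    ((hP.indepFun_clock_mark N).comp ((measurable_pi_apply p.2).comp (measurable_pi_apply p.1))
      measurable_id) (measurable_markRate_pi hθ s p) (measurable_markRate_pi hθ t p)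

lemma measure_ringEvent_inter_le (s t : ℝ≥0) {p q : ℕ × ℕ} (hpq : p ≠ q) :
    P (ringEvent θ a Z B e N s t p ∩ ringEvent θ a Z B e N s t q)
      ≤ ∫⁻ ω, rateIncrement θ a N s t (mark Z B p.1 ω) (mark Z B p.2 ω) *
        rateIncrement θ a N s t (mark Z B q.1 ω) (mark Z B q.2 ω) ∂P :=
  measure_two_clocks_le (H := fun ω i ↦ mark Z B i ω)
    (lo := fun w ↦ markRate θ a N s (w p.1) (w p.2))
    (hi := fun w ↦ markRate θ a N t (w p.1) (w p.2))
    (lo' := fun w ↦ markRate θ a N s (w q.1) (w q.2))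
    (hi' := fun w ↦ markRate θ a N t (w q.1) (w q.2)) (hP.law_clock N p.1 p.2)
    (hP.measurable_clock _ _ _) (hP.law_clock N q.1 q.2) (hP.measurable_clock _ _ _)
    ((hP.indep_clock N).indepFun hpq) (measurable_pi_lambda _ hP.measurable_mark)
    ((hP.indepFun_clock_mark N).comp
      (φ := fun x : ℕ → ℕ → ℝ ↦ (x p.1 p.2, x q.1 q.2))
      (((measurable_pi_apply p.2).comp (measurable_pi_apply p.1)).prodMk
        ((measurable_pi_apply q.2).comp (measurable_pi_apply q.1))) measurable_id)
    (measurable_markRate_pi hθ s p) (measurable_markRate_pi hθ t p)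
    (measurable_markRate_pi hθ s q) (measurable_markRate_pi hθ t q)

/-- Expectations over the mark of a particle that does not enter the other factor can be taken
first. -/
lemma lintegral_mul_rateIncrement_le {K : ℝ≥0∞}
    (hK : ∀ t, (P.map (mark Z B 0)).map (fun m ↦ (markTrajectory t m).1) ≤ K • volume)
    (ha : 0 < a) {s t : ℝ≥0} (hst : s ≤ t) {S : Finset ℕ} {k l : ℕ} (hk : k ∈ S) (hl : l ∉ S)
    {F : (S → Mark d) → ℝ≥0∞} (hF : Measurable F) :
    ∫⁻ ω, F (fun i ↦ mark Z B i ω) * rateIncrement θ a N s t (mark Z B k ω) (mark Z B l ω) ∂P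
      ≤ (∫⁻ ω, F (fun i ↦ mark Z B i ω) ∂P) *
        (ENNReal.ofReal ((N : ℝ)⁻¹) * K * ENNReal.ofReal (t - s)) := by
  have hUm : Measurable fun ω (i : S) ↦ mark Z B i ω :=
    measurable_pi_lambda _ fun i ↦ hP.measurable_mark _
  have hind : IndepFun (fun ω (i : S) ↦ mark Z B i ω) (mark Z B l) P := by
    have h := hP.iIndepFun_mark.indepFun_finset S {l} (by simpa using hl) hP.measurable_mark
    exact IndepFun.comp (φ := id) (ψ := fun x : ({l} : Finset ℕ) → Mark d ↦
      x ⟨l, Finset.mem_singleton_self l⟩) h measurable_id (measurable_pi_apply _)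
  have hinc : Measurable fun p : (S → Mark d) × Mark d ↦
      rateIncrement θ a N s t (p.1 ⟨k, hk⟩) p.2 :=
    Measurable.comp (g := fun q : Mark d × Mark d ↦ rateIncrement θ a N s t q.1 q.2)
      (f := fun p : (S → Mark d) × Mark d ↦ (p.1 ⟨k, hk⟩, p.2))
      (hθ.measurable_rateIncrement a N s t)
      (((measurable_pi_apply _).comp measurable_fst).prodMk measurable_snd)
  refine lintegral_mul_comp_le_of_indepFun
    (k := fun u m ↦ rateIncrement θ a N s t (u ⟨k, hk⟩) m) hind hUm (hP.measurable_mark l) hF hinc fun u ↦ ?_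
  have hpr := Measure.isProbabilityMeasure_map (μ := P) (hP.measurable_mark l).aemeasurable
  refine hθ.lintegral_markRate_le ha ?_ hst _
  rw [hP.map_mark l]
  exact hK

variable {K : ℝ≥0∞}
  (hK : ∀ t, (P.map (mark Z B 0)).map (fun m ↦ (markTrajectory t m).1) ≤ K • volume)
include hK

lemma lintegral_rateIncrement_le (ha : 0 < a) {s t : ℝ≥0} (hst : s ≤ t) {i j : ℕ} (hij : i ≠ j) :
    ∫⁻ ω, rateIncrement θ a N s t (mark Z B i ω) (mark Z B j ω) ∂P
      ≤ ENNReal.ofReal ((N : ℝ)⁻¹) * K * ENNReal.ofReal (t - s) := by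
  simpa using lintegral_mul_rateIncrement_le (N := N) hP hθ hK ha hst (S := {i}) (k := i) (l := j)
    (by simp) (by simpa using hij.symm) (F := fun _ ↦ 1) measurable_const

lemma lintegral_rateIncrement_mul_le (ha : 0 < a) {s t : ℝ≥0} (hst : s ≤ t) {i j k l : ℕ}
    (hij : i ≠ j) (hli : l ≠ i) (hlj : l ≠ j) (hlk : l ≠ k) :
    ∫⁻ ω, rateIncrement θ a N s t (mark Z B i ω) (mark Z B j ω) *
        rateIncrement θ a N s t (mark Z B k ω) (mark Z B l ω) ∂P
      ≤ (ENNReal.ofReal ((N : ℝ)⁻¹) * K * ENNReal.ofReal (t - s)) ^ 2 := by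
  have hF : Measurable fun u : ({i, j, k} : Finset ℕ) → Mark d ↦
      rateIncrement θ a N s t (u ⟨i, by simp⟩) (u ⟨j, by simp⟩) :=
    Measurable.comp (g := fun q : Mark d × Mark d ↦ rateIncrement θ a N s t q.1 q.2)
      (f := fun u : ({i, j, k} : Finset ℕ) → Mark d ↦ (u ⟨i, by simp⟩, u ⟨j, by simp⟩))
      (hθ.measurable_rateIncrement a N s t) ((measurable_pi_apply _).prodMk (measurable_pi_apply _))
  refine (lintegral_mul_rateIncrement_le (N := N) hP hθ hK ha hst (S := {i, j, k}) (k := k)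
    (l := l) (by simp) (by simp [hli, hlj, hlk]) hF).trans ?_
  rw [sq]
  gcongr
  exact lintegral_rateIncrement_le hP hθ hK ha hst hij

/-- Two ordered pairs ring in the same interval with a probability of product form, unless they
consist of the same two particles. -/
lemma measure_ringEvent_inter_le_sq_add (ha : 0 < a) {s t : ℝ≥0} (hst : s ≤ t) {p q : ℕ × ℕ}
    (hp : p.1 ≠ p.2) (hq : q.1 ≠ q.2) {b : ℝ≥0∞}
    (hb : b = ENNReal.ofReal ((N : ℝ)⁻¹) * K * ENNReal.ofReal (t - s)) :
    P (ringEvent θ a Z B e N s t p ∩ ringEvent θ a Z B e N s t q)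
      ≤ b ^ 2 + ((if q = p then b else 0) + if q = p.swap then b else 0) := by
  obtain ⟨i, j⟩ := p
  obtain ⟨k, l⟩ := q
  simp only at hp hq
  have hsingle : P (ringEvent θ a Z B e N s t (i, j) ∩ ringEvent θ a Z B e N s t (k, l)) ≤ b := by
    rw [hb]
    exact (measure_mono inter_subset_left).trans ((measure_ringEvent_le hP hθ s t _).trans
      (lintegral_rateIncrement_le hP hθ hK ha hst hp))
  by_cases h1 : (k, l) = (i, j)
  · rw [if_pos h1]
    exact hsingle.trans (le_self_add.trans le_add_self)
  by_cases h2 : (k, l) = (j, i)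
  · rw [if_pos (show (k, l) = (i, j).swap from h2)]
    exact hsingle.trans (le_add_self.trans le_add_self)
  refine le_trans ?_ le_self_add
  refine (measure_ringEvent_inter_le hP hθ s t (Ne.symm h1)).trans ?_
  rw [hb]
  by_cases hl : l = i ∨ l = j
  · have hk : k ≠ i ∧ k ≠ j := by
      simp only [Prod.mk.injEq, not_and] at h1 h2
      rcases hl with rfl | rfl
      · exact ⟨hq, fun h ↦ h2 h rfl⟩
      · exact ⟨fun h ↦ h1 h rfl, hq⟩
    -- the shared particle is `l`, so the roles of `k` and `l` have to be exchanged
    have hsymm : ∀ m m' : Mark d, rateIncrement θ a N s t m m' = rateIncrement θ a N s t m' m :=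
      fun m m' ↦ by simp only [rateIncrement, hθ.markRate_comm _ m m']
    simp_rw [hsymm (mark Z B k _)]
    exact lintegral_rateIncrement_mul_le hP hθ hK ha hst hp hk.1 hk.2 hq
  · push Not at hl
    exact lintegral_rateIncrement_mul_le hP hθ hK ha hst hp hl.1 hl.2 hq.symm

open Classical in
/-- Chebyshev's bound for the number of pairs that ring during `(s,t]`. -/
lemma measure_card_ringEvent_le (ha : 0 < a) (hN : 0 < N) {s t : ℝ≥0} (hst : s ≤ t) {c : ℝ≥0∞}
    (hc : c ≠ 0) (hc' : c ≠ ∞) :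
    P {ω | c * N ≤ (((Finset.univ : Finset (Fin N)).offDiag.filter fun p ↦
        ω ∈ ringEvent θ a Z B e N s t (p.1, p.2)).card : ℝ≥0∞)}
      ≤ ((K * ENNReal.ofReal (t - s)) ^ 2 + 2 * (K * ENNReal.ofReal (t - s)) * (N : ℝ≥0∞)⁻¹)
        / c ^ 2 := by
  set b : ℝ≥0∞ := ENNReal.ofReal ((N : ℝ)⁻¹) * K * ENNReal.ofReal (t - s) with hb
  set D := (Finset.univ : Finset (Fin N)).offDiag with hD
  set A : Fin N × Fin N → Set Ω := fun p ↦ ringEvent θ a Z B e N s t (p.1, p.2) with hA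
  have hAm : ∀ p, MeasurableSet (A p) := fun p ↦ measurableSet_ringEvent hP hθ s t _
  have hNne : (N : ℝ≥0∞) ≠ 0 := by exact_mod_cast hN.ne'
  set C : Ω → ℝ≥0∞ := fun ω ↦ ∑ p ∈ D, (A p).indicator 1 ω with hC
  have hCcard : ∀ ω, ((D.filter fun p ↦ ω ∈ ringEvent θ a Z B e N s t (p.1, p.2)).card : ℝ≥0∞)
      = C ω := by
    intro ω
    rw [Finset.card_filter]
    push_cast
    exact Finset.sum_congr rfl fun p _ ↦ by simp [hA, indicator_apply]
  have hCm : Measurable C := Finset.measurable_sum _ fun p _ ↦ measurable_one.indicator (hAm p)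
  -- the second moment is a sum over pairs of pairs
  have hsq : ∫⁻ ω, C ω ^ 2 ∂P = ∑ p ∈ D, ∑ q ∈ D, P (A p ∩ A q) := by
    have : ∀ ω, C ω ^ 2 = ∑ p ∈ D, ∑ q ∈ D, (A p ∩ A q).indicator 1 ω := by
      intro ω
      rw [hC, sq, Finset.sum_mul_sum]
      refine Finset.sum_congr rfl fun p _ ↦ Finset.sum_congr rfl fun q _ ↦ ?_
      rw [inter_indicator_one]
      rfl
    simp_rw [this]
    rw [lintegral_finsetSum _ fun p _ ↦ Finset.measurable_sum _ fun q _ ↦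
      measurable_one.indicator ((hAm p).inter (hAm q))]
    refine Finset.sum_congr rfl fun p _ ↦ ?_
    rw [lintegral_finsetSum _ fun q _ ↦ measurable_one.indicator ((hAm p).inter (hAm q))]
    exact Finset.sum_congr rfl fun q _ ↦ lintegral_indicator_one ((hAm p).inter (hAm q))
  have hDcard : (D.card : ℝ≥0∞) ≤ N ^ 2 := by
    have : D.card ≤ N * N := by
      rw [hD, Finset.offDiag_card]; simp
    rw [sq]
    exact_mod_cast this
  have hbound : ∫⁻ ω, C ω ^ 2 ∂P ≤ N ^ 4 * b ^ 2 + 2 * N ^ 2 * b := by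
    rw [hsq]
    calc ∑ p ∈ D, ∑ q ∈ D, P (A p ∩ A q)
        ≤ ∑ p ∈ D, ∑ q ∈ D, (b ^ 2 + ((if q = p then b else 0) + if q = p.swap then b else 0)) := by
          refine Finset.sum_le_sum fun p hp ↦ Finset.sum_le_sum fun q hq ↦ ?_
          have hp' : (p.1 : ℕ) ≠ p.2 := fun h ↦ (Finset.mem_offDiag.1 hp).2.2 (Fin.ext h)
          have hq' : (q.1 : ℕ) ≠ q.2 := fun h ↦ (Finset.mem_offDiag.1 hq).2.2 (Fin.ext h)
          refine (measure_ringEvent_inter_le_sq_add (N := N) (p := (p.1, p.2)) (q := (q.1, q.2))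
            hP hθ hK ha hst hp' hq' hb).trans_eq ?_
          congr 2
          · congr 1
            simp [Prod.ext_iff, Fin.ext_iff]
          · congr 1
            simp [Prod.ext_iff, Fin.ext_iff]
      _ ≤ ∑ p ∈ D, (D.card * b ^ 2 + (b + b)) := by
          refine Finset.sum_le_sum fun p hp ↦ ?_
          rw [Finset.sum_add_distrib, Finset.sum_const, nsmul_eq_mul, Finset.sum_add_distrib]
          gcongr
          · rw [Finset.sum_ite_eq']; split_ifs <;> simp
          · rw [Finset.sum_ite_eq']; split_ifs <;> simp
      _ = D.card * (D.card * b ^ 2 + (b + b)) := by rw [Finset.sum_const, nsmul_eq_mul]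
      _ ≤ N ^ 2 * (N ^ 2 * b ^ 2 + (b + b)) := by gcongr
      _ = _ := by ring
  have hNb : (N : ℝ≥0∞) * b = K * ENNReal.ofReal (t - s) := by
    rw [hb, ← mul_assoc, ← mul_assoc, ENNReal.ofReal_inv_of_pos (by exact_mod_cast hN),
      ENNReal.ofReal_natCast, ENNReal.mul_inv_cancel hNne (ENNReal.natCast_ne_top N), one_mul]
  simp_rw [hCcard]
  calc P {ω | c * N ≤ C ω} ≤ P {ω | (c * N) ^ 2 ≤ C ω ^ 2} :=
        measure_mono fun ω (hω : c * N ≤ C ω) ↦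
          show (c * N) ^ 2 ≤ C ω ^ 2 from pow_le_pow_left' hω 2
    _ ≤ (∫⁻ ω, C ω ^ 2 ∂P) / (c * N) ^ 2 :=
        meas_ge_le_lintegral_div (hCm.pow_const 2).aemeasurable
          (pow_ne_zero 2 (mul_ne_zero hc hNne))
          (ENNReal.pow_ne_top (ENNReal.mul_ne_top hc' (ENNReal.natCast_ne_top N)))
    _ ≤ (N ^ 4 * b ^ 2 + 2 * N ^ 2 * b) / (c * N) ^ 2 := by gcongr
    _ = ((N * b) ^ 2 + 2 * (N * b) * (N : ℝ≥0∞)⁻¹) / c ^ 2 := by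
        have h1 : (N : ℝ≥0∞) ^ 4 * b ^ 2 + 2 * N ^ 2 * b
            = N ^ 2 * ((N * b) ^ 2 + 2 * (N * b) * (N : ℝ≥0∞)⁻¹) := by
          have : (N : ℝ≥0∞) * (N : ℝ≥0∞)⁻¹ = 1 :=
            ENNReal.mul_inv_cancel hNne (ENNReal.natCast_ne_top N)
          calc (N : ℝ≥0∞) ^ 4 * b ^ 2 + 2 * N ^ 2 * b
              = N ^ 4 * b ^ 2 + 2 * N ^ 2 * b * (N * (N : ℝ≥0∞)⁻¹) := by rw [this, mul_one]
            _ = _ := by ring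
        rw [h1, mul_pow c, mul_comm (c ^ 2), ENNReal.mul_div_mul_left _ _
          (pow_ne_zero 2 hNne) (ENNReal.pow_ne_top (ENNReal.natCast_ne_top N))]
    _ = _ := by rw [hNb]

end PairEvents

/-! ### Few particles are removed in a short time -/

section Removals

variable {d : ℕ} {Ω : Type*} {f₀ : Phase d → ℝ} {θ : EuclideanSpace ℝ (Fin d) → ℝ} {a : ℝ} {N : ℕ}
  {Z : ℕ → Ω → Phase d} {B : ℕ → ℝ≥0 → Ω → EuclideanSpace ℝ (Fin d)} {e : ℕ → ℕ → ℕ → Ω → ℝ}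

/-- The time at which particle `i` of the `N`-particle system driven by the regularised noise is
removed. -/
noncomputable def removalTime (θ : EuclideanSpace ℝ (Fin d) → ℝ) (a : ℝ) (Z : ℕ → Ω → Phase d)
    (B : ℕ → ℝ≥0 → Ω → EuclideanSpace ℝ (Fin d)) (e : ℕ → ℕ → ℕ → Ω → ℝ) (N : ℕ) (i : Fin N)
    (ω : Ω) : ℝ≥0∞ :=
  lifetime (fun i j : Fin N ↦ ringTime θ a Z (regularNoise B) e N i j ω) i

lemma ringTime_regularNoise (i j : ℕ) (ω : Ω) : ringTime θ a Z (regularNoise B) e N i j ω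
    = ⨅ (t : ℝ≥0) (_ : e N i j ω ≤ markRate θ a N t (mark Z B i ω) (mark Z B j ω)), (t : ℝ≥0∞) :=
  rfl

/-- Cumulative rates increase, so a pair whose ring time lies in `(s,t)` passes its clock in `(s,t]`. -/
lemma IsInteractionKernel.mem_ringEvent (hθ : IsInteractionKernel θ) (ha : 0 ≤ a) {i j : ℕ} {ω : Ω}
    {s t : ℝ≥0} (hs : s < ringTime θ a Z (regularNoise B) e N i j ω)
    (ht : ringTime θ a Z (regularNoise B) e N i j ω < t) : ω ∈ ringEvent θ a Z B e N s t (i, j) := by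
  rw [ringTime_regularNoise] at hs ht
  constructor
  · by_contra! h
    exact hs.not_ge (iInf₂_le s h)
  · simp only [iInf_lt_iff] at ht
    obtain ⟨u, hu, hut⟩ := ht
    exact hu.trans (hθ.markRate_mono ha _ _ (ENNReal.coe_lt_coe.1 hut).le)

variable [MeasurableSpace Ω] {P : Measure Ω}

lemma IsDrivingNoise.measurable_ringTime (hP : IsDrivingNoise P f₀ Z B e)
    (hθ : IsInteractionKernel θ) (ha : 0 ≤ a) (i j : ℕ) :
    Measurable (ringTime θ a Z (regularNoise B) e N i j) := by
  refine measurable_of_Iio fun c ↦ ?_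
  obtain ⟨D, hDc, hD⟩ := TopologicalSpace.exists_countable_dense ℝ≥0
  have : ringTime θ a Z (regularNoise B) e N i j ⁻¹' Iio c = ⋃ q ∈ {q ∈ D | (q : ℝ≥0∞) < c},
      {ω | e N i j ω ≤ markRate θ a N q (mark Z B i ω) (mark Z B j ω)} := by
    ext ω
    simp only [mem_preimage, ringTime_regularNoise, mem_Iio, iInf_lt_iff, mem_iUnion, exists_prop,
      mem_ofPred_eq]
    constructor
    · rintro ⟨t, ht, htc⟩
      obtain ⟨r, htr, hrc⟩ := ENNReal.lt_iff_exists_nnreal_btwn.1 htc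
      obtain ⟨q, hqD, hq⟩ := hD.exists_between (ENNReal.coe_lt_coe.1 htr)
      exact ⟨q, ⟨hqD, (ENNReal.coe_lt_coe.2 hq.2).trans hrc⟩,
        ht.trans (hθ.markRate_mono ha _ _ hq.1.le)⟩
    · rintro ⟨q, ⟨-, hq⟩, h⟩
      exact ⟨q, h, hq⟩
  rw [this]
  exact MeasurableSet.biUnion (hDc.mono (sep_subset _ _)) fun q _ ↦
    measurableSet_le (hP.measurable_clock _ _ _) (measurable_markRate_mark hP hθ q (i, j))

lemma IsDrivingNoise.measurable_removalTime (hP : IsDrivingNoise P f₀ Z B e)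
    (hθ : IsInteractionKernel θ) (ha : 0 ≤ a) (i : Fin N) :
    Measurable (removalTime θ a Z B e N i) :=
  (measurable_lifetime i).comp (measurable_pi_lambda _ fun j ↦ measurable_pi_lambda _ fun k ↦
    hP.measurable_ringTime hθ ha j k)

open Classical in
/-- With high probability, no short time interval sees the removal of a positive proportion of the
particles, uniformly in their number. -/
lemma IsDrivingNoise.exists_measure_removals_le [IsProbabilityMeasure P]
    (hP : IsDrivingNoise P f₀ Z B e)
    (hθ : IsInteractionKernel θ) {ε : ℕ → ℝ} (hε : ∀ N, 1 ≤ N → 0 < ε N) {K : ℝ≥0∞} (hK' : K ≠ ∞)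
    (hK : ∀ t, (P.map (mark Z B 0)).map (fun m ↦ (markTrajectory t m).1) ≤ K • volume) (T : ℝ≥0)
    {η : ℝ≥0} (hη : 0 < η) :
    ∃ δ : ℝ≥0, 0 < δ ∧ ∃ N₀ : ℕ, ∀ N, N₀ ≤ N → P {ω | ∃ u ≤ T, (η : ℝ≥0∞) * N <
      ((Finset.univ.filter fun i ↦ (u : ℝ≥0∞) < removalTime θ (ε N) Z B e N i ω ∧
        removalTime θ (ε N) Z B e N i ω < u + δ).card : ℝ≥0∞)} ≤ η := by
  obtain ⟨M, hM⟩ := exists_nat_ge T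
  -- each removal is caused by a ring, and a ring removes at most two particles
  have hη' : (η : ℝ≥0∞) ≠ 0 := by exact_mod_cast hη.ne'
  set c : ℝ≥0∞ := η / 2 with hc
  have hc0 : c ≠ 0 := by simp [hc, hη']
  have hct : c ≠ ∞ := (ENNReal.div_lt_top ENNReal.coe_ne_top (by simp)).ne
  set C : ℝ≥0∞ := (M + 1) * (4 * K ^ 2 + 4 * K) / c ^ 2 with hC
  have hCt : C ≠ ∞ := by
    refine (ENNReal.div_lt_top ?_ (pow_ne_zero 2 hc0)).ne
    finiteness
  obtain ⟨L, hL⟩ := ENNReal.exists_nat_gt (r := C / c) (ENNReal.div_lt_top hCt hc0).ne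
  have hL0 : 0 < L := by
    rcases Nat.eq_zero_or_pos L with rfl | h
    · simp at hL
    · exact h
  have hCL : C ≤ c * L := by
    rw [mul_comm]
    exact (ENNReal.div_le_iff hc0 hct).1 hL.le
  have hLr : (0 : ℝ≥0) < L := by exact_mod_cast hL0
  have hLe : (L : ℝ≥0∞) ≠ 0 := by exact_mod_cast hL0.ne'
  refine ⟨(L : ℝ≥0)⁻¹, inv_pos.2 hLr, L, fun N hN ↦ ?_⟩
  have hN1 : 1 ≤ N := hL0.trans_le hN
  -- a window of length `1 / L` lies in one of the windows of length `2 / L` of a grid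
  set E : ℕ → Set Ω := fun k ↦ {ω | c * N ≤ (((Finset.univ : Finset (Fin N)).offDiag.filter fun p ↦
        ω ∈ ringEvent θ (ε N) Z B e N (k * (L : ℝ≥0)⁻¹) ((k + 2) * (L : ℝ≥0)⁻¹)
          (p.1, p.2)).card : ℝ≥0∞)} with hE
  have hcover : {ω | ∃ u ≤ T, (η : ℝ≥0∞) * N <
      ((Finset.univ.filter fun i ↦ (u : ℝ≥0∞) < removalTime θ (ε N) Z B e N i ω ∧
        removalTime θ (ε N) Z B e N i ω < u + ((L : ℝ≥0)⁻¹ : ℝ≥0)).card : ℝ≥0∞)}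
      ⊆ ⋃ k ∈ Finset.range (M * L + 1), E k := by
    rintro ω ⟨u, huT, hu⟩
    set k := ⌊u * L⌋₊ with hk
    have hk1 : (k : ℝ≥0) ≤ u * L := Nat.floor_le zero_le
    have hk2 : u * L < k + 1 := Nat.lt_floor_add_one _
    have hk1' : (k : ℝ≥0) * (L : ℝ≥0)⁻¹ ≤ u := by
      rw [← div_eq_mul_inv, div_le_iff₀ hLr]; exact hk1
    have hk2' : u + (L : ℝ≥0)⁻¹ ≤ (k + 2) * (L : ℝ≥0)⁻¹ := by
      have : u ≤ (k + 1) * (L : ℝ≥0)⁻¹ := by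
        rw [← div_eq_mul_inv, le_div_iff₀ hLr]; exact hk2.le
      calc u + (L : ℝ≥0)⁻¹ ≤ (k + 1) * (L : ℝ≥0)⁻¹ + (L : ℝ≥0)⁻¹ := by gcongr
        _ = _ := by ring
    simp only [mem_iUnion, Finset.mem_range, exists_prop]
    refine ⟨k, ?_, ?_⟩
    · rw [Nat.lt_succ_iff, hk]
      refine Nat.floor_le_of_le ?_
      push_cast
      gcongr
      exact huT.trans hM
    · have h1 := card_lifetime_mem_le (τ := fun i j : Fin N ↦
        ringTime θ (ε N) Z (regularNoise B) e N i j ω) (s := u) (t := u + ((L : ℝ≥0)⁻¹ : ℝ≥0))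
      have h2 : ((Finset.univ : Finset (Fin N)).offDiag.filter fun p ↦
          (u : ℝ≥0∞) < ringTime θ (ε N) Z (regularNoise B) e N p.1 p.2 ω ∧
          ringTime θ (ε N) Z (regularNoise B) e N p.1 p.2 ω < u + ((L : ℝ≥0)⁻¹ : ℝ≥0)).card
          ≤ ((Finset.univ : Finset (Fin N)).offDiag.filter fun p ↦
        ω ∈ ringEvent θ (ε N) Z B e N (k * (L : ℝ≥0)⁻¹) ((k + 2) * (L : ℝ≥0)⁻¹)
          (p.1, p.2)).card := by
        refine Finset.card_le_card (Finset.monotone_filter_right _ fun p _ hp ↦ ?_)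
        refine hθ.mem_ringEvent (hε N hN1).le
          ((ENNReal.coe_le_coe.2 hk1').trans_lt hp.1) (hp.2.trans_le ?_)
        exact_mod_cast hk2'
      have h3 : (η : ℝ≥0∞) * N < 2 * ((Finset.univ : Finset (Fin N)).offDiag.filter fun p ↦
        ω ∈ ringEvent θ (ε N) Z B e N (k * (L : ℝ≥0)⁻¹) ((k + 2) * (L : ℝ≥0)⁻¹)
          (p.1, p.2)).card := by
        refine hu.trans_le ?_
        exact_mod_cast h1.trans (Nat.mul_le_mul_left 2 h2)
      change c * N ≤ _
      rw [hc, ENNReal.div_eq_inv_mul, mul_assoc, ← ENNReal.div_eq_inv_mul]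
      exact ENNReal.div_le_of_le_mul' h3.le
  have hbound : ∀ k, P (E k) ≤ (4 * K ^ 2 + 4 * K) * (L : ℝ≥0∞)⁻¹ ^ 2 / c ^ 2 := by
    intro k
    refine (measure_card_ringEvent_le (t := (k + 2) * (L : ℝ≥0)⁻¹) hP hθ hK (hε N hN1) hN1
      (by gcongr; simp) hc0 hct).trans ?_
    have h1 : ENNReal.ofReal (((k + 2) * (L : ℝ≥0)⁻¹ : ℝ≥0) - (k * (L : ℝ≥0)⁻¹ : ℝ≥0))
        = 2 * (L : ℝ≥0∞)⁻¹ := by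
      have : ((((k + 2) * (L : ℝ≥0)⁻¹ : ℝ≥0) : ℝ) - ((k * (L : ℝ≥0)⁻¹ : ℝ≥0) : ℝ))
          = 2 * (L : ℝ)⁻¹ := by push_cast; ring
      rw [this, ENNReal.ofReal_mul zero_le_two, ENNReal.ofReal_inv_of_pos (by exact_mod_cast hL0)]
      simp
    rw [h1]
    gcongr
    have h2 : (N : ℝ≥0∞)⁻¹ ≤ (L : ℝ≥0∞)⁻¹ := ENNReal.inv_le_inv.2 (by exact_mod_cast hN)
    calc (K * (2 * (L : ℝ≥0∞)⁻¹)) ^ 2 + 2 * (K * (2 * (L : ℝ≥0∞)⁻¹)) * (N : ℝ≥0∞)⁻¹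
        ≤ (K * (2 * (L : ℝ≥0∞)⁻¹)) ^ 2 + 2 * (K * (2 * (L : ℝ≥0∞)⁻¹)) * (L : ℝ≥0∞)⁻¹ := by gcongr
      _ = _ := by ring
  calc _ ≤ P (⋃ k ∈ Finset.range (M * L + 1), E k) := measure_mono hcover
    _ ≤ ∑ k ∈ Finset.range (M * L + 1), P (E k) := measure_biUnion_finset_le _ _
    _ ≤ ∑ k ∈ Finset.range (M * L + 1), (4 * K ^ 2 + 4 * K) * (L : ℝ≥0∞)⁻¹ ^ 2 / c ^ 2 :=
        Finset.sum_le_sum fun k _ ↦ hbound k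
    _ = (M * L + 1 : ℕ) * ((4 * K ^ 2 + 4 * K) * (L : ℝ≥0∞)⁻¹ ^ 2 / c ^ 2) := by simp
    _ ≤ ((M + 1) * L) * ((4 * K ^ 2 + 4 * K) * (L : ℝ≥0∞)⁻¹ ^ 2 / c ^ 2) := by
        gcongr
        have : M * L + 1 ≤ (M + 1) * L := by nlinarith
        exact_mod_cast this
    _ = C * (L : ℝ≥0∞)⁻¹ * (L * (L : ℝ≥0∞)⁻¹) := by
        simp only [hC, div_eq_mul_inv]
        ring
    _ = C * (L : ℝ≥0∞)⁻¹ := by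
        rw [ENNReal.mul_inv_cancel hLe (ENNReal.natCast_ne_top L), mul_one]
    _ ≤ c := by
        rw [← div_eq_mul_inv]
        exact ENNReal.div_le_of_le_mul hCL
    _ ≤ η := ENNReal.half_le_self

end Removals

/-! ### Continuity and boundedness in probability of continuous processes -/

section ContinuousProcess

lemma measurableSet_exists_of_isOpen {Ω A : Type*} [MeasurableSpace Ω] [TopologicalSpace A]
    [TopologicalSpace.SeparableSpace A] {S : A → Set Ω} (hS : ∀ a, MeasurableSet (S a))
    (ho : ∀ ω, IsOpen {a | ω ∈ S a}) : MeasurableSet {ω | ∃ a, ω ∈ S a} := by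
  obtain ⟨D, hDc, hD⟩ := TopologicalSpace.exists_countable_dense A
  have : {ω | ∃ a, ω ∈ S a} = ⋃ a ∈ D, S a := by
    ext ω
    simp only [mem_ofPred_eq, mem_iUnion, exists_prop]
    constructor
    · rintro ⟨a, ha⟩
      obtain ⟨b, hb, hbD⟩ := hD.inter_open_nonempty _ (ho ω) ⟨a, ha⟩
      exact ⟨b, hbD, hb⟩
    · rintro ⟨a, -, ha⟩
      exact ⟨a, ha⟩
  rw [this]
  exact MeasurableSet.biUnion hDc fun a _ ↦ hS a

variable {Ω A Y : Type*} [MeasurableSpace Ω] {P : Measure Ω} [IsFiniteMeasure P]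
  [PseudoMetricSpace A] [CompactSpace A] [PseudoMetricSpace Y] {X : A → Ω → Y}

lemma measurableSet_modulus (hX : ∀ ω, Continuous fun t ↦ X t ω)
    (hm : ∀ s t, Measurable fun ω ↦ dist (X s ω) (X t ω)) (δ r : ℝ) :
    MeasurableSet {ω | ∃ s t, dist s t < δ ∧ r < dist (X s ω) (X t ω)} := by
  have h := measurableSet_exists_of_isOpen (A := A × A)
    (S := fun p ↦ {ω | dist p.1 p.2 < δ ∧ r < dist (X p.1 ω) (X p.2 ω)})
    (fun p ↦ (MeasurableSet.const _).inter (measurableSet_lt measurable_const (hm p.1 p.2)))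
    fun ω ↦ by
      have h1 := (hX ω).comp continuous_fst (X := A × A)
      have h2 := (hX ω).comp continuous_snd (X := A × A)
      exact (isOpen_lt continuous_dist continuous_const).inter
        (isOpen_lt continuous_const (h1.dist h2))
  simpa only [Prod.exists, mem_ofPred_eq] using h

lemma exists_measure_modulus_le (hX : ∀ ω, Continuous fun t ↦ X t ω)
    (hm : ∀ s t, Measurable fun ω ↦ dist (X s ω) (X t ω)) {r : ℝ} (hr : 0 < r) {κ : ℝ≥0∞}
    (hκ : 0 < κ) :
    ∃ δ > 0, P {ω | ∃ s t, dist s t < δ ∧ r < dist (X s ω) (X t ω)} ≤ κ := by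
  set S : ℕ → Set Ω := fun n ↦ {ω | ∃ s t, dist s t < 1 / ((n : ℝ) + 1) ∧
    r < dist (X s ω) (X t ω)} with hS
  have hanti : Antitone S := by
    rintro m n hmn ω ⟨s, t, hst, h⟩
    exact ⟨s, t, hst.trans_le (Nat.one_div_le_one_div hmn), h⟩
  have hempty : ⋂ n, S n = ∅ := by
    refine eq_empty_of_forall_notMem fun ω hω ↦ ?_
    rw [mem_iInter] at hω
    obtain ⟨δ, hδ, h⟩ := Metric.uniformContinuous_iff.1
      (CompactSpace.uniformContinuous_of_continuous (hX ω)) r hr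
    obtain ⟨n, hn⟩ := exists_nat_one_div_lt hδ
    obtain ⟨s, t, hst, hrst⟩ := hω n
    exact (h (hst.trans hn)).not_gt hrst
  have hSm : ∀ n, NullMeasurableSet (S n) P := fun n ↦
    (measurableSet_modulus hX hm (1 / ((n : ℝ) + 1)) r).nullMeasurableSet
  have ht := tendsto_measure_iInter_atTop hSm hanti ⟨0, measure_ne_top _ _⟩
  rw [hempty, measure_empty] at ht
  obtain ⟨n, hn⟩ := (ht.eventually_le_const hκ).exists
  exact ⟨1 / ((n : ℝ) + 1), by positivity, hn⟩

omit [IsFiniteMeasure P] in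
lemma measurableSet_unbounded {Y : Type*} [NormedAddCommGroup Y] {X : A → Ω → Y}
    (hX : ∀ ω, Continuous fun t ↦ X t ω) (hm : ∀ t, Measurable fun ω ↦ ‖X t ω‖) (r : ℝ) :
    MeasurableSet {ω | ∃ t, r < ‖X t ω‖} :=
  measurableSet_exists_of_isOpen (S := fun t ↦ {ω | r < ‖X t ω‖})
    (fun t ↦ measurableSet_lt measurable_const (hm t))
    fun ω ↦ isOpen_lt continuous_const (hX ω).norm

lemma exists_measure_unbounded_le {Y : Type*} [NormedAddCommGroup Y] {X : A → Ω → Y}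
    (hX : ∀ ω, Continuous fun t ↦ X t ω) (hm : ∀ t, Measurable fun ω ↦ ‖X t ω‖) {κ : ℝ≥0∞}
    (hκ : 0 < κ) : ∃ M : ℝ, P {ω | ∃ t, M < ‖X t ω‖} ≤ κ := by
  set S : ℕ → Set Ω := fun n ↦ {ω | ∃ t, (n : ℝ) < ‖X t ω‖} with hS
  have hanti : Antitone S := by
    rintro m n hmn ω ⟨t, h⟩
    exact ⟨t, (Nat.cast_le.2 hmn).trans_lt h⟩
  have hempty : ⋂ n, S n = ∅ := by
    refine eq_empty_of_forall_notMem fun ω hω ↦ ?_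
    rw [mem_iInter] at hω
    obtain ⟨C, hC⟩ := (isCompact_range (hX ω).norm).bddAbove
    obtain ⟨n, hn⟩ := exists_nat_ge C
    obtain ⟨t, ht⟩ := hω n
    exact (hC ⟨t, rfl⟩).not_gt (hn.trans_lt ht)
  have hSm : ∀ n, NullMeasurableSet (S n) P := fun n ↦
    (measurableSet_unbounded hX hm n).nullMeasurableSet
  have ht := tendsto_measure_iInter_atTop hSm hanti ⟨0, measure_ne_top _ _⟩
  rw [hempty, measure_empty] at ht
  obtain ⟨n, hn⟩ := (ht.eventually_le_const hκ).exists
  exact ⟨n, hn⟩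

end ContinuousProcess

section Cadlag

variable {T : ℝ≥0} {E F : Type*} [TopologicalSpace E] [TopologicalSpace F]

lemma IsCadlag.comp_continuous {x : Icc (0 : ℝ≥0) T → E} (hx : IsCadlag x) {g : E → F}
    (hg : Continuous g) : IsCadlag fun t ↦ g (x t) := fun t ↦
  ⟨hg.continuousAt.comp_continuousWithinAt (hx t).1, by
    obtain ⟨l, hl⟩ := (hx t).2
    exact ⟨g l, (hg.tendsto l).comp hl⟩⟩

lemma isCadlag_of_continuous {x : Icc (0 : ℝ≥0) T → E} (hx : Continuous x) : IsCadlag x := fun t ↦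
  ⟨hx.continuousWithinAt, x t, hx.continuousAt.tendsto.mono_left nhdsWithin_le_nhds⟩

lemma IsCadlag.prodMk {x : Icc (0 : ℝ≥0) T → E} {y : Icc (0 : ℝ≥0) T → F} (hx : IsCadlag x)
    (hy : IsCadlag y) : IsCadlag fun t ↦ (x t, y t) := fun t ↦
  ⟨(hx t).1.prodMk (hy t).1, by
    obtain ⟨l, hl⟩ := (hx t).2
    obtain ⟨m, hm⟩ := (hy t).2
    exact ⟨(l, m), hl.prodMk_nhds hm⟩⟩

lemma isCadlag_pi {ι : Type*} {x : Icc (0 : ℝ≥0) T → ι → E} (hx : ∀ i, IsCadlag fun t ↦ x t i) :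
    IsCadlag x := fun t ↦
  ⟨continuousWithinAt_pi.2 fun i ↦ (hx i t).1, by
    choose l hl using fun i ↦ (hx i t).2
    exact ⟨l, tendsto_pi_nhds.2 hl⟩⟩

lemma toSkorokhod_of_isCadlag (c : E) {x : Icc (0 : ℝ≥0) T → E} (hx : IsCadlag x) :
    toSkorokhod c x = ⟨x, hx⟩ :=
  dif_pos hx

lemma isCadlag_ite_lt (τ : ℝ≥0∞) (a b : E) :
    IsCadlag fun t : Icc (0 : ℝ≥0) T ↦ if (t : ℝ≥0) < τ then a else b := by
  have hc : Continuous fun t : Icc (0 : ℝ≥0) T ↦ ((t : ℝ≥0) : ℝ≥0∞) :=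
    ENNReal.continuous_coe.comp continuous_subtype_val
  have hmono : ∀ {s t : Icc (0 : ℝ≥0) T}, s ≤ t → ((s : ℝ≥0) : ℝ≥0∞) ≤ (t : ℝ≥0) := fun h ↦
    ENNReal.coe_le_coe.2 h
  intro t
  constructor
  · by_cases ht : ((t : ℝ≥0) : ℝ≥0∞) < τ
    · refine ContinuousAt.continuousWithinAt ((continuousAt_const (y := a)).congr ?_)
      filter_upwards [hc.continuousAt.eventually_lt continuousAt_const ht] with s hs
      exact (if_pos hs).symm
    · refine (continuousWithinAt_const (b := b)).congr (fun s hs ↦ ?_) ?_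
      · rw [if_neg (not_lt.2 ((not_lt.1 ht).trans (hmono hs)))]
      · rw [if_neg ht]
  · by_cases ht : ((t : ℝ≥0) : ℝ≥0∞) ≤ τ
    · refine ⟨a, tendsto_const_nhds.congr' ?_⟩
      filter_upwards [self_mem_nhdsWithin] with s hs
      rw [if_pos (lt_of_lt_of_le (ENNReal.coe_lt_coe.2 hs) ht)]
    · refine ⟨b, tendsto_const_nhds.congr' ?_⟩
      filter_upwards [nhdsWithin_le_nhds (continuousAt_const.eventually_lt hc.continuousAt
        (not_le.1 ht))] with s hs
      rw [if_neg hs.not_gt]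

end Cadlag

/-! ### The empirical process and its continuous approximation -/

section EmpiricalProcess

variable {d : ℕ} {Ω : Type*} {f₀ : Phase d → ℝ} {θ : EuclideanSpace ℝ (Fin d) → ℝ} {a : ℝ} {N : ℕ}
  {Z : ℕ → Ω → Phase d} {B : ℕ → ℝ≥0 → Ω → EuclideanSpace ℝ (Fin d)} {e : ℕ → ℕ → ℕ → Ω → ℝ}
  {T : ℝ≥0}

/-- The positions and velocities of the `N` free particles at time `t`. -/
noncomputable def trajectories (Z : ℕ → Ω → Phase d)
    (B : ℕ → ℝ≥0 → Ω → EuclideanSpace ℝ (Fin d)) (N : ℕ) (t : ℝ≥0) (ω : Ω) : Fin N → Phase d :=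
  fun i ↦ markTrajectory t (mark Z B i ω)

open Classical in
/-- The indicators of the particles that are active at time `t`. -/
noncomputable def activeWeights (θ : EuclideanSpace ℝ (Fin d) → ℝ) (a : ℝ) (Z : ℕ → Ω → Phase d)
    (B : ℕ → ℝ≥0 → Ω → EuclideanSpace ℝ (Fin d)) (e : ℕ → ℕ → ℕ → Ω → ℝ) (N : ℕ) (t : ℝ≥0) (ω : Ω) :
    Fin N → ℝ :=
  fun i ↦ if t < removalTime θ a Z B e N i ω then 1 else 0

/-- A continuous substitute for the indicator that a particle removed at time `τ` is active at
time `t`: it decreases linearly from one to zero during the time span `1 / N` before `τ`. -/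
noncomputable def fadingWeight (N : ℕ) (τ : ℝ≥0∞) (t : ℝ≥0) : ℝ :=
  (min ((τ - t) * N) 1).toReal

/-- The continuous substitutes for the indicators of the active particles. -/
noncomputable def fadingWeights (θ : EuclideanSpace ℝ (Fin d) → ℝ) (a : ℝ) (Z : ℕ → Ω → Phase d)
    (B : ℕ → ℝ≥0 → Ω → EuclideanSpace ℝ (Fin d)) (e : ℕ → ℕ → ℕ → Ω → ℝ) (N : ℕ) (t : ℝ≥0) (ω : Ω) :
    Fin N → ℝ :=
  fun i ↦ fadingWeight N (removalTime θ a Z B e N i ω) t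

/-- The empirical measure with continuously fading particles. -/
noncomputable def fadingMeasure (θ : EuclideanSpace ℝ (Fin d) → ℝ) (a : ℝ) (Z : ℕ → Ω → Phase d)
    (B : ℕ → ℝ≥0 → Ω → EuclideanSpace ℝ (Fin d)) (e : ℕ → ℕ → ℕ → Ω → ℝ) (N : ℕ) (ω : Ω) (t : ℝ≥0) :
    SubProb (Phase d) :=
  weightedEmpirical (fadingWeights θ a Z B e N t ω) (trajectories Z B N t ω)

lemma continuous_fadingWeight (N : ℕ) (τ : ℝ≥0∞) : Continuous (fadingWeight N τ) := by
  have h1 : Continuous fun t : ℝ≥0 ↦ (τ - t) * N := by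
    refine (ENNReal.continuous_mul_const (ENNReal.natCast_ne_top N)).comp ?_
    by_cases hτ : τ = ∞
    · simpa [hτ] using continuous_const
    · exact (ENNReal.continuous_sub_left hτ).comp ENNReal.continuous_coe
  refine ENNReal.continuousOn_toReal.comp_continuous (h1.min continuous_const) fun t ↦ ?_
  exact ((min_le_right _ _).trans_lt ENNReal.one_lt_top).ne

lemma fadingWeight_eq_zero {τ : ℝ≥0∞} {t : ℝ≥0} (h : τ ≤ t) : fadingWeight N τ t = 0 := by
  simp [fadingWeight, tsub_eq_zero_of_le h]

lemma fadingWeight_eq_one (hN : 0 < N) {τ : ℝ≥0∞} {t : ℝ≥0} (h : t + (N : ℝ≥0∞)⁻¹ ≤ τ) :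
    fadingWeight N τ t = 1 := by
  have h1 : (N : ℝ≥0∞)⁻¹ ≤ τ - t := ENNReal.le_sub_of_add_le_left ENNReal.coe_ne_top h
  have h2 : 1 ≤ (τ - t) * N := by
    rw [← ENNReal.inv_mul_cancel (by exact_mod_cast hN.ne') (ENNReal.natCast_ne_top N)]
    gcongr
  simp [fadingWeight, h2]

lemma measurable_fadingWeight (N : ℕ) (t : ℝ≥0) : Measurable fun τ ↦ fadingWeight N τ t := by
  unfold fadingWeight
  fun_prop

lemma continuous_trajectories (N : ℕ) (ω : Ω) : Continuous fun t ↦ trajectories Z B N t ω :=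
  continuous_pi fun _ ↦ continuous_markTrajectory _

lemma continuous_fadingMeasure (ω : Ω) :
    Continuous (fadingMeasure θ a Z B e N ω) :=
  Continuous.comp (g := fun p : (Fin N → ℝ) × (Fin N → Phase d) ↦ weightedEmpirical p.1 p.2)
    (f := fun t ↦ (fadingWeights θ a Z B e N t ω, trajectories Z B N t ω))
    continuous_weightedEmpirical ((continuous_pi fun _ ↦ continuous_fadingWeight N _).prodMk
      (continuous_trajectories N ω))

lemma empiricalMeasure_regularNoise (ω : Ω) (t : ℝ≥0) :
    empiricalMeasure θ a Z (regularNoise B) e N ω t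
      = weightedEmpirical (activeWeights θ a Z B e N t ω) (trajectories Z B N t ω) := by
  classical
  apply SubProb.ext_measure
  simp only [empiricalMeasure, weightedEmpirical, SubProb.toMeasure_mk, active,
    Finset.sum_filter]
  congr 1
  refine Finset.sum_congr rfl fun i _ ↦ ?_
  change (if (t : ℝ≥0∞) < removalTime θ a Z B e N i ω then _ else _) = ENNReal.ofReal
    (min (if (t : ℝ≥0∞) < removalTime θ a Z B e N i ω then 1 else 0) 1) • _
  by_cases h : (t : ℝ≥0∞) < removalTime θ a Z B e N i ω
  · rw [if_pos h, if_pos h]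
    simp [freeParticle_regularNoise, trajectories]
  · rw [if_neg h, if_neg h]
    simp

lemma isCadlag_empiricalMeasure_regularNoise (ω : Ω) :
    IsCadlag fun t : Icc (0 : ℝ≥0) T ↦ empiricalMeasure θ a Z (regularNoise B) e N ω t := by
  simp_rw [empiricalMeasure_regularNoise]
  refine IsCadlag.comp_continuous (IsCadlag.prodMk (isCadlag_pi fun i ↦ ?_)
    (isCadlag_of_continuous ?_)) continuous_weightedEmpirical
  · exact isCadlag_ite_lt _ _ _
  · exact (continuous_trajectories N ω).comp continuous_subtype_val

lemma empiricalMeasure_congr {B' : ℕ → ℝ≥0 → Ω → EuclideanSpace ℝ (Fin d)} {ω : Ω}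
    (h : ∀ i t, B i t ω = B' i t ω) (t : ℝ≥0) :
    empiricalMeasure θ a Z B e N ω t = empiricalMeasure θ a Z B' e N ω t := by
  apply SubProb.ext_measure
  simp [empiricalMeasure, active, ringTime, cumulativeRate, freeParticle, h]

/-- The empirical process driven by the regularised noise, which is càdlàg for every outcome. -/
noncomputable def regularProcess (T : ℝ≥0) (θ : EuclideanSpace ℝ (Fin d) → ℝ) (a : ℝ)
    (Z : ℕ → Ω → Phase d) (B : ℕ → ℝ≥0 → Ω → EuclideanSpace ℝ (Fin d)) (e : ℕ → ℕ → ℕ → Ω → ℝ)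
    (N : ℕ) (ω : Ω) : SkorokhodSpace T (SubProb (Phase d)) :=
  ⟨fun t ↦ empiricalMeasure θ a Z (regularNoise B) e N ω t,
    isCadlag_empiricalMeasure_regularNoise ω⟩

lemma empiricalProcess_eq_regularProcess {ε : ℕ → ℝ} {ω : Ω}
    (h : ∀ i t, regularNoise B i t ω = B i t ω) :
    empiricalProcess T θ ε Z B e N ω = regularProcess T θ (ε N) Z B e N ω := by
  have h1 : (fun t : Icc (0 : ℝ≥0) T ↦ empiricalMeasure θ (ε N) Z B e N ω t)
      = fun t : Icc (0 : ℝ≥0) T ↦ empiricalMeasure θ (ε N) Z (regularNoise B) e N ω t :=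
    funext fun t ↦ empiricalMeasure_congr (fun i t ↦ (h i t).symm) _
  exact (congrArg (toSkorokhod _) h1).trans
    (toSkorokhod_of_isCadlag _ (isCadlag_empiricalMeasure_regularNoise ω))

/-- The process of the empirical measures with continuously fading particles. -/
noncomputable def fadingProcess (T : ℝ≥0) (θ : EuclideanSpace ℝ (Fin d) → ℝ) (a : ℝ)
    (Z : ℕ → Ω → Phase d) (B : ℕ → ℝ≥0 → Ω → EuclideanSpace ℝ (Fin d)) (e : ℕ → ℕ → ℕ → Ω → ℝ)
    (N : ℕ) (ω : Ω) : SkorokhodSpace T (SubProb (Phase d)) :=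
  SkorokhodSpace.ofContinuous ⟨fun t ↦ fadingMeasure θ a Z B e N ω t,
    (continuous_fadingMeasure ω).comp continuous_subtype_val⟩

variable [MeasurableSpace Ω] {P : Measure Ω}

namespace IsDrivingNoise

variable (hP : IsDrivingNoise P f₀ Z B e) (hθ : IsInteractionKernel θ)
include hP

lemma measurable_trajectories (N : ℕ) (t : ℝ≥0) : Measurable (trajectories Z B N t) :=
  measurable_pi_lambda _ fun i ↦ (measurable_markTrajectory_apply t).comp (hP.measurable_mark i)

include hθ

lemma measurable_fadingWeights (ha : 0 < N → 0 ≤ a) (t : ℝ≥0) :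
    Measurable (fadingWeights θ a Z B e N t) :=
  measurable_pi_lambda _ fun i ↦
    (measurable_fadingWeight N t).comp (hP.measurable_removalTime hθ (ha i.pos) i)

lemma measurable_regularProcess (ha : 0 < N → 0 ≤ a) :
    Measurable (regularProcess T θ a Z B e N) := by
  have hw : ∀ t, Measurable (activeWeights θ a Z B e N t) := fun t ↦
    measurable_pi_lambda _ fun i ↦ Measurable.ite
      (measurableSet_lt measurable_const (hP.measurable_removalTime hθ (ha i.pos) i)) measurable_const
      measurable_const
  exact measurable_skorokhod
    (g := fun p : (Fin N → ℝ) × (Fin N → Phase d) ↦ weightedEmpirical p.1 p.2)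
    continuous_weightedEmpirical (y := fun t ω ↦ (activeWeights θ a Z B e N t ω, trajectories Z B N t ω))
    (fun t ↦ (hw t).prodMk (hP.measurable_trajectories N t))
    fun ω t ↦ empiricalMeasure_regularNoise ω t

lemma measurable_fadingProcess (ha : 0 < N → 0 ≤ a) :
    Measurable (fadingProcess T θ a Z B e N) :=
  measurable_skorokhod
    (g := fun p : (Fin N → ℝ) × (Fin N → Phase d) ↦ weightedEmpirical p.1 p.2)
    continuous_weightedEmpirical (y := fun t ω ↦ (fadingWeights θ a Z B e N t ω, trajectories Z B N t ω))
    (fun t ↦ (hP.measurable_fadingWeights hθ ha t).prodMk (hP.measurable_trajectories N t))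
    fun _ _ ↦ rfl

lemma measurable_dist_fadingMeasure (ha : 0 < N → 0 ≤ a) (s t : ℝ≥0) :
    Measurable fun ω ↦ dist (fadingMeasure θ a Z B e N ω s) (fadingMeasure θ a Z B e N ω t) := by
  have hm : ∀ t, Measurable fun ω ↦ (fadingWeights θ a Z B e N t ω, trajectories Z B N t ω) :=
    fun t ↦ (hP.measurable_fadingWeights hθ ha t).prodMk (hP.measurable_trajectories N t)
  have h : Continuous fun p : ((Fin N → ℝ) × (Fin N → Phase d)) × ((Fin N → ℝ) × (Fin N → Phase d)) ↦
      dist (weightedEmpirical p.1.1 p.1.2) (weightedEmpirical p.2.1 p.2.2) := by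
    refine Continuous.dist ?_ ?_
    · exact Continuous.comp
        (g := fun p : (Fin N → ℝ) × (Fin N → Phase d) ↦ weightedEmpirical p.1 p.2)
        continuous_weightedEmpirical continuous_fst
    · exact Continuous.comp
        (g := fun p : (Fin N → ℝ) × (Fin N → Phase d) ↦ weightedEmpirical p.1 p.2)
        continuous_weightedEmpirical continuous_snd
  exact Measurable.comp
    (g := fun p : ((Fin N → ℝ) × (Fin N → Phase d)) × ((Fin N → ℝ) × (Fin N → Phase d)) ↦
      dist (weightedEmpirical p.1.1 p.1.2) (weightedEmpirical p.2.1 p.2.2))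
    (f := fun ω ↦ ((fadingWeights θ a Z B e N s ω, trajectories Z B N s ω),
      (fadingWeights θ a Z B e N t ω, trajectories Z B N t ω)))
    h.measurable ((hm s).prodMk (hm t))

end IsDrivingNoise

end EmpiricalProcess

/-! ### Tightness estimates -/

section Tightness

variable {d : ℕ} {Ω : Type*} {f₀ : Phase d → ℝ} {Γ R : ℝ} {θ : EuclideanSpace ℝ (Fin d) → ℝ}
  {a : ℝ} {N : ℕ} {Z : ℕ → Ω → Phase d} {B : ℕ → ℝ≥0 → Ω → EuclideanSpace ℝ (Fin d)}
  {e : ℕ → ℕ → ℕ → Ω → ℝ} {T : ℝ≥0}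

open Classical in
lemma weightedEmpirical_apply_le {X : Type*} [MeasurableSpace X] (w : Fin N → ℝ) (x : Fin N → X)
    {A : Set X} (hA : MeasurableSet A) :
    (weightedEmpirical w x).toMeasure A
      ≤ (N : ℝ≥0∞)⁻¹ * (Finset.univ.filter fun i ↦ x i ∈ A).card := by
  simp only [weightedEmpirical, SubProb.toMeasure_mk, Measure.smul_apply,
    Measure.finsetSum_apply, smul_eq_mul, Measure.dirac_apply' _ hA]
  rw [Finset.card_filter]
  push_cast
  gcongr with i
  calc ENNReal.ofReal (min (w i) 1) * A.indicator 1 (x i) ≤ 1 * A.indicator 1 (x i) := by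
        gcongr
        exact ENNReal.ofReal_le_one.2 (min_le_right _ _)
    _ = _ := by rw [one_mul, indicator_apply]; simp

variable [MeasurableSpace Ω] {P : Measure Ω}

namespace IsDrivingNoise

variable [IsProbabilityMeasure P] (hP : IsDrivingNoise P f₀ Z B e)
include hP

open Classical in
/-- Markov's inequality for the number of particles whose mark lies in a given set. -/
lemma measure_card_mark_mem_le {A : Set (Mark d)} (hA : MeasurableSet A) {r : ℝ≥0∞} (hr : r ≠ 0)
    (hr' : r ≠ ∞) (hN : 0 < N) :
    P {ω | r * N ≤ ((Finset.univ.filter fun i : Fin N ↦ mark Z B i ω ∈ A).card : ℝ≥0∞)}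
      ≤ P.map (mark Z B 0) A / r := by
  have hN0 : (N : ℝ≥0∞) ≠ 0 := by exact_mod_cast hN.ne'
  have hcard : ∀ ω, ((Finset.univ.filter fun i : Fin N ↦ mark Z B i ω ∈ A).card : ℝ≥0∞)
      = ∑ i : Fin N, (mark Z B i ⁻¹' A).indicator 1 ω := by
    intro ω
    rw [Finset.card_filter]
    push_cast
    exact Finset.sum_congr rfl fun i _ ↦ by simp [indicator_apply]
  have hm : ∀ i : ℕ, MeasurableSet (mark Z B i ⁻¹' A) := fun i ↦ hP.measurable_mark i hA
  have hmi : ∀ i : Fin N, Measurable ((mark Z B i ⁻¹' A).indicator (1 : Ω → ℝ≥0∞)) := fun i ↦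
    measurable_one.indicator (hm i)
  simp_rw [hcard]
  refine (meas_ge_le_lintegral_div (Finset.measurable_sum _ fun i _ ↦ hmi i).aemeasurable
    (mul_ne_zero hr hN0) (ENNReal.mul_ne_top hr' (ENNReal.natCast_ne_top N))).trans_eq ?_
  rw [lintegral_finsetSum _ fun i _ ↦ hmi i]
  have h1 : ∀ i : Fin N, ∫⁻ ω, (mark Z B i ⁻¹' A).indicator 1 ω ∂P = P.map (mark Z B 0) A := by
    intro i
    rw [lintegral_indicator_one (hm i), ← hP.map_mark i, Measure.map_apply (hP.measurable_mark i) hA]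
  simp_rw [h1]
  rw [Finset.sum_const, Finset.card_univ, Fintype.card_fin, nsmul_eq_mul, mul_comm r,
    ENNReal.mul_div_mul_left _ _ hN0 (ENNReal.natCast_ne_top N)]

/-- The fading empirical measures leave a large ball with small probability, uniformly in the number
of particles. -/
lemma exists_measure_closedBall_compl_le (θ : EuclideanSpace ℝ (Fin d) → ℝ) (ε : ℕ → ℝ) (T : ℝ≥0)
    {η : ℝ≥0} (hη : 0 < η) :
    ∃ M : ℝ, ∀ N, 1 ≤ N → P {ω | ∃ t : Icc (0 : ℝ≥0) T,
      (η : ℝ≥0∞) < (fadingMeasure θ (ε N) Z B e N ω t).toMeasure (closedBall 0 M)ᶜ} ≤ η := by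
  have hη0 : (η : ℝ≥0∞) ≠ 0 := by exact_mod_cast hη.ne'
  have hpr := Measure.isProbabilityMeasure_map (μ := P) (hP.measurable_mark 0).aemeasurable
  have hc : ∀ m : Mark d, Continuous fun t : Icc (0 : ℝ≥0) T ↦ markTrajectory (t : ℝ≥0) m :=
    fun m ↦ (continuous_markTrajectory m).comp continuous_subtype_val
  have hm : ∀ t : Icc (0 : ℝ≥0) T, Measurable fun m : Mark d ↦ ‖markTrajectory (t : ℝ≥0) m‖ :=
    fun t ↦ (measurable_markTrajectory_apply _).norm
  obtain ⟨M, hM⟩ := exists_measure_unbounded_le (P := P.map (mark Z B 0)) hc hm (κ := η * η)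
    (by positivity)
  refine ⟨M, fun N hN ↦ ?_⟩
  classical
  refine (measure_mono ?_).trans ((hP.measure_card_mark_mem_le (measurableSet_unbounded hc hm M)
    hη0 ENNReal.coe_ne_top hN).trans (ENNReal.div_le_of_le_mul hM))
  rintro ω ⟨t, ht⟩
  have h1 := ht.le.trans (weightedEmpirical_apply_le _ _ isClosed_closedBall.measurableSet.compl)
  rw [mul_comm, ← div_eq_mul_inv, ENNReal.le_div_iff_mul_le
    (Or.inl (by exact_mod_cast (Nat.lt_of_lt_of_le zero_lt_one hN).ne')) (Or.inl (ENNReal.natCast_ne_top N))] at h1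
  refine h1.trans ?_
  simp only [mem_ofPred_eq]
  gcongr with i
  intro h
  refine ⟨t, ?_⟩
  simpa [trajectories] using h

end IsDrivingNoise

/-- The fading weight is constant on `[s,t]` unless the particle is removed after `s` and before
`t + 1 / N`. -/
lemma fadingWeight_eq_of_notMem {τ : ℝ≥0∞} {s t δ : ℝ≥0} (hN : 0 < N) (hst : s ≤ t)
    (hδ : t + (N : ℝ≥0)⁻¹ ≤ s + δ) (h : ¬ (s < τ ∧ τ < s + δ)) :
    fadingWeight N τ s = fadingWeight N τ t := by
  rw [not_and_or, not_lt, not_lt] at h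
  have hNr : (N : ℝ≥0) ≠ 0 := by exact_mod_cast hN.ne'
  have hcoe : (((N : ℝ≥0)⁻¹ : ℝ≥0) : ℝ≥0∞) = (N : ℝ≥0∞)⁻¹ := by
    rw [ENNReal.coe_inv hNr]; simp
  rcases h with h | h
  · rw [fadingWeight_eq_zero h, fadingWeight_eq_zero (h.trans (by exact_mod_cast hst))]
  · have h1 : ∀ u ≤ t, (u : ℝ≥0∞) + (N : ℝ≥0∞)⁻¹ ≤ τ := fun u hu ↦ by
      refine le_trans ?_ h
      rw [← hcoe]
      exact_mod_cast (add_le_add_left hu _).trans hδ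
    rw [fadingWeight_eq_one hN (h1 s hst), fadingWeight_eq_one hN (h1 t le_rfl)]

omit [MeasurableSpace Ω] in
lemma activeWeights_eq_fadingWeights {t δ : ℝ≥0} (hN : 0 < N) (hδ : (N : ℝ≥0)⁻¹ ≤ δ) {i : Fin N}
    {ω : Ω} (h : ¬ (t < removalTime θ a Z B e N i ω ∧ removalTime θ a Z B e N i ω < t + δ)) :
    activeWeights θ a Z B e N t ω i = fadingWeights θ a Z B e N t ω i := by
  have hNr : (N : ℝ≥0) ≠ 0 := by exact_mod_cast hN.ne'
  have hcoe : (((N : ℝ≥0)⁻¹ : ℝ≥0) : ℝ≥0∞) = (N : ℝ≥0∞)⁻¹ := by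
    rw [ENNReal.coe_inv hNr]; simp
  unfold activeWeights fadingWeights
  split_ifs with h1
  · have h2 : (t : ℝ≥0∞) + δ ≤ removalTime θ a Z B e N i ω := not_lt.1 fun h' ↦ h ⟨h1, h'⟩
    refine (fadingWeight_eq_one hN (le_trans ?_ h2)).symm
    rw [← hcoe]
    gcongr
  · exact (fadingWeight_eq_zero (not_lt.1 h1)).symm

namespace IsDrivingNoise

variable [IsProbabilityMeasure P] (hP : IsDrivingNoise P f₀ Z B e)
  (hf₀ : IsInitialDensity f₀ Γ R) (hθ : IsInteractionKernel θ) {ε : ℕ → ℝ}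
  (hε : ∀ N, 1 ≤ N → 0 < ε N)
include hP hf₀ hθ hε

/-- The empirical process is uniformly close to its continuous approximation. -/
lemma exists_measure_dist_fadingMeasure_le (T : ℝ≥0) {η : ℝ≥0} (hη : 0 < η) :
    ∃ N₀ : ℕ, ∀ N, N₀ ≤ N → P {ω | ∃ t : Icc (0 : ℝ≥0) T,
      (η : ℝ) < dist (empiricalMeasure θ (ε N) Z (regularNoise B) e N ω t)
        (fadingMeasure θ (ε N) Z B e N ω t)} ≤ η := by
  classical
  obtain ⟨δ, hδ, N₀, hN₀⟩ := hP.exists_measure_removals_le hθ hε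
    (ENNReal.mul_ne_top ENNReal.ofReal_ne_top measure_closedBall_lt_top.ne)
    (hP.map_position_le hf₀) T hη
  obtain ⟨N₁, hN₁⟩ := exists_nat_gt δ⁻¹
  have hN₁0 : 0 < N₁ := by
    have : (0 : ℝ≥0) < N₁ := zero_le.trans_lt hN₁
    exact_mod_cast this
  refine ⟨max N₀ N₁, fun N hN ↦ (measure_mono ?_).trans (hN₀ N (le_of_max_le_left hN))⟩
  have hN1 : 0 < N := hN₁0.trans_le (le_of_max_le_right hN)
  have hNδ : (N : ℝ≥0)⁻¹ ≤ δ := by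
    have h1 : (N₁ : ℝ≥0) ≤ N := by exact_mod_cast le_of_max_le_right hN
    exact inv_le_of_inv_le₀ hδ (hN₁.le.trans h1)
  rintro ω ⟨t, ht⟩
  refine ⟨t, t.2.2, ?_⟩
  by_contra! hcard
  refine ht.not_ge ?_
  rw [empiricalMeasure_regularNoise]
  refine dist_weightedEmpirical_le η.2 ?_
  have h2 : (Finset.univ.filter fun i ↦ ¬ (activeWeights θ (ε N) Z B e N t ω i
      = fadingWeights θ (ε N) Z B e N t ω i ∧
        dist (trajectories Z B N t ω i) (trajectories Z B N t ω i) ≤ η)).card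
      ≤ (Finset.univ.filter fun i ↦ ((t : ℝ≥0) : ℝ≥0∞) < removalTime θ (ε N) Z B e N i ω ∧
        removalTime θ (ε N) Z B e N i ω < (t : ℝ≥0) + δ).card := by
    refine Finset.card_le_card (Finset.monotone_filter_right _ fun i _ hi ↦ ?_)
    by_contra h
    exact hi ⟨activeWeights_eq_fadingWeights hN1 hNδ h, by simp⟩
  have h3 := (Nat.cast_le (α := ℝ≥0∞).2 h2).trans hcard
  have h4 : ((Finset.univ.filter fun i ↦ ¬ (activeWeights θ (ε N) Z B e N t ω i
      = fadingWeights θ (ε N) Z B e N t ω i ∧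
        dist (trajectories Z B N t ω i) (trajectories Z B N t ω i) ≤ η)).card : ℝ≥0) ≤ η * N := by
    exact_mod_cast h3
  exact_mod_cast h4

/-- The modulus of continuity of the fading empirical measures is small with high probability,
uniformly in the number of particles. -/
lemma exists_measure_fadingMeasure_modulus_le (T : ℝ≥0) {η : ℝ≥0} (hη : 0 < η) :
    ∃ δ : ℝ, 0 < δ ∧ ∀ N, 1 ≤ N → P {ω | ∃ s t : Icc (0 : ℝ≥0) T, dist s t < δ ∧
      (η : ℝ) < dist (fadingMeasure θ (ε N) Z B e N ω s) (fadingMeasure θ (ε N) Z B e N ω t)}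
        ≤ η := by
  classical
  have hpr := Measure.isProbabilityMeasure_map (μ := P) (hP.measurable_mark 0).aemeasurable
  set r : ℝ≥0 := η / 2 with hr
  have hr0 : 0 < r := by positivity
  have hre : (r : ℝ≥0∞) ≠ 0 := by exact_mod_cast hr0.ne'
  have hrr : r + r = η := add_halves η
  -- many particles: few of them are removed in a short time or move far
  obtain ⟨δ₁, hδ₁, N₀, hN₀⟩ := hP.exists_measure_removals_le hθ hε
    (ENNReal.mul_ne_top ENNReal.ofReal_ne_top measure_closedBall_lt_top.ne)
    (hP.map_position_le hf₀) T hr0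
  have hc : ∀ m : Mark d, Continuous fun t : Icc (0 : ℝ≥0) T ↦ markTrajectory (t : ℝ≥0) m :=
    fun m ↦ (continuous_markTrajectory m).comp continuous_subtype_val
  have hm : ∀ s t : Icc (0 : ℝ≥0) T, Measurable fun m : Mark d ↦
      dist (markTrajectory (s : ℝ≥0) m) (markTrajectory (t : ℝ≥0) m) :=
    fun s t ↦ (measurable_markTrajectory_apply _).dist (measurable_markTrajectory_apply _)
  obtain ⟨δ₂, hδ₂, hδ₂'⟩ := exists_measure_modulus_le (P := P.map (mark Z B 0)) hc hm
    (r := r) (by exact_mod_cast hr0) (κ := r * r) (by positivity)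
  set A : Set (Mark d) := {m | ∃ s t : Icc (0 : ℝ≥0) T, dist s t < δ₂ ∧
    (r : ℝ) < dist (markTrajectory (s : ℝ≥0) m) (markTrajectory (t : ℝ≥0) m)} with hA
  have hAm : MeasurableSet A := measurableSet_modulus hc hm δ₂ r
  obtain ⟨N₁, hN₁⟩ := exists_nat_gt (δ₁ / 2)⁻¹
  -- finitely many remaining numbers of particles: each process is continuous
  have hsmall : ∀ N, ∃ δ : ℝ, 0 < δ ∧ (1 ≤ N → P {ω | ∃ s t : Icc (0 : ℝ≥0) T, dist s t < δ ∧
      (η : ℝ) < dist (fadingMeasure θ (ε N) Z B e N ω s) (fadingMeasure θ (ε N) Z B e N ω t)}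
        ≤ η) := by
    intro N
    by_cases hN : 1 ≤ N
    · obtain ⟨δ, hδ, h⟩ := exists_measure_modulus_le (P := P)
        (X := fun (t : Icc (0 : ℝ≥0) T) ω ↦ fadingMeasure θ (ε N) Z B e N ω t)
        (fun ω ↦ (continuous_fadingMeasure ω).comp continuous_subtype_val)
        (fun s t ↦ hP.measurable_dist_fadingMeasure hθ (fun _ ↦ (hε N hN).le) s t)
        (r := η) (by exact_mod_cast hη) (κ := η) (by exact_mod_cast hη)
      exact ⟨δ, hδ, fun _ ↦ h⟩
    · exact ⟨1, one_pos, fun h ↦ absurd h hN⟩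
  choose δs hδs hδs' using hsmall
  obtain ⟨δ₃, hδ₃, hδ₃'⟩ : ∃ δ₃ : ℝ, 0 < δ₃ ∧ ∀ N ≤ max N₀ N₁, δ₃ ≤ δs N := by
    obtain ⟨n, -, hn⟩ := Finset.exists_min_image (Finset.range (max N₀ N₁ + 1)) δs ⟨0, by simp⟩
    exact ⟨δs n, hδs n, fun N hN ↦ hn N (Finset.mem_range.2 (Nat.lt_succ_of_le hN))⟩
  refine ⟨min δ₃ (min δ₂ (δ₁ / 2)), by positivity, fun N hN ↦ ?_⟩
  rcases le_total N (max N₀ N₁) with hle | hge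
  · refine (measure_mono ?_).trans (hδs' N hN)
    rintro ω ⟨s, t, hst, h⟩
    exact ⟨s, t, hst.trans_le ((min_le_left _ _).trans (hδ₃' N hle)), h⟩
  have hNδ : (N : ℝ≥0)⁻¹ ≤ δ₁ / 2 := by
    have h1 : (N₁ : ℝ≥0) ≤ N := by exact_mod_cast le_of_max_le_right hge
    exact inv_le_of_inv_le₀ (by positivity) (hN₁.le.trans h1)
  set E₁ : Set Ω := {ω | ∃ u ≤ T, (r : ℝ≥0∞) * N <
      ((Finset.univ.filter fun i ↦ (u : ℝ≥0∞) < removalTime θ (ε N) Z B e N i ω ∧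
        removalTime θ (ε N) Z B e N i ω < u + δ₁).card : ℝ≥0∞)} with hE₁
  set E₂ : Set Ω := {ω | (r : ℝ≥0∞) * N ≤
    ((Finset.univ.filter fun i : Fin N ↦ mark Z B i ω ∈ A).card : ℝ≥0∞)} with hE₂
  have hP₁ : P E₁ ≤ r := hN₀ N (le_of_max_le_left hge)
  have hP₂ : P E₂ ≤ r := (hP.measure_card_mark_mem_le hAm hre ENNReal.coe_ne_top hN).trans
    (ENNReal.div_le_of_le_mul hδ₂')
  suffices hsub : {ω | ∃ s t : Icc (0 : ℝ≥0) T, dist s t < min δ₃ (min δ₂ (δ₁ / 2)) ∧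
      (η : ℝ) < dist (fadingMeasure θ (ε N) Z B e N ω s) (fadingMeasure θ (ε N) Z B e N ω t)}
      ⊆ E₁ ∪ E₂ by
    refine (measure_mono hsub).trans ((measure_union_le _ _).trans ((add_le_add hP₁ hP₂).trans ?_))
    exact_mod_cast hrr.le
  have key : ∀ ω (s t : Icc (0 : ℝ≥0) T), s ≤ t → dist s t < min δ₃ (min δ₂ (δ₁ / 2)) →
      (η : ℝ) < dist (fadingMeasure θ (ε N) Z B e N ω s) (fadingMeasure θ (ε N) Z B e N ω t) →
      ω ∈ E₁ ∪ E₂ := by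
    intro ω s t hst hdist hη'
    by_contra hω
    simp only [hE₁, hE₂, mem_union, mem_ofPred_eq, not_or, not_exists, not_and, not_lt,
      not_le] at hω
    refine hη'.not_ge (dist_weightedEmpirical_le η.2 ?_)
    have hst₂ : dist s t < δ₂ := hdist.trans_le ((min_le_right _ _).trans (min_le_left _ _))
    have hst₁ : dist s t < δ₁ / 2 := hdist.trans_le ((min_le_right _ _).trans (min_le_right _ _))
    have hts : (t : ℝ≥0) ≤ s + δ₁ / 2 := by
      rw [Subtype.dist_eq, NNReal.dist_eq, abs_sub_comm] at hst₁
      have h := (le_abs_self _).trans hst₁.le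
      rw [← NNReal.coe_le_coe]
      push_cast
      linarith
    have hwin : (t : ℝ≥0) + (N : ℝ≥0)⁻¹ ≤ s + δ₁ := by
      calc (t : ℝ≥0) + (N : ℝ≥0)⁻¹ ≤ s + δ₁ / 2 + δ₁ / 2 := add_le_add hts hNδ
        _ = s + δ₁ := by rw [add_assoc, add_halves]
    have hsub : (Finset.univ.filter fun i ↦ ¬ (fadingWeights θ (ε N) Z B e N s ω i
        = fadingWeights θ (ε N) Z B e N t ω i ∧
        dist (trajectories Z B N s ω i) (trajectories Z B N t ω i) ≤ η))
        ⊆ (Finset.univ.filter fun i ↦ ((s : ℝ≥0) : ℝ≥0∞) < removalTime θ (ε N) Z B e N i ω ∧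
          removalTime θ (ε N) Z B e N i ω < (s : ℝ≥0) + δ₁)
        ∪ Finset.univ.filter fun i : Fin N ↦ mark Z B i ω ∈ A := by
      intro i hi
      simp only [Finset.mem_filter, Finset.mem_univ, true_and, Finset.mem_union] at hi ⊢
      by_contra! h
      refine hi ⟨fadingWeight_eq_of_notMem hN hst hwin fun h' ↦ h.1 h'.1 |>.not_gt h'.2, ?_⟩
      by_contra! h'
      refine h.2 ⟨s, t, hst₂, lt_of_le_of_lt ?_ h'⟩
      exact_mod_cast hrr ▸ le_self_add
    have h1 := Nat.cast_le (α := ℝ≥0∞).2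
      ((Finset.card_le_card hsub).trans (Finset.card_union_le _ _))
    push_cast at h1
    have h2 := h1.trans (add_le_add (hω.1 s s.2.2) hω.2.le)
    rw [← add_mul, show (r : ℝ≥0∞) + r = η by exact_mod_cast hrr] at h2
    have h3 : ((Finset.univ.filter fun i ↦ ¬ (fadingWeights θ (ε N) Z B e N s ω i
        = fadingWeights θ (ε N) Z B e N t ω i ∧
        dist (trajectories Z B N s ω i) (trajectories Z B N t ω i) ≤ η)).card : ℝ≥0) ≤ η * N := by
      exact_mod_cast h2
    exact_mod_cast h3
  rintro ω ⟨s, t, hst, h⟩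
  rcases le_total s t with hle | hle
  · exact key ω s t hle hst h
  · exact key ω t s hle (by rwa [dist_comm]) (by rwa [dist_comm])

end IsDrivingNoise

end Tightness

/-! ### Relative compactness of laws -/

section RelativeCompactness

variable {Ω E : Type*} [MeasurableSpace Ω] {P : Measure Ω} [IsProbabilityMeasure P]
  [PseudoEMetricSpace E] [MeasurableSpace E] [BorelSpace E] {U V : ℕ → Ω → E}

/-- If `V` is tight and `U` is close to `V` in probability, expectations of bounded continuous
functions of `U` and of `V` are close. Continuity is uniform near a compact set. -/
lemma tendsto_integral_sub_integral_of_tight (hU : ∀ N, AEMeasurable (U N) P)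
    (hV : ∀ N, Measurable (V N))
    (htight : ∀ κ : ℝ≥0, 0 < κ → ∃ K, IsCompact K ∧ ∀ N, 1 ≤ N → P {ω | V N ω ∉ K} ≤ κ)
    (hclose : ∀ κ : ℝ≥0, 0 < κ → ∃ N₀, ∀ N, N₀ ≤ N → P {ω | κ < edist (U N ω) (V N ω)} ≤ κ)
    (f : E →ᵇ ℝ) :
    Tendsto (fun N ↦ ∫ ω, f (U N ω) ∂P - ∫ ω, f (V N ω) ∂P) atTop (𝓝 0) := by
  rw [Metric.tendsto_atTop]
  intro ρ hρ
  obtain ⟨κ, hκ, hκρ⟩ : ∃ κ : ℝ≥0, 0 < κ ∧ 2 * ‖f‖ * (2 * κ) ≤ ρ / 4 := by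
    refine ⟨(ρ / (16 * (‖f‖ + 1))).toNNReal, Real.toNNReal_pos.2 (by positivity), ?_⟩
    rw [Real.coe_toNNReal _ (by positivity)]
    have h : ‖f‖ / (‖f‖ + 1) ≤ 1 := (div_le_one (by positivity)).2 (by linarith)
    calc 2 * ‖f‖ * (2 * (ρ / (16 * (‖f‖ + 1)))) = ρ / 4 * (‖f‖ / (‖f‖ + 1)) := by
          field_simp
          ring
      _ ≤ ρ / 4 * 1 := by gcongr
      _ = ρ / 4 := mul_one _
  obtain ⟨K, hK, hVK⟩ := htight κ hκ
  have hunif := hK.uniformContinuousAt_of_continuousAt f (fun x _ ↦ f.continuous.continuousAt)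
    (Metric.dist_mem_uniformity (show 0 < ρ / 4 by positivity))
  obtain ⟨δ, hδ, hδ'⟩ := mem_uniformity_edist.1 hunif
  obtain ⟨κ', hκ', hκ'δ⟩ := ENNReal.lt_iff_exists_nnreal_btwn.1 (lt_min hδ (ENNReal.coe_pos.2 hκ))
  have hκ'0 : 0 < κ' := ENNReal.coe_pos.1 hκ'
  obtain ⟨N₀, hN₀⟩ := hclose κ' hκ'0
  refine ⟨max 1 N₀, fun N hN ↦ ?_⟩
  set bad : Set Ω := {ω | V N ω ∉ K} ∪ {ω | κ' < edist (U N ω) (V N ω)} with hbad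
  have hbadP : P.real (toMeasurable P bad) ≤ 2 * κ := by
    rw [measureReal_def, measure_toMeasurable]
    refine ENNReal.toReal_le_of_le_ofReal (by positivity) ?_
    refine (measure_union_le _ _).trans ((add_le_add (hVK N (le_of_max_le_left hN))
      ((hN₀ N (le_of_max_le_right hN)).trans (hκ'δ.le.trans (min_le_right _ _)))).trans_eq ?_)
    rw [← two_mul, ENNReal.ofReal_mul zero_le_two]
    simp
  have hUi : Integrable (fun ω ↦ f (U N ω)) P := by
    refine Integrable.of_bound (C := ‖f‖) ?_ (Eventually.of_forall fun ω ↦ f.norm_coe_le_norm _)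
    exact (f.continuous.measurable.comp_aemeasurable (hU N)).aestronglyMeasurable
  have hVi : Integrable (fun ω ↦ f (V N ω)) P := by
    refine Integrable.of_bound (C := ‖f‖) ?_ (Eventually.of_forall fun ω ↦ f.norm_coe_le_norm _)
    exact (f.continuous.measurable.comp (hV N)).aestronglyMeasurable
  have hpt : ∀ ω, ‖f (U N ω) - f (V N ω)‖
      ≤ ρ / 4 + (toMeasurable P bad).indicator (fun _ ↦ 2 * ‖f‖) ω := by
    intro ω
    by_cases hω : ω ∈ bad
    · rw [indicator_of_mem (subset_toMeasurable P bad hω)]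
      have h := norm_sub_le_of_le (f.norm_coe_le_norm (U N ω)) (f.norm_coe_le_norm (V N ω))
      linarith
    · simp only [hbad, mem_union, mem_ofPred_eq, not_or, not_not, not_lt] at hω
      have h : dist (f (V N ω)) (f (U N ω)) < ρ / 4 := by
        refine hδ' (a := V N ω) (b := U N ω) ?_ hω.1
        rw [edist_comm]
        exact hω.2.trans_lt (hκ'δ.trans_le (min_le_left _ _))
      rw [dist_comm, dist_eq_norm] at h
      have h0 : 0 ≤ (toMeasurable P bad).indicator (fun _ ↦ 2 * ‖f‖) ω :=
        indicator_nonneg (fun _ _ ↦ by positivity) ω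
      linarith
  rw [dist_zero_right, ← integral_sub hUi hVi]
  have hInd : Integrable ((toMeasurable P bad).indicator fun _ ↦ 2 * ‖f‖) P :=
    (integrable_const _).indicator (measurableSet_toMeasurable _ _)
  calc ‖∫ ω, f (U N ω) - f (V N ω) ∂P‖ ≤ ∫ ω, ‖f (U N ω) - f (V N ω)‖ ∂P :=
        norm_integral_le_integral_norm _
    _ ≤ ∫ ω, ρ / 4 + (toMeasurable P bad).indicator (fun _ ↦ 2 * ‖f‖) ω ∂P :=
        integral_mono (hUi.sub hVi).norm ((integrable_const _).add hInd) hpt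
    _ = ρ / 4 + P.real (toMeasurable P bad) * (2 * ‖f‖) := by
        rw [integral_add (integrable_const _) hInd,
          integral_indicator_const _ (measurableSet_toMeasurable _ _)]
        simp
    _ ≤ ρ / 4 + 2 * ‖f‖ * (2 * κ) := by
        rw [mul_comm (P.real _)]
        gcongr
    _ < ρ := by linarith

/-- Laws that are asymptotically close to a tight sequence are relatively compact. -/
lemma isCompact_closure_laws_of_tight [T2Space E] (hU : ∀ N, AEMeasurable (U N) P)
    (hV : ∀ N, Measurable (V N))
    (htight : ∀ κ : ℝ≥0, 0 < κ → ∃ K, IsCompact K ∧ ∀ N, 1 ≤ N → P {ω | V N ω ∉ K} ≤ κ)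
    (hclose : ∀ κ : ℝ≥0, 0 < κ → ∃ N₀, ∀ N, N₀ ≤ N → P {ω | κ < edist (U N ω) (V N ω)} ≤ κ) :
    IsCompact (closure ((fun N ↦ ProbabilityMeasure.map ⟨P, inferInstance⟩ (hU N)) '' Ici 1)) := by
  set lawU : ℕ → ProbabilityMeasure E := fun N ↦
    ProbabilityMeasure.map ⟨P, inferInstance⟩ (hU N) with hlawU
  set lawV : ℕ → ProbabilityMeasure E := fun N ↦
    ProbabilityMeasure.map ⟨P, inferInstance⟩ (hV N).aemeasurable with hlawV
  have hUm : ∀ N, (lawU N : Measure E) = P.map (U N) := fun _ ↦ rfl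
  have hVm : ∀ N, (lawV N : Measure E) = P.map (V N) := fun _ ↦ rfl
  have hVc : IsCompact (closure (lawV '' Ici 1)) := by
    refine isCompact_closure_of_isTightMeasureSet
      (isTightMeasureSet_iff_exists_isCompact_measure_compl_le.2 fun κ hκ ↦ ?_)
    obtain ⟨κ', hκ', hκ'κ⟩ := ENNReal.lt_iff_exists_nnreal_btwn.1 hκ
    obtain ⟨K, hK, h⟩ := htight κ' (ENNReal.coe_pos.1 hκ')
    refine ⟨K, hK, ?_⟩
    rintro _ ⟨_, ⟨N, hN, rfl⟩, rfl⟩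
    refine le_trans ?_ ((h N hN).trans hκ'κ.le)
    rw [hVm, Measure.map_apply (hV N) hK.isClosed.measurableSet.compl]
    rfl
  have hUint : ∀ N (f : E →ᵇ ℝ), ∫ x, f x ∂(lawU N : Measure E) = ∫ ω, f (U N ω) ∂P := by
    intro N f
    rw [hUm]
    exact integral_map (hU N) f.continuous.aestronglyMeasurable
  have hVint : ∀ N (f : E →ᵇ ℝ), ∫ x, f x ∂(lawV N : Measure E) = ∫ ω, f (V N ω) ∂P := by
    intro N f
    rw [hVm]
    exact integral_map (hV N).aemeasurable f.continuous.aestronglyMeasurable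
  suffices h : IsCompact (closure (lawV '' Ici 1) ∪ lawU '' Ici 1) from
    h.closure_of_subset subset_union_right
  rw [isCompact_iff_ultrafilter_le_nhds]
  intro F hF
  rcases Ultrafilter.union_mem_iff.1 (le_principal_iff.1 hF) with h | h
  · obtain ⟨Q, hQ, hFQ⟩ := isCompact_iff_ultrafilter_le_nhds.1 hVc F (le_principal_iff.2 h)
    exact ⟨Q, Or.inl hQ, hFQ⟩
  · set G := Ultrafilter.ofComapInfPrincipal h with hG
    have hG1 : Ici 1 ∈ G := Ultrafilter.ofComapInfPrincipal_mem h
    have hGF : G.map lawU = F := Ultrafilter.ofComapInfPrincipal_eq_of_map h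
    rcases G.le_cofinite_or_eq_pure with hcof | ⟨n, hn⟩
    · -- an ultrafilter of indices that tend to infinity: the limit along `lawV` is also the limit
      -- along `lawU`
      rw [Nat.cofinite_eq_atTop] at hcof
      obtain ⟨Q, hQ, hGQ⟩ := isCompact_iff_ultrafilter_le_nhds.1 hVc (G.map lawV)
        (le_principal_iff.2 (mem_of_superset (Ultrafilter.mem_map.2
          (mem_of_superset hG1 (subset_preimage_image lawV _))) subset_closure))
      refine ⟨Q, Or.inl hQ, ?_⟩
      rw [← hGF]
      have htV : Tendsto lawV G (𝓝 Q) := hGQ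
      change Tendsto lawU G (𝓝 Q)
      rw [ProbabilityMeasure.tendsto_iff_forall_integral_tendsto] at htV ⊢
      intro f
      have h0 := (tendsto_integral_sub_integral_of_tight hU hV htight hclose f).mono_left hcof
      have h1 := (htV f).add h0
      rw [add_zero] at h1
      refine h1.congr fun N ↦ ?_
      rw [hUint, hVint]
      ring
    · refine ⟨lawU n, Or.inr ⟨n, ?_, rfl⟩, ?_⟩
      · rw [hn] at hG1
        exact Ultrafilter.mem_pure.1 hG1
      · rw [← hGF, hn]
        exact pure_le_nhds _

end RelativeCompactness

section EmpiricalProcess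

variable {d : ℕ} {Ω : Type*} {f₀ : Phase d → ℝ} {Γ R : ℝ} {θ : EuclideanSpace ℝ (Fin d) → ℝ}
  {N : ℕ} {Z : ℕ → Ω → Phase d} {B : ℕ → ℝ≥0 → Ω → EuclideanSpace ℝ (Fin d)}
  {e : ℕ → ℕ → ℕ → Ω → ℝ} [MeasurableSpace Ω] {P : Measure Ω}

namespace IsDrivingNoise

variable [IsProbabilityMeasure P] (hP : IsDrivingNoise P f₀ Z B e)
  (hf₀ : IsInitialDensity f₀ Γ R) (hθ : IsInteractionKernel θ) {ε : ℕ → ℝ}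
  (hε : ∀ N, 1 ≤ N → 0 < ε N)
include hP hf₀ hθ hε

lemma exists_isCompact_fadingProcess (T : ℝ≥0) {κ : ℝ≥0} (hκ : 0 < κ) :
    ∃ K, IsCompact K ∧ ∀ N, 1 ≤ N → P {ω | fadingProcess T θ (ε N) Z B e N ω ∉ K} ≤ κ := by
  obtain ⟨η, hη, hηsum⟩ := ENNReal.exists_pos_sum_of_countable
    (ε := (κ / 2 : ℝ≥0)) (by positivity) ℕ
  have hηt : Tendsto η atTop (𝓝 0) := by
    have h : Summable η := ENNReal.tsum_coe_ne_top_iff_summable.1 hηsum.ne_top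
    exact NNReal.tendsto_atTop_zero_of_summable h
  choose M hM using fun n ↦ hP.exists_measure_closedBall_compl_le θ ε T (hη n)
  choose δ hδ hδ' using fun n ↦ hP.exists_measure_fadingMeasure_modulus_le hf₀ hθ hε T (hη n)
  have hcpt : IsCompact {μ : SubProb (Phase d) | ∀ n, μ.toMeasure (closedBall 0 (M n))ᶜ ≤ η n} :=
    SubProb.isCompact_of_compl_le (fun n ↦ isCompact_closedBall _ _) hηt
  have hηt' : Tendsto (fun n ↦ (η n : ℝ)) atTop (𝓝 0) := NNReal.tendsto_coe.2 hηt
  have hK : IsCompact {x : SkorokhodSpace T (SubProb (Phase d)) |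
      (∀ t, x t ∈ {μ : SubProb (Phase d) | ∀ n, μ.toMeasure (closedBall 0 (M n))ᶜ ≤ η n}) ∧
      ∀ m s t, dist s t < δ m → dist (x s) (x t) ≤ η m} :=
    SkorokhodSpace.isCompact_of_modulus hcpt hηt' hδ
  refine ⟨_, hK, fun N hN ↦ ?_⟩
  have hsub : {ω | fadingProcess T θ (ε N) Z B e N ω ∉
      {x : SkorokhodSpace T (SubProb (Phase d)) |
        (∀ t, x t ∈ {μ : SubProb (Phase d) | ∀ n, μ.toMeasure (closedBall 0 (M n))ᶜ ≤ η n}) ∧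
        ∀ m s t, dist s t < δ m → dist (x s) (x t) ≤ η m}}
      ⊆ ⋃ n, ({ω | ∃ t : Icc (0 : ℝ≥0) T, (η n : ℝ≥0∞)
          < (fadingMeasure θ (ε N) Z B e N ω t).toMeasure (closedBall 0 (M n))ᶜ} ∪
        {ω | ∃ s t : Icc (0 : ℝ≥0) T, dist s t < δ n ∧ (η n : ℝ) <
          dist (fadingMeasure θ (ε N) Z B e N ω s) (fadingMeasure θ (ε N) Z B e N ω t)}) := by
    intro ω hω
    simp only [mem_ofPred_eq, not_and_or, not_forall] at hω
    rw [mem_iUnion]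
    rcases hω with ⟨t, n, h⟩ | ⟨n, s, t, hst, h⟩
    · exact ⟨n, Or.inl ⟨t, not_le.1 h⟩⟩
    · exact ⟨n, Or.inr ⟨s, t, hst, not_le.1 h⟩⟩
  refine (measure_mono hsub).trans ((measure_iUnion_le _).trans ?_)
  calc ∑' n, P _ ≤ ∑' n, ((η n : ℝ≥0∞) + η n) :=
        ENNReal.tsum_le_tsum fun n ↦
          (measure_union_le _ _).trans (add_le_add (hM n N hN) (hδ' n N hN))
    _ = (∑' n, (η n : ℝ≥0∞)) + ∑' n, (η n : ℝ≥0∞) := ENNReal.tsum_add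
    _ ≤ (κ / 2 : ℝ≥0) + (κ / 2 : ℝ≥0) := add_le_add hηsum.le hηsum.le
    _ = κ := by exact_mod_cast add_halves κ

lemma exists_measure_edist_fadingProcess_le (T : ℝ≥0) {κ : ℝ≥0} (hκ : 0 < κ) :
    ∃ N₀, ∀ N, N₀ ≤ N → P {ω | κ < edist (regularProcess T θ (ε N) Z B e N ω)
      (fadingProcess T θ (ε N) Z B e N ω)} ≤ κ := by
  obtain ⟨N₀, hN₀⟩ := hP.exists_measure_dist_fadingMeasure_le hf₀ hθ hε T hκ
  refine ⟨N₀, fun N hN ↦ (measure_mono fun ω hω ↦ ?_).trans (hN₀ N hN)⟩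
  by_contra! h
  simp only [mem_ofPred_eq, not_exists, not_lt] at h
  refine (show (κ : ℝ≥0∞) < _ from hω).not_ge (SkorokhodSpace.edist_le_of_forall fun t ↦ ?_)
  rw [edist_dist]
  exact (ENNReal.ofReal_le_ofReal (h t)).trans_eq (ENNReal.ofReal_coe_nnreal)

end IsDrivingNoise

end EmpiricalProcess

/-! ### Identification of the limits -/

section Domination

variable {X : Type*} [PseudoMetricSpace X]

/-- An open set that has a compact subset `K` has, between `K` and itself, a finite union of basis
sets whose closure is still contained in the open set. -/
lemma exists_finset_countableBasis [SecondCountableTopology X] {K U : Set X} (hK : IsCompact K)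
    (hU : IsOpen U) (hKU : K ⊆ U) : ∃ S : Finset (TopologicalSpace.countableBasis X),
      K ⊆ ⋃ b ∈ S, (b : Set X) ∧ closure (⋃ b ∈ S, (b : Set X)) ⊆ U := by
  obtain ⟨δ, hδ, hδU⟩ := hK.exists_cthickening_subset_open hU hKU
  obtain ⟨S, hS⟩ := hK.elim_finite_subcover
    (fun b : {b : TopologicalSpace.countableBasis X // (b : Set X) ⊆ thickening δ K} ↦ (b.1 : Set X))
    (fun b ↦ TopologicalSpace.isOpen_of_mem_countableBasis b.1.2) fun x hx ↦ by
      obtain ⟨b, hb, hxb, hbU⟩ := (TopologicalSpace.isBasis_countableBasis X).exists_subset_of_mem_open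
        (self_subset_thickening hδ K hx) isOpen_thickening
      exact mem_iUnion.2 ⟨⟨⟨b, hb⟩, hbU⟩, hxb⟩
  classical
  refine ⟨S.image Subtype.val, ?_, ?_⟩
  · refine hS.trans (iUnion₂_subset fun b hb ↦ ?_)
    exact subset_iUnion₂_of_subset b.1 (Finset.mem_image_of_mem _ hb) le_rfl
  · refine Subset.trans ?_ hδU
    refine closure_minimal (iUnion₂_subset fun b hb ↦ ?_) isClosed_cthickening
    obtain ⟨b, -, rfl⟩ := Finset.mem_image.1 hb
    exact b.2.trans (thickening_subset_cthickening _ _)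

lemma measure_le_of_isOpen_le [MeasurableSpace X] {μ ν : Measure X} [ν.OuterRegular]
    (h : ∀ U, IsOpen U → μ U ≤ ν U) : μ ≤ ν := by
  refine Measure.le_iff'.2 fun A ↦ ?_
  rw [A.measure_eq_iInf_isOpen ν]
  exact le_iInf₂ fun U hAU ↦ le_iInf fun hU ↦ (measure_mono hAU).trans (h U hU)

end Domination

section Limit

variable {d : ℕ} {Ω : Type*} {f₀ : Phase d → ℝ} {Γ R : ℝ} {θ : EuclideanSpace ℝ (Fin d) → ℝ}
  {a : ℝ} {N : ℕ} {Z : ℕ → Ω → Phase d} {B : ℕ → ℝ≥0 → Ω → EuclideanSpace ℝ (Fin d)}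
  {e : ℕ → ℕ → ℕ → Ω → ℝ} {T : ℝ≥0} [MeasurableSpace Ω] {P : Measure Ω}

/-- The law of one free particle at time `t`. -/
noncomputable def freeLaw (P : Measure Ω) (Z : ℕ → Ω → Phase d)
    (B : ℕ → ℝ≥0 → Ω → EuclideanSpace ℝ (Fin d)) (t : ℝ≥0) : Measure (Phase d) :=
  (P.map (mark Z B 0)).map (markTrajectory t)

namespace IsDrivingNoise

variable [IsProbabilityMeasure P] (hP : IsDrivingNoise P f₀ Z B e)
include hP

lemma isProbabilityMeasure_freeLaw (t : ℝ≥0) : IsProbabilityMeasure (freeLaw P Z B t) := by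
  have := Measure.isProbabilityMeasure_map (μ := P) (hP.measurable_mark 0).aemeasurable
  exact Measure.isProbabilityMeasure_map (measurable_markTrajectory_apply t).aemeasurable

lemma freeLaw_eq (i : ℕ) (t : ℝ≥0) :
    freeLaw P Z B t = P.map fun ω ↦ markTrajectory t (mark Z B i ω) := by
  rw [freeLaw, ← hP.map_mark i,
    Measure.map_map (measurable_markTrajectory_apply t) (hP.measurable_mark i)]
  rfl

lemma map_freeParticle (t : ℝ≥0) : P.map (freeParticle Z B 0 t) = freeLaw P Z B t := by
  rw [hP.freeLaw_eq 0]
  refine Measure.map_congr ?_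
  filter_upwards [hP.ae_regularNoise_eq] with ω hω
  rw [← freeParticle_regularNoise]
  simp [freeParticle, hω]

omit [IsProbabilityMeasure P] in
lemma aemeasurable_freeParticle (t : ℝ≥0) : AEMeasurable (freeParticle Z B 0 t) P := by
  refine ⟨fun ω ↦ markTrajectory t (mark Z B 0 ω),
    (measurable_markTrajectory_apply t).comp (hP.measurable_mark 0), ?_⟩
  filter_upwards [hP.ae_regularNoise_eq] with ω hω
  rw [← freeParticle_regularNoise]
  simp [freeParticle, hω]

/-- The laws of a free particle depend on time in an upper semicontinuous way on closed sets. -/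
lemma eventually_freeLaw_lt {F : Set (Phase d)} (hF : IsClosed F) {t : ℝ≥0} {c : ℝ≥0∞}
    (h : freeLaw P Z B t F < c) : ∀ᶠ s in 𝓝 t, freeLaw P Z B s F < c := by
  have hpr := Measure.isProbabilityMeasure_map (μ := P) (hP.measurable_mark 0).aemeasurable
  let ν : ℝ≥0 → ProbabilityMeasure (Phase d) := fun s ↦
    ⟨freeLaw P Z B s, hP.isProbabilityMeasure_freeLaw s⟩
  have hlim : Tendsto ν (𝓝 t) (𝓝 (ν t)) := by
    rw [ProbabilityMeasure.tendsto_iff_forall_integral_tendsto]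
    intro f
    have hint : ∀ s, ∫ z, f z ∂(freeLaw P Z B s)
        = ∫ m, f (markTrajectory s m) ∂(P.map (mark Z B 0)) := fun s ↦
      integral_map (measurable_markTrajectory_apply s).aemeasurable
        f.continuous.aestronglyMeasurable
    change Tendsto (fun s ↦ ∫ z, f z ∂(freeLaw P Z B s)) (𝓝 t) (𝓝 (∫ z, f z ∂(freeLaw P Z B t)))
    simp_rw [hint]
    refine tendsto_integral_filter_of_dominated_convergence (fun _ ↦ ‖f‖)
      (Eventually.of_forall fun s ↦ ?_) (Eventually.of_forall fun s ↦ Eventually.of_forall fun m ↦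
        f.norm_coe_le_norm _) (integrable_const _) (Eventually.of_forall fun m ↦ ?_)
    · exact (f.continuous.measurable.comp (measurable_markTrajectory_apply s)).aestronglyMeasurable
    · exact (f.continuous.comp (continuous_markTrajectory m)).tendsto t
  have hsup := ProbabilityMeasure.limsup_measure_closed_le_of_tendsto hlim hF
  exact eventually_lt_of_limsup_lt (hsup.trans_lt h)

/-- Law of large numbers: at a fixed time, removing particles can only decrease the empirical
measure, which without removals converges to the law of a free particle. -/
lemma tendsto_measure_lt_regularProcess (θ : EuclideanSpace ℝ (Fin d) → ℝ) (ε : ℕ → ℝ)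
    {t : Icc (0 : ℝ≥0) T} {A : Set (Phase d)} (hA : MeasurableSet A) {c : ℝ}
    (hc : (freeLaw P Z B t).real A < c) :
    Tendsto (fun N ↦ P {ω | c < (regularProcess T θ (ε N) Z B e N ω t).toMeasure.real A})
      atTop (𝓝 0) := by
  classical
  set X : ℕ → Ω → Phase d := fun i ω ↦ markTrajectory (t : ℝ≥0) (mark Z B i ω) with hX
  have hXm : ∀ i, Measurable (X i) := fun i ↦
    (measurable_markTrajectory_apply _).comp (hP.measurable_mark i)
  set Y : ℕ → Ω → ℝ := fun i ω ↦ A.indicator 1 (X i ω) with hY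
  have hind : Measurable (A.indicator (1 : Phase d → ℝ)) := measurable_one.indicator hA
  have hYm : ∀ i, Measurable (Y i) := fun i ↦ hind.comp (hXm i)
  have hYi : Integrable (Y 0) P := by
    refine Integrable.of_bound (C := 1) (hYm 0).aestronglyMeasurable (Eventually.of_forall fun ω ↦ ?_)
    simp only [hY, indicator_apply]
    split_ifs <;> simp
  have hmean : ∫ ω, Y 0 ω ∂P = (freeLaw P Z B t).real A := by
    have h1 : Y 0 = (X 0 ⁻¹' A).indicator 1 := by ext ω; simp [hY, indicator_apply]
    rw [h1, integral_indicator_one (hXm 0 hA), hP.freeLaw_eq 0, map_measureReal_apply (hXm 0) hA]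
  have hsl := strong_law_ae_real Y hYi
    (fun i j hij ↦ ((hP.iIndepFun_mark.comp (fun _ ↦ markTrajectory (t : ℝ≥0))
      fun _ ↦ measurable_markTrajectory_apply _).comp (fun _ ↦ A.indicator 1)
        fun _ ↦ hind).indepFun hij)
    (fun i ↦ by
      have h : IdentDistrib (X i) (X 0) P P :=
        ⟨(hXm i).aemeasurable, (hXm 0).aemeasurable, by
          rw [← hP.freeLaw_eq i, ← hP.freeLaw_eq 0]⟩
      exact h.comp hind)
  have hmeas := tendstoInMeasure_of_tendsto_ae (fun N ↦ by
    have : Measurable fun ω ↦ (∑ i ∈ Finset.range N, Y i ω) / N :=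
      (Finset.measurable_sum _ fun i _ ↦ hYm i).div_const _
    exact this.aestronglyMeasurable) hsl
  have hgap : 0 < ENNReal.ofReal (c - (freeLaw P Z B t).real A) :=
    ENNReal.ofReal_pos.2 (sub_pos.2 hc)
  refine tendsto_of_tendsto_of_tendsto_of_le_of_le tendsto_const_nhds (hmeas _ hgap)
    (fun _ ↦ zero_le) fun N ↦ measure_mono fun ω hω ↦ ?_
  have h1 : (regularProcess T θ (ε N) Z B e N ω t).toMeasure.real A
      ≤ (∑ i ∈ Finset.range N, Y i ω) / N := by
    change (empiricalMeasure θ (ε N) Z (regularNoise B) e N ω t).toMeasure.real A ≤ _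
    rw [empiricalMeasure_regularNoise, measureReal_def]
    refine ENNReal.toReal_le_of_le_ofReal (div_nonneg (Finset.sum_nonneg fun i _ ↦
      indicator_nonneg (fun _ _ ↦ zero_le_one) _) N.cast_nonneg) ?_
    refine (weightedEmpirical_apply_le _ _ hA).trans_eq ?_
    rw [← Fin.sum_univ_eq_sum_range (fun i ↦ Y i ω), Finset.card_filter]
    rcases Nat.eq_zero_or_pos N with rfl | hN
    · simp
    rw [div_eq_inv_mul, ENNReal.ofReal_mul (by positivity),
      ENNReal.ofReal_inv_of_pos (by exact_mod_cast hN), ENNReal.ofReal_natCast]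
    congr 1
    rw [ENNReal.ofReal_sum_of_nonneg]
    · push_cast
      refine Finset.sum_congr rfl fun i _ ↦ ?_
      by_cases h : markTrajectory (t : ℝ≥0) (mark Z B i ω) ∈ A <;>
        simp [hY, hX, trajectories, h]
    · intro i _
      exact indicator_nonneg (fun _ _ ↦ zero_le_one) _
  have h2 : c < (∑ i ∈ Finset.range N, Y i ω) / N := lt_of_lt_of_le hω h1
  simp only [mem_ofPred_eq]
  rw [edist_dist, Real.dist_eq, hmean]
  refine ENNReal.ofReal_le_ofReal ((sub_le_sub_right h2.le _).trans (le_abs_self _))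

variable (hθ : IsInteractionKernel θ) {ε : ℕ → ℝ} (hε : ∀ N, 1 ≤ N → 0 < ε N)
include hθ hε

/-- A limit of the empirical processes gives no mass to the paths that stably exceed the free law at
a given time on a given open set. -/
lemma measure_interior_eq_zero {law : ℕ → ProbabilityMeasure (SkorokhodSpace T (SubProb (Phase d)))}
    (hlaw : ∀ N, (law N : Measure (SkorokhodSpace T (SubProb (Phase d))))
      = P.map (regularProcess T θ (ε N) Z B e N))
    {n : ℕ → ℕ} (hn : StrictMono n) {Q : ProbabilityMeasure (SkorokhodSpace T (SubProb (Phase d)))}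
    (hQ : Tendsto (fun k ↦ law (n k)) atTop (𝓝 Q)) {t : Icc (0 : ℝ≥0) T} {G : Set (Phase d)}
    (hG : MeasurableSet G) {c : ℝ} (hc : (freeLaw P Z B t).real G < c) :
    (Q : Measure (SkorokhodSpace T (SubProb (Phase d))))
      (interior {y : SkorokhodSpace T (SubProb (Phase d)) | c < (y t).toMeasure.real G}) = 0 := by
  set O := interior {y : SkorokhodSpace T (SubProb (Phase d)) | c < (y t).toMeasure.real G} with hO
  have hOo : IsOpen O := isOpen_interior
  have h1 := ProbabilityMeasure.le_liminf_measure_open_of_tendsto hQ hOo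
  have h2 : Tendsto (fun k ↦ (law (n k) : Measure (SkorokhodSpace T (SubProb (Phase d)))) O)
      atTop (𝓝 0) := by
    refine tendsto_of_tendsto_of_tendsto_of_le_of_le tendsto_const_nhds
      ((hP.tendsto_measure_lt_regularProcess θ ε hG hc).comp hn.tendsto_atTop)
      (fun _ ↦ zero_le) fun k ↦ ?_
    change (law (n k) : Measure (SkorokhodSpace T (SubProb (Phase d)))) O ≤ _
    rw [hlaw, Measure.map_apply
      (hP.measurable_regularProcess hθ fun h ↦ (hε _ h).le) hOo.measurableSet]
    have hsub : O ⊆ {y : SkorokhodSpace T (SubProb (Phase d)) | c < (y t).toMeasure.real G} :=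
      interior_subset
    exact measure_mono (preimage_mono hsub)
  rw [h2.liminf_eq] at h1
  exact le_antisymm h1 zero_le

/-- The limits of the empirical processes are dominated by the law of a free particle at all times:
an excess at some time on some open set would be stable, and visible at one of countably many
times on one of countably many open sets. -/
lemma ae_le_freeLaw {law : ℕ → ProbabilityMeasure (SkorokhodSpace T (SubProb (Phase d)))}
    (hlaw : ∀ N, (law N : Measure (SkorokhodSpace T (SubProb (Phase d))))
      = P.map (regularProcess T θ (ε N) Z B e N))
    {n : ℕ → ℕ} (hn : StrictMono n) {Q : ProbabilityMeasure (SkorokhodSpace T (SubProb (Phase d)))}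
    (hQ : Tendsto (fun k ↦ law (n k)) atTop (𝓝 Q)) :
    ∀ᵐ y ∂(Q : Measure (SkorokhodSpace T (SubProb (Phase d)))), ∀ t : Icc (0 : ℝ≥0) T,
      (y t).toMeasure ≤ freeLaw P Z B t := by
  have hprob := hP.isProbabilityMeasure_freeLaw
  obtain ⟨D, hDc, hD⟩ := TopologicalSpace.exists_countable_dense (Icc (0 : ℝ≥0) T)
  have hae : ∀ᵐ y ∂(Q : Measure (SkorokhodSpace T (SubProb (Phase d)))),
      ∀ s ∈ insert (endTime T) D, ∀ (S : Finset (TopologicalSpace.countableBasis (Phase d))) (c : ℚ),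
        (freeLaw P Z B s).real (⋃ b ∈ S, (b : Set (Phase d))) < c →
        y ∉ interior {y : SkorokhodSpace T (SubProb (Phase d)) |
          c < (y s).toMeasure.real (⋃ b ∈ S, (b : Set (Phase d)))} := by
    rw [ae_ball_iff (hDc.insert _)]
    intro s _
    rw [ae_all_iff]
    intro S
    rw [ae_all_iff]
    intro c
    by_cases hc : (freeLaw P Z B s).real (⋃ b ∈ S, (b : Set (Phase d))) < c
    · have hG : MeasurableSet (⋃ b ∈ S, (b : Set (Phase d))) := (isOpen_biUnion fun b _ ↦
        TopologicalSpace.isOpen_of_mem_countableBasis b.2).measurableSet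
      have h0 := hP.measure_interior_eq_zero hθ hε hlaw hn hQ hG hc
      filter_upwards [measure_eq_zero_iff_ae_notMem.1 h0] with y hy _ using hy
    · exact Eventually.of_forall fun _ h ↦ absurd h hc
  filter_upwards [hae] with y hy t
  refine measure_le_of_isOpen_le fun U hU ↦ ?_
  by_contra! hlt
  obtain ⟨K, hKU, hK, hlt'⟩ := hU.exists_lt_isCompact hlt
  obtain ⟨S, hKS, hSU⟩ := exists_finset_countableBasis hK hU hKU
  set G := ⋃ b ∈ S, (b : Set (Phase d)) with hG
  have hGo : IsOpen G := isOpen_biUnion fun b _ ↦ TopologicalSpace.isOpen_of_mem_countableBasis b.2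
  have h1 : (freeLaw P Z B t).real (closure G) < (y t).toMeasure.real G := by
    refine (ENNReal.toReal_lt_toReal (measure_ne_top _ _) (measure_ne_top _ _)).2 ?_
    exact (measure_mono hSU).trans_lt (hlt'.trans_le (measure_mono hKS))
  obtain ⟨c, hc1, hc2⟩ := exists_rat_btwn h1
  have hc0 : (0 : ℝ) ≤ c := measureReal_nonneg.trans hc1.le
  have hOo : IsOpen {μ : SubProb (Phase d) | (c : ℝ) < μ.toMeasure.real G} :=
    SubProb.isOpen_lt_measure hGo c
  rcases (le_endTime t).eq_or_lt with rfl | htT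
  · refine hy _ (mem_insert _ _) S c ((measureReal_mono subset_closure).trans_lt hc1) ?_
    have ho := SkorokhodSpace.isOpen_endTime_mem (T := T) hOo
    exact ho.interior_eq.symm ▸ hc2
  · obtain ⟨b, hbt, hb⟩ := SkorokhodSpace.exists_mem_interior (x := y) hOo hc2 htT
    have hc1' : freeLaw P Z B t (closure G) < ENNReal.ofReal c :=
      (ENNReal.lt_ofReal_iff_toReal_lt (by finiteness)).2 hc1
    have hev : ∀ᶠ s : Icc (0 : ℝ≥0) T in 𝓝 t, freeLaw P Z B s (closure G) < ENNReal.ofReal c :=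
      continuous_subtype_val.continuousAt.eventually
        (hP.eventually_freeLaw_lt isClosed_closure hc1')
    obtain ⟨V, hV, hVo, htV⟩ := _root_.mem_nhds_iff.1 hev
    have hbot : (𝓝[>] t).NeBot := nhdsGT_neBot_of_exists_gt ⟨_, htT⟩
    have hne : (V ∩ Ioo t b).Nonempty :=
      Filter.nonempty_of_mem (inter_mem (mem_nhdsWithin_of_mem_nhds (hVo.mem_nhds htV))
        (Ioo_mem_nhdsGT hbt))
    obtain ⟨s, ⟨hsV, hsb⟩, hsD⟩ := hD.inter_open_nonempty _ (hVo.inter isOpen_Ioo) hne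
    refine hy s (mem_insert_of_mem _ hsD) S c ?_ (hb s hsb)
    refine (measureReal_mono subset_closure).trans_lt ?_
    exact (ENNReal.lt_ofReal_iff_toReal_lt (by finiteness)).1 (hV hsV)

end IsDrivingNoise

end Limit

/-! ### Densities -/

section Densities

lemma rnDeriv_le_rnDeriv_of_le {X : Type*} [MeasurableSpace X] {μ ν ρ : Measure X}
    [IsFiniteMeasure μ] [IsFiniteMeasure ν] [SigmaFinite ρ] (h : μ ≤ ν) (hν : ν ≪ ρ) :
    ∀ᵐ x ∂ρ, μ.rnDeriv ρ x ≤ ν.rnDeriv ρ x := by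
  refine ae_le_of_forall_setLIntegral_le_of_sigmaFinite (Measure.measurable_rnDeriv _ _)
    fun s _ _ ↦ ?_
  rw [Measure.setLIntegral_rnDeriv (h.absolutelyContinuous.trans hν),
    Measure.setLIntegral_rnDeriv hν]
  exact h s

end Densities
end AnnihilatingParticles

theorem mainTheorem5 {d : ℕ} (hd : 1 ≤ d) (T : ℝ≥0)
    {f₀ : Phase d → ℝ} {Γ R : ℝ} (hf₀ : IsInitialDensity f₀ Γ R)
    {θ : EuclideanSpace ℝ (Fin d) → ℝ} (hθ : IsInteractionKernel θ)
    {ε : ℕ → ℝ} (hε : IsLocalScale d ε)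
    {Ω : Type*} [MeasurableSpace Ω] (P : Measure Ω) [IsProbabilityMeasure P]
    {Z : ℕ → Ω → Phase d} {B : ℕ → ℝ≥0 → Ω → EuclideanSpace ℝ (Fin d)}
    {e : ℕ → ℕ → ℕ → Ω → ℝ} (hP : IsDrivingNoise P f₀ Z B e) :
    (∀ t : ℝ≥0, HasLaw (freeParticle Z B 0 t) (volume.withDensity (freeDensity P Z B t)) P) ∧
    (∀ N : ℕ, ∀ᵐ ω ∂P, ∀ t : Icc (0 : ℝ≥0) T,
      empiricalProcess T θ ε Z B e N ω t = empiricalMeasure θ (ε N) Z B e N ω t) ∧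
    ∃ hm : ∀ N : ℕ, AEMeasurable (empiricalProcess T θ ε Z B e N) P,
      let law : ℕ → ProbabilityMeasure (SkorokhodSpace T (SubProb (Phase d))) :=
        fun N ↦ ProbabilityMeasure.map ⟨P, inferInstance⟩ (hm N)
      IsCompact (closure (law '' Ici 1)) ∧
      ∀ (n : ℕ → ℕ) (Q : ProbabilityMeasure (SkorokhodSpace T (SubProb (Phase d)))),
        StrictMono n → Tendsto (fun k ↦ law (n k)) atTop (𝓝 Q) →
        ∀ᵐ y ∂(Q : Measure (SkorokhodSpace T (SubProb (Phase d)))), ∀ t : Icc (0 : ℝ≥0) T,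
          ∃ f : Phase d → ℝ≥0∞, Measurable f ∧
            (y t).toMeasure = volume.withDensity f ∧
            ∀ᵐ z, f z ≤ freeDensity P Z B t z := by
  have hac : ∀ t, freeLaw P Z B t ≪ volume := hP.map_trajectory_absolutelyContinuous
  have hprob := hP.isProbabilityMeasure_freeLaw
  have hdens : ∀ t, freeDensity P Z B t = (freeLaw P Z B t).rnDeriv volume := fun t ↦ by
    rw [freeDensity, hP.map_freeParticle]
  have hproc : ∀ N, empiricalProcess T θ ε Z B e N =ᵐ[P] regularProcess T θ (ε N) Z B e N := by
    intro N
    filter_upwards [hP.ae_regularNoise_eq] with ω hω using empiricalProcess_eq_regularProcess hω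
  have hm : ∀ N, AEMeasurable (empiricalProcess T θ ε Z B e N) P := fun N ↦
    ⟨_, hP.measurable_regularProcess hθ fun h ↦ (hε.pos N h).le, hproc N⟩
  refine ⟨fun t ↦ ⟨hP.aemeasurable_freeParticle t, ?_⟩, fun N ↦ ?_, hm, ?_, ?_⟩
  · rw [hP.map_freeParticle, hdens, Measure.withDensity_rnDeriv_eq _ _ (hac t)]
  · filter_upwards [hP.ae_regularNoise_eq] with ω hω t
    rw [empiricalProcess_eq_regularProcess hω]
    exact empiricalMeasure_congr hω t
  · refine isCompact_closure_laws_of_tight hm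
      (V := fun N ↦ fadingProcess T θ (ε N) Z B e N)
      (fun N ↦ hP.measurable_fadingProcess hθ fun h ↦ (hε.pos N h).le)
      (fun κ hκ ↦ hP.exists_isCompact_fadingProcess hf₀ hθ hε.pos T hκ) fun κ hκ ↦ ?_
    obtain ⟨N₀, hN₀⟩ := hP.exists_measure_edist_fadingProcess_le hf₀ hθ hε.pos T hκ
    refine ⟨N₀, fun N hN ↦ le_trans (measure_mono_ae ?_) (hN₀ N hN)⟩
    filter_upwards [hproc N] with ω hω h
    have h' : (κ : ℝ≥0∞) < edist (empiricalProcess T θ ε Z B e N ω)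
      (fadingProcess T θ (ε N) Z B e N ω) := h
    rw [hω] at h'
    exact h'
  · intro n Q hn hQ
    have hlaw : ∀ N, (ProbabilityMeasure.map ⟨P, inferInstance⟩ (hm N) :
        Measure (SkorokhodSpace T (SubProb (Phase d))))
        = P.map (regularProcess T θ (ε N) Z B e N) := fun N ↦ Measure.map_congr (hproc N)
    filter_upwards [hP.ae_le_freeLaw hθ hε.pos hlaw hn hQ] with y hy t
    refine ⟨(y t).toMeasure.rnDeriv volume, Measure.measurable_rnDeriv _ _, ?_, ?_⟩
    · exact (Measure.withDensity_rnDeriv_eq _ _ ((hy t).absolutelyContinuous.trans (hac t))).symm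
    · rw [hdens]
      exact rnDeriv_le_rnDeriv_of_le (hy t) (hac t)
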